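/- Let $R$ be a commutative ring whose nilradical $\mathcal N R$ is a nilpotent ideal, and let $R((u))((t))^*$ be the group of invertible iterated Laurent series over $R$. Let $\mathbb Z(R)$ be the ring of locally constant functions $\operatorname{Spec} R\to\mathbf Z$. For a unit $a$ of an $R$-algebra and $\nu\in\mathbb Z(R)$, write $R=\bigoplus_s R_s$ (a finite product) with $\nu=n_s$ constant on $\operatorname{Spec} R_s$, write $a=\bigoplus_s a_s$, and put $a^\nu=\bigoplus_s a_s^{n_s}$. Order $\mathbf Z^2$ lexicographically. Every $f\in R((u))((t))^*$ has a unique decomposition $$f=f_0\,u^{\nu_2(f)}t^{\nu_1(f)}\prod_{(i,j)<(0,0)}(1-a_{i,j}u^jt^i)\prod_{(i,j)>(0,0)}(1-a_{i,j}u^jt^i),$$ where $f_0\in R^*$, $\nu_1(f),\nu_2(f)\in\mathbb Z(R)$, $a_{i,j}\in R$; where $a_{i,j}\in\mathcal N R$ for $(i,j)<(0,0)$, with $i$ and $j$ bounded below on the set of $(i,j)<(0,0)$ with $a_{i,j}\neq0$; where for each $i\ge 0$ the $j$ with $(i,j)>(0,0)$ and $a_{i,j}\ne 0$ are bounded below;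 and where the two products converge in the topology of $R((u))((t))$ with basic neighbourhoods of zero $t^mR((u))[[t]]+\sum_{i\in\mathbf Z}u^{m_i}t^iR[[u]]$ ($m,m_i\in\mathbf Z$). Put $\nu(f,g)=\nu_2(f)\nu_1(g)-\nu_2(g)\nu_1(f)$ and $$A=\nu(f,g)\nu(f,h)+\nu(g,h)\nu(g,f)+\nu(h,f)\nu(h,g)+\nu(f,g)\nu(f,h)\nu(g,h).$$ For $(i,j),(k,l),(m,n)\in\mathbf Z^2\setminus(0,0)$ and $a,b,c\in R$ attached to these indices define the following. * With $p=lm-nk$, $q=ni-jm$, $r=jk-li$: if $p,q,r$ are all positive or all negative, let $d$ be their greatest common divisor, taken with their common sign, and $T(a,b,c)=(1-a^{p/d}b^{q/d}c^{r/d})^{d}$; otherwise $T(a,b,c)=1$. * $S(a,b)=1$ if $jk-li\ne0$ or $jl+ik\ge0$ or $jl=0$; otherwise, with $e=\gcd(j,l)>0$, $S(a,b)=(1-a^{|l|/e}b^{|j|/e})^{-e\,l/|l|}$. * $Q(a,b)=1$ if $jk-li\ne0$ or $jl+ik\ge0$ or $ik=0$; otherwise, with $e=\gcd(i,k)>0$,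 $Q(a,b)=(1-a^{|k|/e}b^{|i|/e})^{e\,k/|k|}$. Let $f,g,h\in R((u))((t))^*$ have the coefficients $a_{i,j}$, $b_{k,l}$, $c_{m,n}$ in their decompositions. The two-dimensional Contou-Carrère symbol of $f,g,h$ is $$(f,g,h)=(-1)^A f_0^{\nu(g,h)}g_0^{\nu(h,f)}h_0^{\nu(f,g)}\prod T(a_{i,j},b_{k,l},c_{m,n})\cdot\prod S(a_{i,j},b_{k,l})^{\nu_1(h)}\prod Q(a_{i,j},b_{k,l})^{\nu_2(h)}\cdot\prod S(c_{m,n},a_{i,j})^{\nu_1(g)}\prod Q(c_{m,n},a_{i,j})^{\nu_2(g)}\cdot\prod S(b_{k,l},c_{m,n})^{\nu_1(f)}\prod Q(b_{k,l},c_{m,n})^{\nu_2(f)}\in R^*,$$ the products being over all indices in $\mathbf Z^2\setminus(0,0)$; only finitely many of the values of $T$, $S$ and $Q$ in them differ from $1$. The symbol $(\cdot,\cdot,\cdot)$ is tri-multiplicative, i.e. multiplicative in each of its three arguments, and it satisfies the Steinberg relations: if $f$, $1-f$ and $g$ are in $R((u))((t))^*$, then $(f,1-f,g)=(f,g,1-f)=(g,f,1-f)=1$.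 -/

import Mathlib

noncomputable section

namespace ContouCarrere

open TopologicalSpace

/-- The ring `R((u))((t))`: Laurent series in `t` whose coefficients are Laurent series in `u`.
The coefficient of `u ^ j * t ^ i` in `f` is `(f.coeff i).coeff j`. -/
abbrev Iterated (R : Type*) [CommRing R] : Type _ := LaurentSeries (LaurentSeries R)

/-- The group of locally constant integer-valued functions on `Spec R`. -/
abbrev LocInt (R : Type*) [CommRing R] : Type _ := LocallyConstant (PrimeSpectrum R) ℤ

section

variable {R : Type*} [CommRing R]

/-! ### Powers with locally constant exponents -/

/-- The idempotent of `R` that is `1` on the locus of `Spec R` where `ν = n` and `0` elsewhere. -/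
def idem (ν : LocInt R) (n : ℤ) : R :=
  (PrimeSpectrum.isIdempotentElemEquivClopens.symm
    (⟨ν ⁻¹' {n}, ν.isLocallyConstant.isClopen_fiber n⟩ : Clopens (PrimeSpectrum R))).1

lemma isIdempotentElem_idem (ν : LocInt R) (n : ℤ) : IsIdempotentElem (idem ν n) :=
  (PrimeSpectrum.isIdempotentElemEquivClopens.symm
    (⟨ν ⁻¹' {n}, ν.isLocallyConstant.isClopen_fiber n⟩ : Clopens (PrimeSpectrum R))).2

lemma idem_notMem_iff (ν : LocInt R) (n : ℤ) (p : PrimeSpectrum R) :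
    idem ν n ∉ p.asIdeal ↔ ν p = n := by
  have h := PrimeSpectrum.basicOpen_isIdempotentElemEquivClopens_symm
    (⟨ν ⁻¹' {n}, ν.isLocallyConstant.isClopen_fiber n⟩ : Clopens (PrimeSpectrum R))
  have h2 : p ∈ PrimeSpectrum.basicOpen (idem ν n) ↔ ν p = n := by
    unfold idem
    rw [h]
    rfl
  exact h2

lemma idem_mul_idem (ν : LocInt R) {n m : ℤ} (h : n ≠ m) : idem ν n * idem ν m = 0 := by
  have h1 : IsIdempotentElem (idem ν n * idem ν m) :=
    (isIdempotentElem_idem ν n).mul (isIdempotentElem_idem ν m)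
  apply PrimeSpectrum.basicOpen_injOn_isIdempotentElem h1 IsIdempotentElem.zero
  ext p
  simp only [PrimeSpectrum.basicOpen_mul, PrimeSpectrum.basicOpen_zero]
  constructor
  · rintro ⟨hn, hm⟩
    exact (h (((idem_notMem_iff ν n p).1 hn).symm.trans ((idem_notMem_iff ν m p).1 hm))).elim
  · intro hp
    exact hp.elim

lemma sum_idem (ν : LocInt R) : ∑ n ∈ ν.range_finite.toFinset, idem ν n = 1 := by
  have hid : IsIdempotentElem (∑ n ∈ ν.range_finite.toFinset, idem ν n) := by
    unfold IsIdempotentElem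
    rw [Finset.sum_mul_sum]
    refine Finset.sum_congr rfl fun n hn => ?_
    rw [Finset.sum_eq_single n (fun m _ hm => idem_mul_idem ν hm.symm) (fun h => (h hn).elim)]
    exact isIdempotentElem_idem ν n
  have hu : IsUnit (∑ n ∈ ν.range_finite.toFinset, idem ν n) := by
    by_contra hnu
    obtain ⟨M, hM, hmem⟩ := exists_max_ideal_of_mem_nonunits hnu
    have hp := (idem_notMem_iff ν _ ⟨M, hM.isPrime⟩).2 rfl
    apply hp
    have hmem2 := M.mul_mem_left (idem ν (ν ⟨M, hM.isPrime⟩)) hmem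
    rw [Finset.mul_sum, Finset.sum_eq_single (ν ⟨M, hM.isPrime⟩)
      (fun m _ hm => idem_mul_idem ν hm.symm)
      (fun h => (h (by simp)).elim), isIdempotentElem_idem] at hmem2
    exact hmem2
  exact (IsIdempotentElem.iff_eq_one_of_isUnit hu).1 hid

variable {A : Type*} [CommRing A]

/-- The element `⊕ aᵢ ^ nᵢ`, where `Spec R = ⊔ Uᵢ` with `ν = nᵢ` on `Uᵢ` and `a = ⊕ aᵢ`. -/
def powVal (φ : R →+* A) (a : Aˣ) (ν : LocInt R) : A :=
  ∑ n ∈ ν.range_finite.toFinset, φ (idem ν n) * ((a ^ n : Aˣ) : A)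

lemma powVal_mul_powVal_inv (φ : R →+* A) (a : Aˣ) (ν : LocInt R) :
    powVal φ a ν * powVal φ a⁻¹ ν = 1 := by
  unfold powVal
  rw [Finset.sum_mul_sum, ← map_one φ, ← sum_idem ν, map_sum]
  refine Finset.sum_congr rfl fun n hn => ?_
  rw [Finset.sum_eq_single n]
  · rw [mul_mul_mul_comm, ← map_mul, isIdempotentElem_idem, ← Units.val_mul, inv_zpow',
      ← zpow_add]
    simp
  · intro m _ hm
    rw [mul_mul_mul_comm, ← map_mul, idem_mul_idem ν hm.symm]
    simp
  · exact fun h => (h hn).elim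

/-- The power `a ^ ν` of a unit `a` of an `R`-algebra `φ : R → A`, for a locally constant function
`ν : Spec R → ℤ`. -/
def lpow (φ : R →+* A) (a : Aˣ) (ν : LocInt R) : Aˣ where
  val := powVal φ a ν
  inv := powVal φ a⁻¹ ν
  val_inv := powVal_mul_powVal_inv φ a ν
  inv_val := by rw [mul_comm]; exact powVal_mul_powVal_inv φ a ν

/-! ### Monomials and infinite products in `R((u))((t))` -/

/-- The inclusion of the constants `R → R((u))((t))`. -/
def constHom (R : Type*) [CommRing R] : R →+* Iterated R := HahnSeries.C.comp HahnSeries.C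

/-- The monomial `r * u ^ j * t ^ i`. -/
def mono (i j : ℤ) (r : R) : Iterated R :=
  HahnSeries.single i (HahnSeries.single j r)

lemma mono_mul_mono (i j k l : ℤ) (r s : R) :
    mono i j r * mono k l s = mono (i + k) (j + l) (r * s) := by
  simp [mono, HahnSeries.single_mul_single]

lemma mono_zero_one : mono (0 : ℤ) 0 (1 : R) = 1 := rfl

/-- The unit `u ^ j * t ^ i` of `R((u))((t))`. -/
def monoUnit (R : Type*) [CommRing R] (i j : ℤ) : (Iterated R)ˣ where
  val := mono i j 1
  inv := mono (-i) (-j) 1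
  val_inv := by rw [mono_mul_mono]; simp [mono_zero_one]
  inv_val := by rw [mono_mul_mono]; simp [mono_zero_one]

/-- The basic neighbourhood
`t ^ m * R((u))[[t]] + ∑ i, u ^ (k i) * t ^ i * R[[u]]` of `0` in `R((u))((t))`. -/
def basicNhd (R : Type*) [CommRing R] (m : ℤ) (k : ℤ → ℤ) : Set (Iterated R) :=
  {f | ∀ i < m, ∀ j < k i, (f.coeff i).coeff j = 0}

/-- The finite partial products of the family `φ` converge to `g` in the topology of
`R((u))((t))` whose basic neighbourhoods of `0` are the sets `basicNhd R m k`. -/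
def IsInfProd (φ : ℤ × ℤ → Iterated R) (g : Iterated R) : Prop :=
  ∀ (m : ℤ) (k : ℤ → ℤ), ∃ F₀ : Finset (ℤ × ℤ), ∀ F : Finset (ℤ × ℤ), F₀ ⊆ F →
    (∏ x ∈ F, φ x) - g ∈ basicNhd R m k

/-- `x > (0, 0)` lexicographically. -/
def LexPos (x : ℤ × ℤ) : Prop := 0 < x.1 ∨ (x.1 = 0 ∧ 0 < x.2)

/-- `x < (0, 0)` lexicographically. -/
def LexNeg (x : ℤ × ℤ) : Prop := x.1 < 0 ∨ (x.1 = 0 ∧ x.2 < 0)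

/-! ### The product decomposition of a unit of `R((u))((t))` -/

end

/-- The parameters of a product
`c * u ^ ν₂ * t ^ ν₁ * ∏ (1 - a (i, j) * u ^ j * t ^ i)` over `(i, j) ≠ (0, 0)`.
The coefficients with a negative index are nilpotent, and the supports are those for which the
products over the negative and over the positive indices converge. The unused value `a (0, 0)`
is normalized to be `0`. -/
@[ext] structure Factorization (R : Type*) [CommRing R] where
  /-- the constant factor -/
  c : Rˣ
  /-- the exponent of `t` -/
  ν₁ : LocInt R
  /-- the exponent of `u` -/
  ν₂ : LocInt R
  /-- the coefficients: `a (i, j)` belongs to `u ^ j * t ^ i` -/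
  a : ℤ × ℤ → R
  a_zero : a (0, 0) = 0
  nilp : ∀ x, LexNeg x → IsNilpotent (a x)
  bdd_neg : ∃ n m : ℤ, ∀ x, LexNeg x → a x ≠ 0 → n < x.1 ∧ m < x.2
  bdd_pos : ∀ i : ℤ, ∃ m : ℤ, ∀ j : ℤ, LexPos (i, j) → a (i, j) ≠ 0 → m < j

section

variable {R : Type*} [CommRing R]

instance : Inhabited (Factorization R) :=
  ⟨{ c := 1, ν₁ := 0, ν₂ := 0, a := 0, a_zero := rfl
     nilp := fun _ _ => IsNilpotent.zero
     bdd_neg := ⟨0, 0, fun _ _ h => (h rfl).elim⟩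
     bdd_pos := fun _ => ⟨0, fun _ _ h => (h rfl).elim⟩ }⟩

open Classical in
/-- The factor `1 - a (i, j) * u ^ j * t ^ i` if the index satisfies `P`, and `1` otherwise. -/
def Factorization.factor (D : Factorization R) (P : ℤ × ℤ → Prop) (x : ℤ × ℤ) : Iterated R :=
  if P x then 1 - mono x.1 x.2 (D.a x) else 1

/-- `f = c * u ^ ν₂ * t ^ ν₁ * ∏_{x < 0} (1 - a x) * ∏_{x > 0} (1 - a x)`. -/
def Factorization.Represents (D : Factorization R) (f : (Iterated R)ˣ) : Prop :=
  ∃ g₁ g₂ : Iterated R, IsInfProd (D.factor LexNeg) g₁ ∧ IsInfProd (D.factor LexPos) g₂ ∧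
    (f : Iterated R) = constHom R (D.c : R) *
      (lpow (constHom R) (monoUnit R 0 1) D.ν₂ : (Iterated R)ˣ) *
      (lpow (constHom R) (monoUnit R 1 0) D.ν₁ : (Iterated R)ˣ) * g₁ * g₂

open Classical in
/-- The decomposition of `f`. -/
def factorization (f : (Iterated R)ˣ) : Factorization R :=
  if h : ∃ D : Factorization R, D.Represents f then h.choose else default

/-! ### The factors `T`, `S`, `Q` of the explicit formula -/

open Classical in
/-- The unit `(1 - x) ^ d` for nilpotent `x`. -/
def oneSubPow (x : R) (d : ℤ) : Rˣ :=
  if h : IsNilpotent x then h.isUnit_one_sub.unit ^ d else 1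

/-- The determinant with columns `(x.2, x.1)` and `(y.2, y.1)`. -/
def det (x y : ℤ × ℤ) : ℤ := x.2 * y.1 - y.2 * x.1

/-- With `p = det y z`, `q = det z x`, `r = det x y` and `d = gcd (p, q, r)`, the element
`a ^ (|p| / d) * b ^ (|q| / d) * c ^ (|r| / d)`. -/
def tArg (x y z : ℤ × ℤ) (a b c : R) : R :=
  a ^ ((det y z).natAbs / ((det y z).gcd ((det z x).gcd (det x y)))) *
  b ^ ((det z x).natAbs / ((det y z).gcd ((det z x).gcd (det x y)))) *
  c ^ ((det x y).natAbs / ((det y z).gcd ((det z x).gcd (det x y))))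

/-- The value `T` on `1 - a u^j t^i`, `1 - b u^l t^k`, `1 - c u^n t^m`, where `x = (i, j)`,
`y = (k, l)`, `z = (m, n)`. The greatest common divisor in the exponent carries the common sign
of the three determinants. -/
def symT (x y z : ℤ × ℤ) (a b c : R) : Rˣ :=
  if 0 < det y z ∧ 0 < det z x ∧ 0 < det x y then
    oneSubPow (tArg x y z a b c) ((det y z).gcd ((det z x).gcd (det x y)))
  else if det y z < 0 ∧ det z x < 0 ∧ det x y < 0 then
    oneSubPow (tArg x y z a b c) (-((det y z).gcd ((det z x).gcd (det x y)) : ℤ))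
  else 1

/-- The value `S` on `1 - a u^j t^i`, `1 - b u^l t^k` (and `t`), where `x = (i, j)`,
`y = (k, l)`. -/
def symS (x y : ℤ × ℤ) (a b : R) : Rˣ :=
  if det x y ≠ 0 ∨ 0 ≤ x.2 * y.2 + x.1 * y.1 ∨ x.2 * y.2 = 0 then 1
  else oneSubPow (a ^ (y.2.natAbs / x.2.gcd y.2) * b ^ (x.2.natAbs / x.2.gcd y.2))
    (-(y.2.sign * x.2.gcd y.2))

/-- The value `Q` on `1 - a u^j t^i`, `1 - b u^l t^k` (and `u`), where `x = (i, j)`,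
`y = (k, l)`. -/
def symQ (x y : ℤ × ℤ) (a b : R) : Rˣ :=
  if det x y ≠ 0 ∨ 0 ≤ x.2 * y.2 + x.1 * y.1 ∨ x.1 * y.1 = 0 then 1
  else oneSubPow (a ^ (y.1.natAbs / x.1.gcd y.1) * b ^ (x.1.natAbs / x.1.gcd y.1))
    (y.1.sign * x.1.gcd y.1)

/-! ### The explicit formula -/

/-- `ν(f, g) = ν₂(f) ν₁(g) - ν₂(g) ν₁(f)`. -/
def nu (D E : Factorization R) : LocInt R := D.ν₂ * E.ν₁ - E.ν₂ * D.ν₁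

/-- The exponent of the sign. -/
def signExp (D E F : Factorization R) : LocInt R :=
  nu D E * nu D F + nu E F * nu E D + nu F D * nu F E + nu D E * nu D F * nu E F

/-- The factors `T` of three decompositions. -/
def termT (D E F : Factorization R) (w : (ℤ × ℤ) × (ℤ × ℤ) × (ℤ × ℤ)) : Rˣ :=
  symT w.1 w.2.1 w.2.2 (D.a w.1) (E.a w.2.1) (F.a w.2.2)

/-- The factors `S` of two decompositions. -/
def termS (D E : Factorization R) (w : (ℤ × ℤ) × (ℤ × ℤ)) : Rˣ :=
  symS w.1 w.2 (D.a w.1) (E.a w.2)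

/-- The factors `Q` of two decompositions. -/
def termQ (D E : Factorization R) (w : (ℤ × ℤ) × (ℤ × ℤ)) : Rˣ :=
  symQ w.1 w.2 (D.a w.1) (E.a w.2)

/-- The explicit formula in terms of decompositions. The factors with an index `(0, 0)` are `1`. -/
def formula (D E F : Factorization R) : Rˣ :=
  lpow (RingHom.id R) (-1 : Rˣ) (signExp D E F) *
  lpow (RingHom.id R) D.c (nu E F) * lpow (RingHom.id R) E.c (nu F D) *
  lpow (RingHom.id R) F.c (nu D E) *
  (∏ᶠ w, termT D E F w) *
  (∏ᶠ w, lpow (RingHom.id R) (termS D E w) F.ν₁) *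
  (∏ᶠ w, lpow (RingHom.id R) (termQ D E w) F.ν₂) *
  (∏ᶠ w, lpow (RingHom.id R) (termS F D w) E.ν₁) *
  (∏ᶠ w, lpow (RingHom.id R) (termQ F D w) E.ν₂) *
  (∏ᶠ w, lpow (RingHom.id R) (termS E F w) D.ν₁) *
  (∏ᶠ w, lpow (RingHom.id R) (termQ E F w) D.ν₂)

/-- The two-dimensional Contou-Carrère symbol of three units of `R((u))((t))`. -/
def symbol (f g h : (Iterated R)ˣ) : Rˣ :=
  formula (factorization f) (factorization g) (factorization h)

end

end ContouCarrere

end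

noncomputable section

namespace ContouCarrere

set_option linter.unusedSectionVars false

open Filter HahnSeries
open scoped Pointwise

/-! ### Coefficientwise limits and infinite products of Hahn series -/

section Convergence

variable {Γ R : Type*} [AddCommGroup Γ] [LinearOrder Γ] [IsOrderedAddMonoid Γ] [CommRing R]

/-! Iterated Laurent series are Hahn series over `ℤ × ℤ` with the lexicographic order, written with
monomials `X ^ x`. There the required convergence of products becomes coefficientwise stabilization
with supports in a common partially well-ordered set (`isInfProd_iff`).

Decomposition. The order of a unit modulo a prime is locally constant on the spectrum, which gives
`ν₁` and `ν₂`. After division by the monomial, the coefficients at negative indices are nilpotent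
and the constant one is a unit. A Birkhoff factorization (`exists_birkhoff`, `birkhoff_unique`)
splits the series into constant, negative and positive parts. The negative part is expanded as a
product by approximation along powers of the nilradical, the positive part by well-founded recursion
on the index.

Finiteness. A value of `T`, `S` or `Q` other than `1` requires a relation with positive integer
coefficients between the indices and a nonzero product of the corresponding powers of coefficients.
Well-ordering of the supports leaves finitely many such indices.

Symbol. The key is `dlog_formula`: for a derivation `δ` of the coefficients and constant orders, the
logarithmic derivative of the formula is the constant term of the 3 × 3 determinant of the
logarithmic derivatives of `f`, `g`, `h` under `δ`, `u ∂/∂u` and `t ∂/∂t`. This residue is additive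
in each argument, and it vanishes on `f, 1 - f, g` because the logarithmic derivatives of `f` and `1
- f` are proportional.

To integrate this information, the formula, which commutes with base change (`map_formula`), is
moved to a torsion-free ring. Localization at maximal ideals makes the orders constant, and a
nonzero ring with nilpotent nilradical is a quotient of a torsion-free ring `V` along which units
and nilpotents lift (`exists_isLift`). Over `V[X]` the lifted coefficients `a x` are replaced by `X
* a x`. At `X = 0` everything is a monomial and the claims concern the tame symbol, where they are
elementary; at `X = 1`, followed by the quotient map, the original data return. A unit of `V[X]`
with zero logarithmic derivative is constant, so the identity at `X = 0` carries over to `X = 1`.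
Cyclic invariance of the formula handles the other arguments. -/

/-- The index set no longer depends on the factors, so one finite sum serves all members of a net
with supports in `S` and `T`. -/
lemma coeff_mul_of_support_subset {x y : HahnSeries Γ R} {S T : Set Γ} (hS : S.IsPWO)
    (hT : T.IsPWO) (hx : x.support ⊆ S) (hy : y.support ⊆ T) (z : Γ) :
    (x * y).coeff z =
      ∑ ij ∈ Finset.antidiagonal hS hT z, x.coeff ij.1 * y.coeff ij.2 := by
  rw [coeff_mul_left' hS hx]
  refine Finset.sum_subset (Finset.antidiagonal_mono_right hy) fun ij h1 h2 => ?_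
  have : y.coeff ij.2 = 0 := by
    by_contra h
    rw [Finset.mem_antidiagonal] at h1 h2
    exact h2 ⟨h1.1, h, h1.2.2⟩
  rw [this, mul_zero]

/-- Coefficientwise eventual equality of a net of Hahn series whose supports lie in a common
partially well-ordered set. -/
structure TendstoCoeff {ι : Type*} (l : Filter ι) (f : ι → HahnSeries Γ R) (g : HahnSeries Γ R) :
    Prop where
  bdd : ∃ S : Set Γ, S.IsPWO ∧ ∀ i, (f i).support ⊆ S
  ev : ∀ z, ∀ᶠ i in l, (f i).coeff z = g.coeff z

namespace TendstoCoeff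

variable {ι : Type*} {l : Filter ι} {f f' : ι → HahnSeries Γ R} {g g' : HahnSeries Γ R}

lemma support_subset [l.NeBot] (h : TendstoCoeff l f g) {S : Set Γ}
    (hS : ∀ i, (f i).support ⊆ S) : g.support ⊆ S := by
  intro z hz
  obtain ⟨i, hi⟩ := (h.ev z).exists
  exact hS i (by rw [mem_support, hi]; exact hz)

lemma unique [l.NeBot] (h : TendstoCoeff l f g) (h' : TendstoCoeff l f g') : g = g' := by
  ext z
  obtain ⟨i, hi, hi'⟩ := ((h.ev z).and (h'.ev z)).exists
  rw [← hi, hi']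

lemma const (g : HahnSeries Γ R) : TendstoCoeff l (fun _ => g) g :=
  ⟨⟨g.support, g.isPWO_support, fun _ => subset_rfl⟩, fun _ => Eventually.of_forall fun _ => rfl⟩

lemma add (h : TendstoCoeff l f g) (h' : TendstoCoeff l f' g') :
    TendstoCoeff l (fun i => f i + f' i) (g + g') := by
  obtain ⟨S, hS, hf⟩ := h.bdd
  obtain ⟨T, hT, hf'⟩ := h'.bdd
  refine ⟨⟨S ∪ T, hS.union hT, fun i => ?_⟩, fun z => ?_⟩
  · exact Set.Subset.trans (support_add_subset _ _) (Set.union_subset_union (hf i) (hf' i))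
  · filter_upwards [h.ev z, h'.ev z] with i h1 h2
    simp [h1, h2]

lemma neg (h : TendstoCoeff l f g) : TendstoCoeff l (fun i => - f i) (- g) := by
  obtain ⟨S, hS, hf⟩ := h.bdd
  refine ⟨⟨S, hS, fun i => ?_⟩, fun z => ?_⟩
  · rw [support_neg]; exact hf i
  · filter_upwards [h.ev z] with i h1
    simp [h1]

lemma sub (h : TendstoCoeff l f g) (h' : TendstoCoeff l f' g') :
    TendstoCoeff l (fun i => f i - f' i) (g - g') := by
  simpa [sub_eq_add_neg] using h.add h'.neg

/-- A coefficient of the product involves only finitely many coefficients of the factors, indexed by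
the antidiagonal of the two bounding sets; all of them stabilize simultaneously. -/
lemma mul [l.NeBot] (h : TendstoCoeff l f g) (h' : TendstoCoeff l f' g') :
    TendstoCoeff l (fun i => f i * f' i) (g * g') := by
  obtain ⟨S, hS, hf⟩ := h.bdd
  obtain ⟨T, hT, hf'⟩ := h'.bdd
  refine ⟨⟨S + T, hS.add hT, fun i => ?_⟩, fun z => ?_⟩
  · exact support_mul_subset.trans (Set.add_subset_add (hf i) (hf' i))
  · have : ∀ᶠ i in l, ∀ ij ∈ Finset.antidiagonal hS hT z,
        (f i).coeff ij.1 = g.coeff ij.1 ∧ (f' i).coeff ij.2 = g'.coeff ij.2 := by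
      rw [eventually_all_finset]
      exact fun ij _ => (h.ev _).and (h'.ev _)
    filter_upwards [this] with i hi
    rw [coeff_mul_of_support_subset hS hT (hf i) (hf' i),
      coeff_mul_of_support_subset hS hT (h.support_subset hf) (h'.support_subset hf')]
    exact Finset.sum_congr rfl fun ij hij => by rw [(hi ij hij).1, (hi ij hij).2]

end TendstoCoeff

/-- The finite product `∏ (1 - a x X ^ x)` over `x ∈ F`. -/
def eprod (a : Γ → R) (F : Finset Γ) : HahnSeries Γ R := ∏ x ∈ F, (1 - single x (a x))

lemma eprod_empty (a : Γ → R) : eprod a ∅ = 1 := by simp [eprod]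

lemma eprod_insert (a : Γ → R) {F : Finset Γ} {y : Γ} (hy : y ∉ F) :
    eprod a (insert y F) = eprod a F - single y (a y) * eprod a F := by
  rw [eprod, Finset.prod_insert hy, ← eprod]; ring

lemma coeff_eprod_insert (a : Γ → R) {F : Finset Γ} {y : Γ} (hy : y ∉ F) (z : Γ) :
    (eprod a (insert y F)).coeff z = (eprod a F).coeff z - a y * (eprod a F).coeff (z - y) := by
  rw [eprod_insert a hy, coeff_sub, coeff_single_mul]

/-- A new factor with index `y` changes the coefficient at `z` by `a y` times the coefficient at `z
- y`, which is zero unless `a y ≠ 0` and `z - y ∈ S`. -/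
lemma coeff_eprod_eq_of_subset {a : Γ → R} {S : Set Γ} (hS : ∀ F, (eprod a F).support ⊆ S) {z : Γ}
    {F₀ F : Finset Γ} (hF₀ : ∀ y ∈ F, a y ≠ 0 → z - y ∈ S → y ∈ F₀) (hF : F₀ ⊆ F) :
    (eprod a F).coeff z = (eprod a F₀).coeff z := by
  classical
  have key : ∀ G : Finset Γ, G ⊆ F → Disjoint F₀ G →
      (eprod a (F₀ ∪ G)).coeff z = (eprod a F₀).coeff z := by
    intro G
    induction G using Finset.induction_on with
    | empty => simp
    | insert y G hy ih =>
      intro hG hd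
      rw [Finset.disjoint_insert_right] at hd
      rw [Finset.insert_subset_iff] at hG
      have hy' : y ∉ F₀ ∪ G := by simp [hd.1, hy]
      rw [Finset.union_insert, coeff_eprod_insert a hy', ih hG.2 hd.2]
      have : a y * (eprod a (F₀ ∪ G)).coeff (z - y) = 0 := by
        by_contra h
        exact hd.1 (hF₀ y hG.1 (left_ne_zero_of_mul h) (hS _ (right_ne_zero_of_mul h)))
      rw [this, sub_zero]
  rw [← Finset.union_sdiff_of_subset hF]
  exact key _ Finset.sdiff_subset Finset.disjoint_sdiff

/-- The indices that can influence the coefficient at `z` come from a finite antidiagonal, so the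
coefficient is constant once all of them are included. -/
lemma exists_tendstoCoeff_eprod {a : Γ → R} (ha : (Function.support a).IsPWO) {S : Set Γ}
    (hS : S.IsPWO) (h : ∀ F, (eprod a F).support ⊆ S) :
    ∃ g, TendstoCoeff atTop (eprod a) g := by
  classical
  let F₀ : Γ → Finset Γ := fun z => (Finset.antidiagonal ha hS z).image Prod.fst
  have hF₀ : ∀ z y, a y ≠ 0 → z - y ∈ S → y ∈ F₀ z := fun z y h1 h2 =>
    Finset.mem_image.2 ⟨(y, z - y), by simp [h1, h2], rfl⟩
  refine ⟨⟨fun z => (eprod a (F₀ z)).coeff z, hS.mono fun z hz => h _ hz⟩, ⟨S, hS, h⟩, fun z => ?_⟩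
  filter_upwards [eventually_ge_atTop (F₀ z)] with F hF
  exact coeff_eprod_eq_of_subset h (fun y _ => hF₀ z y) hF

/-! ### Products over positive indices -/

lemma support_eprod_subset_closure (a : Γ → R) (F : Finset Γ) :
    (eprod a F).support ⊆ AddSubmonoid.closure (Function.support a) := by
  classical
  induction F using Finset.induction_on with
  | empty =>
    intro z hz
    rw [eprod_empty, mem_support, coeff_one] at hz
    have : z = 0 := by by_contra h; simp [h] at hz
    rw [this]; exact zero_mem _
  | insert y F hy ih =>
    intro z hz
    rw [mem_support, coeff_eprod_insert a hy] at hz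
    by_cases h : (eprod a F).coeff z = 0
    · rw [h, zero_sub, neg_ne_zero] at hz
      have h1 : z - y ∈ AddSubmonoid.closure (Function.support a) := ih (right_ne_zero_of_mul hz)
      have h2 : y ∈ AddSubmonoid.closure (Function.support a) :=
        AddSubmonoid.subset_closure (left_ne_zero_of_mul hz)
      simpa using add_mem h1 h2
    · exact ih h

lemma exists_tendstoCoeff_eprod_pos {a : Γ → R} (ha : (Function.support a).IsPWO)
    (hpos : ∀ x, a x ≠ 0 → 0 < x) : ∃ g, TendstoCoeff atTop (eprod a) g :=
  exists_tendstoCoeff_eprod ha (ha.addSubmonoid_closure fun x hx => (hpos x hx).le)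
    (support_eprod_subset_closure a)

/-! ### Products over nilpotent coefficients -/

lemma isPWO_nsmul {T : Set Γ} (hT : T.IsPWO) (j : ℕ) : (j • T).IsPWO := by
  induction j with
  | zero => rw [zero_nsmul]; exact Set.isPWO_singleton _
  | succ j ih => rw [succ_nsmul]; exact ih.add hT

/-- In the expanded product, a term with at most `j` factors `a x` has its exponent in `j • T`,
since `0 ∈ T`. Outside this set every term contains at least `j + 1` elements of `I`. -/
lemma coeff_eprod_mem_pow {I : Ideal R} {a : Γ → R} (haI : ∀ x, a x ∈ I) {T : Set Γ}
    (hT0 : 0 ∈ T) (hT : Function.support a ⊆ T) (F : Finset Γ) (j : ℕ) {z : Γ} (hz : z ∉ j • T) :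
    (eprod a F).coeff z ∈ I ^ (j + 1) := by
  classical
  induction F using Finset.induction_on generalizing j z with
  | empty =>
    have h0 : (0 : Γ) ∈ j • T := by
      clear hz
      induction j with
      | zero => simp
      | succ j ih => rw [succ_nsmul]; exact ⟨0, ih, 0, hT0, by simp⟩
    have : z ≠ 0 := by rintro rfl; exact hz h0
    simp [eprod_empty, coeff_one, this]
  | insert y F hy ih =>
    rw [coeff_eprod_insert a hy]
    refine sub_mem (ih j hz) ?_
    by_cases hay : a y = 0
    · simp [hay]
    cases j with
    | zero => simpa using I.mul_mem_right _ (haI y)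
    | succ j =>
      rw [pow_succ']
      refine Ideal.mul_mem_mul (haI y) (ih j fun h => hz ?_)
      rw [succ_nsmul]
      exact ⟨z - y, h, y, hT hay, by simp⟩

lemma exists_tendstoCoeff_eprod_nilpotent {I : Ideal R} (hI : IsNilpotent I) {a : Γ → R}
    (haI : ∀ x, a x ∈ I) (ha : (Function.support a).IsPWO) :
    ∃ g, TendstoCoeff atTop (eprod a) g := by
  obtain ⟨k, hk⟩ := hI
  have hT : (insert 0 (Function.support a)).IsPWO := ha.insert 0
  refine exists_tendstoCoeff_eprod ha (isPWO_nsmul hT k) fun F z hz => ?_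
  by_contra hzT
  have := coeff_eprod_mem_pow haI (Set.mem_insert _ _) (Set.subset_insert _ _) F k hzT
  rw [pow_succ, hk] at this
  exact hz (by simpa using this)

end Convergence

/-! ### Birkhoff factorization modulo a nilpotent ideal -/

section Birkhoff

variable {Γ R : Type*} [AddCommGroup Γ] [LinearOrder Γ] [IsOrderedAddMonoid Γ] [CommRing R]

/-! ### Series with coefficients in an ideal -/

/-- The ideal of Hahn series with coefficients in `I`. -/
def coeffIdeal (Γ : Type*) [AddCommGroup Γ] [LinearOrder Γ] [IsOrderedAddMonoid Γ] (I : Ideal R) :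
    Ideal (HahnSeries Γ R) where
  carrier := {f | ∀ z, f.coeff z ∈ I}
  add_mem' hf hg z := by rw [coeff_add]; exact add_mem (hf z) (hg z)
  zero_mem' z := by simp
  smul_mem' c f hf z := by
    rw [smul_eq_mul, coeff_mul]
    exact sum_mem fun ij _ => I.mul_mem_left _ (hf _)

lemma mul_mem_coeffIdeal {I J : Ideal R} {f g : HahnSeries Γ R} (hf : f ∈ coeffIdeal Γ I)
    (hg : g ∈ coeffIdeal Γ J) : f * g ∈ coeffIdeal Γ (I * J) := fun z => by
  rw [coeff_mul]
  exact sum_mem fun ij _ => Ideal.mul_mem_mul (hf _) (hg _)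

lemma coeffIdeal_mono {I J : Ideal R} (h : I ≤ J) : coeffIdeal Γ I ≤ coeffIdeal Γ J :=
  fun _ hf z => h (hf z)

lemma pow_mem_coeffIdeal {I : Ideal R} {f : HahnSeries Γ R} (hf : f ∈ coeffIdeal Γ I) (n : ℕ) :
    f ^ n ∈ coeffIdeal Γ (I ^ n) := by
  induction n with
  | zero => intro z; simp
  | succ n ih => rw [pow_succ, pow_succ]; exact mul_mem_coeffIdeal ih hf

lemma isNilpotent_of_mem_coeffIdeal {I : Ideal R} (hI : IsNilpotent I) {f : HahnSeries Γ R}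
    (hf : f ∈ coeffIdeal Γ I) : IsNilpotent f := by
  obtain ⟨k, hk⟩ := hI
  refine ⟨k, ?_⟩
  ext z
  have := pow_mem_coeffIdeal hf k z
  rw [hk] at this
  simpa using this

lemma eq_zero_of_mem_coeffIdeal_bot {f : HahnSeries Γ R}
    (hf : f ∈ coeffIdeal Γ (0 : Ideal R)) : f = 0 := by
  ext z
  simpa using hf z

/-! ### Leading terms of products -/

lemma coeff_mul_add_of_le {f g : HahnSeries Γ R} {x y : Γ} (hf : ∀ z < x, f.coeff z = 0)
    (hg : ∀ z < y, g.coeff z = 0) : (f * g).coeff (x + y) = f.coeff x * g.coeff y := by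
  rw [coeff_mul]
  by_cases h : f.coeff x = 0 ∨ g.coeff y = 0
  · have h0 : f.coeff x * g.coeff y = 0 := by rcases h with h | h <;> simp [h]
    rw [h0]
    refine Finset.sum_eq_zero fun ij hij => ?_
    rw [Finset.mem_antidiagonal] at hij
    rcases lt_trichotomy ij.1 x with h1 | h1 | h1
    · simp [hf _ h1]
    · rw [h1] at hij ⊢
      rw [add_left_cancel hij.2.2, h0]
    · have : ij.2 < y := by
        by_contra hlt
        exact absurd hij.2.2 (add_lt_add_of_lt_of_le h1 (not_lt.1 hlt)).ne'
      simp [hg _ this]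
  · rw [not_or] at h
    rw [Finset.sum_eq_single (x, y)]
    · rintro ⟨i, j⟩ hij hne
      rw [Finset.mem_antidiagonal] at hij
      rcases lt_trichotomy i x with h1 | h1 | h1
      · simp [hf _ h1]
      · have h2 : j = y := by
          have := hij.2.2
          rw [h1] at this
          exact add_left_cancel this
        exact absurd (by rw [h1, h2]) hne
      · have : j < y := by
          by_contra hlt
          exact absurd hij.2.2 (add_lt_add_of_lt_of_le h1 (not_lt.1 hlt)).ne'
        simp [hg _ this]
    · intro hn
      exact absurd (by simp [h.1, h.2]) hn

lemma coeff_mul_eq_zero_of_lt {f g : HahnSeries Γ R} {x y : Γ} (hf : ∀ z < x, f.coeff z = 0)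
    (hg : ∀ z < y, g.coeff z = 0) {z : Γ} (hz : z < x + y) : (f * g).coeff z = 0 := by
  rw [coeff_mul]
  refine Finset.sum_eq_zero fun ij hij => ?_
  rw [Finset.mem_antidiagonal] at hij
  by_cases h1 : ij.1 < x
  · simp [hf _ h1]
  · have : ij.2 < y := by
      by_contra hlt
      rw [← hij.2.2] at hz
      exact absurd hz (not_lt.2 (add_le_add (not_lt.1 h1) (not_lt.1 hlt)))
    simp [hg _ this]

lemma coeff_mul_zero_of_nonpos {f g : HahnSeries Γ R} (hf : ∀ z, 0 < z → f.coeff z = 0)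
    (hg : ∀ z, 0 < z → g.coeff z = 0) : (f * g).coeff 0 = f.coeff 0 * g.coeff 0 := by
  rw [coeff_mul]
  have hrest : ∀ ij ∈ Finset.antidiagonal f.isPWO_support g.isPWO_support (0 : Γ),
      ij ≠ (0, 0) → f.coeff ij.1 * g.coeff ij.2 = 0 := by
    rintro ⟨i, j⟩ hij hne
    rw [Finset.mem_antidiagonal] at hij
    have hj : i = -j := eq_neg_of_add_eq_zero_left hij.2.2
    rcases lt_trichotomy 0 j with h | h | h
    · simp [hg _ h]
    · exact absurd (by rw [hj, ← h]; simp) hne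
    · have : 0 < i := by rw [hj]; exact neg_pos.2 h
      simp [hf _ this]
  by_cases h : f.coeff 0 ≠ 0 ∧ g.coeff 0 ≠ 0
  · rw [Finset.sum_eq_single (0, 0) hrest]
    intro hn
    exact absurd (by simp [h.1, h.2]) hn
  · have h0 : f.coeff 0 * g.coeff 0 = 0 := by
      by_contra h1
      exact h ⟨left_ne_zero_of_mul h1, right_ne_zero_of_mul h1⟩
    rw [h0]
    refine Finset.sum_eq_zero fun ij hij => ?_
    by_cases hij0 : ij = (0, 0)
    · rw [hij0]; exact h0
    · exact hrest ij hij hij0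

lemma coeff_mul_eq_zero_of_nonpos {f g : HahnSeries Γ R} (hf : ∀ z, 0 < z → f.coeff z = 0)
    (hg : ∀ z, 0 < z → g.coeff z = 0) {z : Γ} (hz : 0 < z) : (f * g).coeff z = 0 := by
  rw [coeff_mul]
  refine Finset.sum_eq_zero fun ij hij => ?_
  rw [Finset.mem_antidiagonal] at hij
  by_cases h1 : 0 < ij.1
  · simp [hf _ h1]
  · have : 0 < ij.2 := by
      by_contra hlt
      rw [← hij.2.2] at hz
      exact absurd hz (not_lt.2 (add_nonpos (not_lt.1 h1) (not_lt.1 hlt)))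
    simp [hg _ this]

/-! ### Positive and negative unipotent series -/

/-- Series of the form `1 + ∑_{x > 0} f x X ^ x`. -/
structure IsPosOne (f : HahnSeries Γ R) : Prop where
  neg : ∀ z < 0, f.coeff z = 0
  zero : f.coeff 0 = 1

/-- Series of the form `1 + ∑_{x < 0} f x X ^ x` with `f x ∈ I`. -/
structure IsNegOne (I : Ideal R) (f : HahnSeries Γ R) : Prop where
  pos : ∀ z, 0 < z → f.coeff z = 0
  zero : f.coeff 0 = 1
  neg : ∀ z < 0, f.coeff z ∈ I

lemma IsPosOne.one : IsPosOne (1 : HahnSeries Γ R) :=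
  ⟨fun z hz => by simp [coeff_one, hz.ne], by simp⟩

lemma IsNegOne.one (I : Ideal R) : IsNegOne I (1 : HahnSeries Γ R) :=
  ⟨fun z hz => by simp [coeff_one, hz.ne'], by simp, fun z hz => by simp [coeff_one, hz.ne]⟩

lemma IsPosOne.mul {f g : HahnSeries Γ R} (hf : IsPosOne f) (hg : IsPosOne g) :
    IsPosOne (f * g) := by
  refine ⟨fun z hz => coeff_mul_eq_zero_of_lt hf.neg hg.neg (by simpa using hz), ?_⟩
  have := coeff_mul_add_of_le hf.neg hg.neg
  simpa [hf.zero, hg.zero] using this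

lemma IsNegOne.sub_one_mem {I : Ideal R} {f : HahnSeries Γ R} (hf : IsNegOne I f) :
    f - 1 ∈ coeffIdeal Γ I := by
  intro z
  rw [coeff_sub, coeff_one]
  rcases lt_trichotomy z 0 with h | h | h
  · simpa [h.ne] using hf.neg z h
  · simp [h, hf.zero]
  · simp [h.ne', hf.pos z h]

lemma IsNegOne.mul {I : Ideal R} {f g : HahnSeries Γ R} (hf : IsNegOne I f) (hg : IsNegOne I g) :
    IsNegOne I (f * g) := by
  refine ⟨fun z hz => coeff_mul_eq_zero_of_nonpos hf.pos hg.pos hz, ?_, fun z hz => ?_⟩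
  · rw [coeff_mul_zero_of_nonpos hf.pos hg.pos, hf.zero, hg.zero, one_mul]
  · have h1 : f * g - 1 ∈ coeffIdeal Γ I := by
      have : f * g - 1 = (f - 1) * g + (g - 1) := by ring
      rw [this]
      exact add_mem (Ideal.mul_mem_right _ _ hf.sub_one_mem) hg.sub_one_mem
    simpa [coeff_one, hz.ne] using h1 z

lemma IsPosOne.isUnit {f : HahnSeries Γ R} (hf : IsPosOne f) : IsUnit f := by
  apply isUnit_of_orderTop_pos
  by_contra h
  rw [not_lt] at h
  have hne : (f - 1).orderTop ≠ ⊤ := fun h1 => by rw [h1] at h; simp at h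
  obtain ⟨x, hx⟩ := WithTop.ne_top_iff_exists.1 hne
  have h1 := coeff_orderTop_ne hx.symm
  rw [← hx] at h
  have hx0 : x ≤ 0 := by exact_mod_cast h
  rcases hx0.lt_or_eq with h2 | h2
  · simp [coeff_one, h2.ne, hf.neg x h2] at h1
  · simp [h2, hf.zero] at h1

/-- Since `f` starts with `1`, the product `f * g` has the same lowest term as `g`; for the product
to be `1` this term cannot sit at a negative index. -/
lemma IsPosOne.of_mul_eq_one {f g : HahnSeries Γ R} (hf : IsPosOne f) (h : f * g = 1) :
    IsPosOne g := by
  have hneg : ∀ z < 0, g.coeff z = 0 := by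
    by_contra hne
    push Not at hne
    obtain ⟨z, hz, hgz⟩ := hne
    have hg : g ≠ 0 := ne_zero_of_coeff_ne_zero hgz
    have ho : g.order ≤ z := order_le_of_coeff_ne_zero hgz
    have := coeff_mul_add_of_le hf.neg (fun z hz => coeff_eq_zero_of_lt_order (x := g) hz)
    rw [h, zero_add, hf.zero, one_mul, coeff_one, if_neg (ho.trans_lt hz).ne] at this
    exact hg (coeff_order_eq_zero.1 this.symm)
  refine ⟨hneg, ?_⟩
  have := coeff_mul_add_of_le hf.neg hneg
  rw [h, hf.zero] at this
  simpa using this.symm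

lemma IsNegOne.isUnit {I : Ideal R} (hI : IsNilpotent I) {f : HahnSeries Γ R}
    (hf : IsNegOne I f) : IsUnit f := by
  have := (isNilpotent_of_mem_coeffIdeal hI hf.sub_one_mem).isUnit_one_add
  simpa using this

/-- In `g = 1 - (f - 1) * g`, the series `f - 1` lives at negative indices with coefficients in `I`.
A coefficient of `g` at a positive index is thus an `I`-combination of coefficients at larger
positive indices; iteration puts it in every power of `I`. -/
lemma IsNegOne.of_mul_eq_one {I : Ideal R} (hI : IsNilpotent I) {f g : HahnSeries Γ R}
    (hf : IsNegOne I f) (h : f * g = 1) : IsNegOne I g := by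
  have hg : g = 1 - (f - 1) * g := by rw [sub_mul, h]; ring
  have hpos : ∀ z, 0 < z → g.coeff z = 0 := by
    have key : ∀ j : ℕ, ∀ z, 0 < z → g.coeff z ∈ I ^ j := by
      intro j
      induction j with
      | zero => simp
      | succ j ih =>
        intro z hz
        rw [hg, coeff_sub, coeff_one, if_neg hz.ne', coeff_mul, zero_sub]
        refine neg_mem (sum_mem fun ij hij => ?_)
        rw [Finset.mem_antidiagonal] at hij
        rcases lt_or_ge ij.1 0 with h1 | h1
        · rw [pow_succ']
          refine Ideal.mul_mem_mul (hf.sub_one_mem _) (ih _ ?_)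
          have : ij.2 = z - ij.1 := eq_sub_of_add_eq' hij.2.2
          rw [this]
          exact sub_pos.2 (h1.trans hz)
        · have : (f - 1).coeff ij.1 = 0 := by
            rcases h1.eq_or_lt with h1 | h1
            · simp [← h1, hf.zero]
            · simp [coeff_one, h1.ne', hf.pos _ h1]
          simp [this]
    obtain ⟨k, hk⟩ := hI
    intro z hz
    have := key k z hz
    rw [hk] at this
    simpa using this
  refine ⟨hpos, ?_, fun z hz => ?_⟩
  · have := coeff_mul_zero_of_nonpos hf.pos hpos
    rw [h, hf.zero] at this
    simpa using this.symm
  · rw [hg, coeff_sub, coeff_one, if_neg hz.ne, zero_sub]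
    exact neg_mem (Ideal.mul_mem_right _ _ hf.sub_one_mem z)

/-- Uniqueness of the decomposition into a constant, a negative and a positive part. -/
lemma birkhoff_unique {I : Ideal R} (hI : IsNilpotent I) {c c' : R} {n n' p p' : HahnSeries Γ R}
    (hn : IsNegOne I n) (hn' : IsNegOne I n') (hp : IsPosOne p) (hp' : IsPosOne p')
    (hc' : IsUnit c') (h : C c * n * p = C c' * n' * p') : c = c' ∧ n = n' ∧ p = p' := by
  obtain ⟨q, hq⟩ := hp.isUnit.exists_right_inv
  obtain ⟨m, hm⟩ := (hn'.isUnit hI).exists_right_inv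
  obtain ⟨e, he⟩ := hc'.exists_right_inv
  have hq1 := hp.of_mul_eq_one hq
  have hm1 := hn'.of_mul_eq_one hI hm
  have hCe : (C c' : HahnSeries Γ R) * C e = 1 := by rw [← map_mul, he, map_one]
  -- Moving the negative parts to one side and the positive parts to the other gives a series
  -- supported at nonpositive indices equal to one supported at nonnegative indices; both are then
  -- constant.
  have h1 : C (e * c) * (n * m) = p' * q := by
    have h2 : C c * n * p * (q * m * C e) = C c' * n' * p' * (q * m * C e) := by rw [h]
    have h3 : C c * n * p * (q * m * C e) = C (e * c) * (n * m) * (p * q) := by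
      rw [map_mul]; ring
    have h4 : C c' * n' * p' * (q * m * C e) = (C c' * C e) * (n' * m) * (p' * q) := by ring
    rw [h3, h4, hq, hm, hCe] at h2
    simpa using h2
  have hnm := hn.mul hm1
  have hpq := hp'.mul hq1
  have hec : e * c = 1 := by
    have := congrArg (fun f => f.coeff 0) h1
    simpa [C_mul_eq_smul, hnm.zero, hpq.zero] using this
  rw [hec, map_one, one_mul] at h1
  have hone : n * m = 1 := by
    ext z
    rw [coeff_one]
    rcases lt_trichotomy z 0 with hz | hz | hz
    · rw [h1, hpq.neg z hz, if_neg hz.ne]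
    · simp [hz, hnm.zero]
    · rw [hnm.pos z hz, if_neg hz.ne']
  refine ⟨?_, ?_, ?_⟩
  · calc c = (c' * e) * c := by rw [he, one_mul]
      _ = c' * (e * c) := by ring
      _ = c' := by rw [hec, mul_one]
  · calc n = n * (n' * m) := by rw [hm, mul_one]
      _ = (n * m) * n' := by ring
      _ = n' := by rw [hone, one_mul]
  · rw [hone] at h1
    calc p = (p' * q) * p := by rw [← h1, one_mul]
      _ = p' * (p * q) := by ring
      _ = p' := by rw [hq, mul_one]

/-- The series with the coefficients of `f` at the indices in `s`. -/
def restrict (s : Set Γ) (f : HahnSeries Γ R) : HahnSeries Γ R where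
  coeff := s.indicator f.coeff
  isPWO_support' := f.isPWO_support.mono fun z hz => by
    rw [Function.mem_support, Set.indicator_apply_ne_zero] at hz
    exact hz.2

lemma coeff_restrict_of_mem {s : Set Γ} {z : Γ} (hz : z ∈ s) (f : HahnSeries Γ R) :
    (restrict s f).coeff z = f.coeff z := Set.indicator_of_mem hz _

lemma coeff_restrict_of_notMem {s : Set Γ} {z : Γ} (hz : z ∉ s) (f : HahnSeries Γ R) :
    (restrict s f).coeff z = 0 := Set.indicator_of_notMem hz _

lemma restrict_mem_coeffIdeal {I : Ideal R} {f : HahnSeries Γ R} (hf : f ∈ coeffIdeal Γ I)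
    (s : Set Γ) : restrict s f ∈ coeffIdeal Γ I := fun z => by
  by_cases hz : z ∈ s
  · rw [coeff_restrict_of_mem hz]; exact hf z
  · rw [coeff_restrict_of_notMem hz]; exact I.zero_mem

lemma isUnit_of_coeff_isUnit {f : HahnSeries Γ R} {x : Γ} (hx : IsUnit (f.coeff x))
    (hlt : ∀ z < x, f.coeff z = 0) : IsUnit f := by
  obtain h | h := subsingleton_or_nontrivial R
  · exact isUnit_of_subsingleton f
  have ho : f.order = x := by
    have hf : f ≠ 0 := ne_zero_of_coeff_ne_zero hx.ne_zero
    refine le_antisymm (order_le_of_coeff_ne_zero hx.ne_zero) ?_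
    by_contra hlt'
    exact hf (coeff_order_eq_zero.1 (hlt _ (not_le.1 hlt')))
  refine isUnit_of_isUnit_leadingCoeff_AddUnitOrder ?_ (AddGroup.isAddUnit _)
  rw [leadingCoeff_eq, ho]
  exact hx

/-- A series whose first coefficient outside a nilpotent ideal is a unit is a unit. -/
lemma isUnit_of_coeff_isUnit_of_mem {I : Ideal R} (hI : IsNilpotent I) {f : HahnSeries Γ R} {x : Γ}
    (hx : IsUnit (f.coeff x)) (hlt : ∀ z < x, f.coeff z ∈ I) : IsUnit f := by
  have h1 : IsUnit (restrict (Set.Ici x) f) := by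
    refine isUnit_of_coeff_isUnit (x := x) ?_ fun z hz => ?_
    · rwa [coeff_restrict_of_mem (Set.mem_Ici.2 le_rfl)]
    · exact coeff_restrict_of_notMem (by simpa using hz) f
  have h2 : f - restrict (Set.Ici x) f ∈ coeffIdeal Γ I := by
    intro z
    rw [coeff_sub]
    by_cases hz : x ≤ z
    · rw [coeff_restrict_of_mem (Set.mem_Ici.2 hz)]; simp
    · rw [coeff_restrict_of_notMem (by simpa using hz), sub_zero]
      exact hlt z (not_le.1 hz)
  have h3 := (isNilpotent_of_mem_coeffIdeal hI h2).isUnit_add_right_of_commute h1 (Commute.all _ _)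
  simpa using h3

/-- Existence of the decomposition into a constant, a negative and a positive part. -/
lemma exists_birkhoff {I : Ideal R} (hI : IsNilpotent I) {g : HahnSeries Γ R}
    (hg : ∀ z < 0, g.coeff z ∈ I) (hg0 : IsUnit (g.coeff 0)) :
    ∃ (c : Rˣ) (n p : HahnSeries Γ R), IsNegOne I n ∧ IsPosOne p ∧ g = C (c : R) * n * p := by
  -- Successive approximation: the error `h` has coefficients in `I ^ (j + 1)`, which is zero for
  -- large `j`. The start truncates `g` to nonnegative indices.
  have key : ∀ j : ℕ, ∃ (c : Rˣ) (n p h : HahnSeries Γ R), IsNegOne I n ∧ IsPosOne p ∧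
      h ∈ coeffIdeal Γ (I ^ (j + 1)) ∧ g = C (c : R) * n * p * (1 + h) := by
    intro j
    induction j with
    | zero =>
      obtain ⟨c, hc⟩ := hg0
      set q := restrict (Set.Ici 0) g with hq
      have hq0 : q.coeff 0 = c := by rw [hq, coeff_restrict_of_mem (Set.mem_Ici.2 le_rfl), hc]
      have hqneg : ∀ z < 0, q.coeff z = 0 := fun z hz =>
        coeff_restrict_of_notMem (by simpa using hz) g
      have hqu : IsUnit q := isUnit_of_coeff_isUnit (x := 0) (by rw [hq0]; exact c.isUnit) hqneg
      obtain ⟨q', hq'⟩ := hqu.exists_right_inv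
      refine ⟨c, 1, C ((c⁻¹ : Rˣ) : R) * q, q' * (g - q), IsNegOne.one I, ⟨fun z hz => ?_, ?_⟩,
        ?_, ?_⟩
      · simp [hqneg z hz]
      · simp [hq0]
      · rw [zero_add, pow_one]
        refine Ideal.mul_mem_left _ _ fun z => ?_
        rw [coeff_sub]
        by_cases hz : 0 ≤ z
        · rw [hq, coeff_restrict_of_mem (Set.mem_Ici.2 hz)]; simp
        · rw [hqneg z (not_le.1 hz), sub_zero]
          exact hg z (not_le.1 hz)
      · have h1 : (C (c : R) : HahnSeries Γ R) * C ((c⁻¹ : Rˣ) : R) = 1 := by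
          rw [← map_mul]; simp
        calc g = q + (q * q') * (g - q) := by rw [hq']; ring
          _ = 1 * q * (1 + q' * (g - q)) := by ring
          _ = (C (c : R) * C ((c⁻¹ : Rˣ) : R)) * q * (1 + q' * (g - q)) := by rw [h1]
          _ = _ := by ring
    | succ j ih =>
      obtain ⟨c, n, p, h, hn, hp, hh, hgeq⟩ := ih
      set I' := I ^ (j + 1) with hI'
      have hI'I : I' ≤ I := Ideal.pow_le_self (by simp)
      have hI'nil : IsNilpotent I' := hI.pow_of_pos (by simp)
      set hm := restrict (Set.Iio 0) h with hhm
      set hp' := restrict (Set.Ioi 0) h with hhp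
      have hm_mem := restrict_mem_coeffIdeal hh (Set.Iio 0)
      have hp_mem := restrict_mem_coeffIdeal hh (Set.Ioi 0)
      rw [← hhm] at hm_mem
      rw [← hhp] at hp_mem
      have hr : h.coeff 0 ∈ I' := hh 0
      have hC_mem : C (h.coeff 0) ∈ coeffIdeal Γ I' := by
        intro z
        by_cases hz : z = 0
        · simpa [hz] using hr
        · simp [coeff_single_of_ne hz, C_apply]
      have hsum : h = hm + C (h.coeff 0) + hp' := by
        ext z
        rw [coeff_add, coeff_add]
        rcases lt_trichotomy z 0 with hz | hz | hz
        · rw [hhm, hhp, coeff_restrict_of_mem (by simpa using hz),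
            coeff_restrict_of_notMem (by simpa using hz.le)]
          simp [C_apply, coeff_single_of_ne hz.ne]
        · rw [hhm, hhp, coeff_restrict_of_notMem (by simp [hz]),
            coeff_restrict_of_notMem (by simp [hz])]
          simp [hz]
        · rw [hhm, hhp, coeff_restrict_of_notMem (by simpa using hz.le),
            coeff_restrict_of_mem (by simpa using hz)]
          simp [C_apply, coeff_single_of_ne hz.ne']
      have hu0 : IsUnit (1 + h.coeff 0) := by
        obtain ⟨k, hk⟩ := hI'nil
        refine IsNilpotent.isUnit_one_add ⟨k, ?_⟩
        have := Ideal.pow_mem_pow hr k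
        rw [hk] at this
        simpa using this
      have hum : IsUnit (1 + hm) := (isNilpotent_of_mem_coeffIdeal hI'nil hm_mem).isUnit_one_add
      have hup : IsUnit (1 + hp') := (isNilpotent_of_mem_coeffIdeal hI'nil hp_mem).isUnit_one_add
      have huC : IsUnit (1 + C (h.coeff 0) : HahnSeries Γ R) :=
        (isNilpotent_of_mem_coeffIdeal hI'nil hC_mem).isUnit_one_add
      obtain ⟨v, hv⟩ := ((hum.mul huC).mul hup).exists_right_inv
      have hnm : IsNegOne I (1 + hm) := by
        refine ⟨fun z hz => ?_, ?_, fun z hz => ?_⟩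
        · rw [coeff_add, coeff_one, if_neg hz.ne', hhm,
            coeff_restrict_of_notMem (by simpa using hz.le), add_zero]
        · rw [coeff_add, coeff_one, if_pos rfl, hhm, coeff_restrict_of_notMem (by simp), add_zero]
        · rw [coeff_add, coeff_one, if_neg hz.ne, zero_add]
          exact hI'I (hm_mem z)
      have hpp : IsPosOne (1 + hp') := by
        refine ⟨fun z hz => ?_, ?_⟩
        · rw [coeff_add, coeff_one, if_neg hz.ne, hhp,
            coeff_restrict_of_notMem (by simpa using hz.le), add_zero]
        · rw [coeff_add, coeff_one, if_pos rfl, hhp, coeff_restrict_of_notMem (by simp), add_zero]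
      obtain ⟨u, hu⟩ := hu0
      -- The negative, constant and positive parts of `h` are absorbed into the three factors. What
      -- remains consists of products of two different parts, multiplied by the inverse `v`, and so
      -- gains a power of `I`.
      refine ⟨c * u, n * (1 + hm), p * (1 + hp'),
        -(hm * C (h.coeff 0) + (hm + C (h.coeff 0) + hm * C (h.coeff 0)) * hp') * v,
        hn.mul hnm, hp.mul hpp, ?_, ?_⟩
      · refine Ideal.mul_mem_right _ _ (neg_mem ?_)
        have hle : I' * I' ≤ I ^ (j + 1 + 1) := by
          rw [pow_succ]
          exact Ideal.mul_mono le_rfl hI'I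
        refine coeffIdeal_mono hle (add_mem (mul_mem_coeffIdeal hm_mem hC_mem) ?_)
        exact mul_mem_coeffIdeal
          (add_mem (add_mem hm_mem hC_mem) (Ideal.mul_mem_right _ _ hm_mem)) hp_mem
      · have hCu : (C ((c * u : Rˣ) : R) : HahnSeries Γ R) = C (c : R) * (1 + C (h.coeff 0)) := by
          rw [Units.val_mul, hu, map_mul, map_add, map_one]
        rw [hCu, hgeq]
        have h5 : 1 + h = (1 + hm) * (1 + C (h.coeff 0)) * (1 + hp') *
            (1 + -(hm * C (h.coeff 0) + (hm + C (h.coeff 0) + hm * C (h.coeff 0)) * hp') * v) := by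
          have : (1 + hm) * (1 + C (h.coeff 0)) * (1 + hp') *
            (1 + -(hm * C (h.coeff 0) + (hm + C (h.coeff 0) + hm * C (h.coeff 0)) * hp') * v) =
            (1 + hm) * (1 + C (h.coeff 0)) * (1 + hp') -
            ((1 + hm) * (1 + C (h.coeff 0)) * (1 + hp') * v) *
            (hm * C (h.coeff 0) + (hm + C (h.coeff 0) + hm * C (h.coeff 0)) * hp') := by ring
          rw [this, hv]
          nth_rewrite 1 [hsum]
          ring
        rw [h5]
        ring
  obtain ⟨k, hk⟩ := hI
  obtain ⟨c, n, p, h, hn, hp, hh, hgeq⟩ := key k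
  refine ⟨c, n, p, hn, hp, ?_⟩
  rw [pow_succ, hk, zero_mul] at hh
  rw [hgeq, eq_zero_of_mem_coeffIdeal_bot hh, add_zero, mul_one]

end Birkhoff

/-! ### Expansion of negative and positive series as infinite products -/

section EulerProducts

variable {Γ R : Type*} [AddCommGroup Γ] [LinearOrder Γ] [IsOrderedAddMonoid Γ] [CommRing R]

lemma isPosOne_eprod {a : Γ → R} (ha : ∀ x, a x ≠ 0 → 0 < x) (F : Finset Γ) :
    IsPosOne (eprod a F) := by
  classical
  refine Finset.prod_induction _ IsPosOne (fun _ _ => IsPosOne.mul) IsPosOne.one fun x _ => ?_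
  by_cases hx : a x = 0
  · rw [hx, single_eq_zero, sub_zero]; exact IsPosOne.one
  · have := ha x hx
    refine ⟨fun z hz => ?_, ?_⟩
    · rw [coeff_sub, coeff_one, if_neg hz.ne, coeff_single_of_ne (hz.trans this).ne, sub_zero]
    · rw [coeff_sub, coeff_one, if_pos rfl, coeff_single_of_ne this.ne, sub_zero]

lemma isNegOne_eprod {I : Ideal R} {a : Γ → R} (haI : ∀ x, a x ∈ I) (ha : ∀ x, a x ≠ 0 → x < 0)
    (F : Finset Γ) : IsNegOne I (eprod a F) := by
  classical
  refine Finset.prod_induction _ (IsNegOne I) (fun _ _ => IsNegOne.mul) (IsNegOne.one I)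
    fun x _ => ?_
  by_cases hx : a x = 0
  · rw [hx, single_eq_zero, sub_zero]; exact IsNegOne.one I
  · have := ha x hx
    refine ⟨fun z hz => ?_, ?_, fun z hz => ?_⟩
    · rw [coeff_sub, coeff_one, if_neg hz.ne', coeff_single_of_ne (this.trans hz).ne', sub_zero]
    · rw [coeff_sub, coeff_one, if_pos rfl, coeff_single_of_ne this.ne', sub_zero]
    · rw [coeff_sub, coeff_one, if_neg hz.ne, zero_sub, coeff_single]
      split_ifs
      · exact neg_mem (haI x)
      · simp

lemma IsPosOne.of_tendsto {ι : Type*} {l : Filter ι} [l.NeBot] {f : ι → HahnSeries Γ R}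
    {g : HahnSeries Γ R} (hf : ∀ i, IsPosOne (f i)) (h : TendstoCoeff l f g) : IsPosOne g := by
  refine ⟨fun z hz => ?_, ?_⟩
  · obtain ⟨i, hi⟩ := (h.ev z).exists
    rw [← hi, (hf i).neg z hz]
  · obtain ⟨i, hi⟩ := (h.ev 0).exists
    rw [← hi, (hf i).zero]

lemma IsNegOne.of_tendsto {I : Ideal R} {ι : Type*} {l : Filter ι} [l.NeBot]
    {f : ι → HahnSeries Γ R} {g : HahnSeries Γ R} (hf : ∀ i, IsNegOne I (f i))
    (h : TendstoCoeff l f g) : IsNegOne I g := by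
  refine ⟨fun z hz => ?_, ?_, fun z hz => ?_⟩
  · obtain ⟨i, hi⟩ := (h.ev z).exists
    rw [← hi, (hf i).pos z hz]
  · obtain ⟨i, hi⟩ := (h.ev 0).exists
    rw [← hi, (hf i).zero]
  · obtain ⟨i, hi⟩ := (h.ev z).exists
    rw [← hi]
    exact (hf i).neg z hz

/-! ### The negative part -/

/-- First-order expansion: a change of the coefficients inside `I ^ m` changes the product by minus
the sum of the changes, since every cross term carries a further factor from `I`. -/
lemma eprod_sub_eprod_mem {I : Ideal R} {a b : Γ → R} (ha : ∀ x, a x ∈ I) (hb : ∀ x, b x ∈ I)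
    {m : ℕ} (hab : ∀ x, b x - a x ∈ I ^ m) (F : Finset Γ) :
    eprod b F - eprod a F + ∑ x ∈ F, single x (b x - a x) ∈ coeffIdeal Γ (I ^ (m + 1)) := by
  classical
  have hsingle : ∀ {J : Ideal R} {r : R} (x : Γ), r ∈ J → single x r ∈ coeffIdeal Γ J := by
    intro J r x hr z
    rw [coeff_single]
    split_ifs
    · exact hr
    · simp
  have hone : ∀ F : Finset Γ, eprod b F - 1 ∈ coeffIdeal Γ I := by
    intro F
    induction F using Finset.induction_on with
    | empty => simp [eprod_empty]
    | insert y F hy ih =>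
      rw [eprod_insert b hy, sub_right_comm]
      exact sub_mem ih (Ideal.mul_mem_right _ _ (hsingle y (hb y)))
  induction F using Finset.induction_on with
  | empty => simp [eprod_empty]
  | insert y F hy ih =>
    rw [eprod_insert b hy, eprod_insert a hy, Finset.sum_insert hy]
    set s := ∑ x ∈ F, single x (b x - a x) with hs
    have hsm : s ∈ coeffIdeal Γ (I ^ m) := sum_mem fun x _ => hsingle x (hab x)
    have hdiff : eprod b F - eprod a F ∈ coeffIdeal Γ (I ^ m) := by
      have : eprod b F - eprod a F = (eprod b F - eprod a F + s) - s := by ring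
      rw [this]
      exact sub_mem (coeffIdeal_mono (Ideal.pow_le_pow_right (Nat.le_succ m)) ih) hsm
    have hsub : single y (b y - a y) = single y (b y) - single y (a y) := by
      ext z
      simp only [coeff_single, coeff_sub]
      split_ifs <;> simp
    have heq : eprod b F - single y (b y) * eprod b F - (eprod a F - single y (a y) * eprod a F) +
        (single y (b y - a y) + s) = (eprod b F - eprod a F + s) -
        single y (b y - a y) * (eprod b F - 1) - single y (a y) * (eprod b F - eprod a F) := by
      rw [hsub]; ring
    rw [heq]
    refine sub_mem (sub_mem ih ?_) ?_
    · rw [pow_succ]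
      exact mul_mem_coeffIdeal (hsingle y (hab y)) (hone F)
    · rw [pow_succ']
      exact mul_mem_coeffIdeal (hsingle y (ha y)) hdiff

lemma coeff_sub_coeff_add_mem {I : Ideal R} {a b : Γ → R} {f g : HahnSeries Γ R}
    (ha : ∀ x, a x ∈ I) (hb : ∀ x, b x ∈ I) (hf : TendstoCoeff atTop (eprod a) f)
    (hg : TendstoCoeff atTop (eprod b) g)
    {m : ℕ} (hab : ∀ x, b x - a x ∈ I ^ m) (z : Γ) :
    g.coeff z - f.coeff z + (b z - a z) ∈ I ^ (m + 1) := by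
  classical
  obtain ⟨F, h1, h2, h3⟩ :=
    ((hf.ev z).and ((hg.ev z).and (eventually_ge_atTop {z}))).exists
  have := eprod_sub_eprod_mem ha hb hab F z
  rw [coeff_add, coeff_sub, h1, h2, coeff_sum, Finset.sum_eq_single z] at this
  · simpa using this
  · intro x _ hx
    exact coeff_single_of_ne hx.symm
  · intro hz
    exact absurd (h3 (Finset.mem_singleton_self z)) hz

/-- With equal limits, the first-order expansion improves `b - a ∈ I ^ m` to `b - a ∈ I ^ (m + 1)`,
so nilpotency of `I` forces equality. -/
lemma eprod_nilpotent_unique {I : Ideal R} (hI : IsNilpotent I) {a b : Γ → R}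
    {f : HahnSeries Γ R} (ha : ∀ x, a x ∈ I) (hb : ∀ x, b x ∈ I)
    (hf : TendstoCoeff atTop (eprod a) f) (hg : TendstoCoeff atTop (eprod b) f) : a = b := by
  have key : ∀ m : ℕ, ∀ x, b x - a x ∈ I ^ (m + 1) := by
    intro m
    induction m with
    | zero => intro x; simpa using sub_mem (hb x) (ha x)
    | succ m ih =>
      intro x
      simpa using coeff_sub_coeff_add_mem ha hb hf hg ih x
  obtain ⟨k, hk⟩ := hI
  ext x
  have := key k x
  rw [pow_succ, hk, zero_mul] at this
  exact (sub_eq_zero.1 (by simpa using this)).symm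

lemma exists_eprod_of_isNegOne {I : Ideal R} (hI : IsNilpotent I) {n : HahnSeries Γ R}
    (hn : IsNegOne I n) : ∃ a : Γ → R, (∀ x, a x ∈ I) ∧ (∀ x, a x ≠ 0 → x < 0) ∧
      (Function.support a).IsPWO ∧ TendstoCoeff atTop (eprod a) n := by
  have key : ∀ m : ℕ, ∃ (a : Γ → R) (f : HahnSeries Γ R), (∀ x, a x ∈ I) ∧
      (∀ x, a x ≠ 0 → x < 0) ∧ (Function.support a).IsPWO ∧ TendstoCoeff atTop (eprod a) f ∧
      n - f ∈ coeffIdeal Γ (I ^ (m + 1)) := by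
    intro m
    induction m with
    | zero =>
      refine ⟨0, 1, fun _ => I.zero_mem, fun x hx => absurd rfl hx, by simp, ?_, ?_⟩
      · have : (eprod (0 : Γ → R)) = fun _ => 1 := by funext F; simp [eprod]
        rw [this]
        exact TendstoCoeff.const 1
      · simpa using hn.sub_one_mem
    | succ m ih =>
      obtain ⟨a, f, haI, ha, hpwo, hf, hmem⟩ := ih
      have hfneg : IsNegOne I f := IsNegOne.of_tendsto (isNegOne_eprod haI ha) hf
      -- Newton correction by the defect `n - f`: to first order the product moves by the negative
      -- of the change in coefficients, so the new defect lies one power of `I` deeper.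
      set b : Γ → R := fun x => a x - (n - f).coeff x with hb
      have hle : I ^ (m + 1) ≤ I := Ideal.pow_le_self (by simp)
      have hbI : ∀ x, b x ∈ I := fun x => sub_mem (haI x) (hle (hmem x))
      have hbneg : ∀ x, b x ≠ 0 → x < 0 := by
        intro x hx
        by_contra h
        refine hx ?_
        have h1 : a x = 0 := by by_contra h1; exact h (ha x h1)
        rcases (not_lt.1 h).eq_or_lt with h2 | h2
        · subst h2
          simp [hb, h1, hn.zero, hfneg.zero]
        · simp [hb, h1, hn.pos x h2, hfneg.pos x h2]
      have hbpwo : (Function.support b).IsPWO := by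
        refine (hpwo.union (n - f).isPWO_support).mono fun x hx => ?_
        by_contra h
        simp only [Set.mem_union, Function.mem_support, mem_support, not_or, not_not] at h
        exact hx (by simp only [hb]; rw [h.1, h.2, sub_zero])
      obtain ⟨g, hg⟩ := exists_tendstoCoeff_eprod_nilpotent hI hbI hbpwo
      refine ⟨b, g, hbI, hbneg, hbpwo, hg, fun z => ?_⟩
      have hab : ∀ x, b x - a x ∈ I ^ (m + 1) := fun x => by
        have : b x - a x = -(n - f).coeff x := by simp only [hb]; ring
        rw [this]
        exact neg_mem (hmem x)
      have := coeff_sub_coeff_add_mem haI hbI hf hg hab z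
      have h3 : (n - g).coeff z = -(g.coeff z - f.coeff z + (b z - a z)) := by
        simp only [hb, coeff_sub]; ring
      rw [h3]
      exact neg_mem this
  obtain ⟨k, hk⟩ := hI
  obtain ⟨a, f, haI, ha, hpwo, hf, hmem⟩ := key k
  rw [pow_succ, hk, zero_mul] at hmem
  rw [sub_eq_zero.1 (eq_zero_of_mem_coeffIdeal_bot hmem)]
  exact ⟨a, haI, ha, hpwo, hf⟩

/-! ### The positive part -/

lemma eprod_congr {a b : Γ → R} {F : Finset Γ} (h : ∀ x ∈ F, a x = b x) :
    eprod a F = eprod b F := Finset.prod_congr rfl fun x hx => by rw [h x hx]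

lemma coeff_eprod_eq_neg_add {a : Γ → R} (ha : ∀ x, a x ≠ 0 → 0 < x)
    {F : Finset Γ} {x : Γ} (hx : x ∈ F) :
    (eprod a F).coeff x = - a x + (eprod a (F.erase x)).coeff x := by
  have := coeff_eprod_insert a (Finset.notMem_erase x F) x
  rw [Finset.insert_erase hx] at this
  rw [this, sub_self, (isPosOne_eprod ha _).zero]
  ring

lemma coeff_eprod_filter_le {a : Γ → R} (ha : ∀ x, a x ≠ 0 → 0 < x) (F : Finset Γ) (x : Γ) :
    (eprod a (F.filter (· ≤ x))).coeff x = (eprod a F).coeff x := by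
  refine (coeff_eprod_eq_of_subset (S := Set.Ici 0) (fun G z hz => ?_) (fun y hy _ hxy => ?_)
    (Finset.filter_subset _ _)).symm
  · by_contra h
    exact hz ((isPosOne_eprod ha G).neg z (by simpa using h))
  · rw [Finset.mem_filter]
    exact ⟨hy, by simpa using hxy⟩

/-- At the least index where `a` and `b` differ, factors with larger index do not matter and those
with smaller index agree; the coefficient there then determines `a x`. -/
lemma eprod_pos_unique {a b : Γ → R} {f : HahnSeries Γ R} (ha : ∀ x, a x ≠ 0 → 0 < x)
    (hb : ∀ x, b x ≠ 0 → 0 < x) (hapwo : (Function.support a).IsPWO)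
    (hbpwo : (Function.support b).IsPWO)
    (hf : TendstoCoeff atTop (eprod a) f) (hg : TendstoCoeff atTop (eprod b) f) : a = b := by
  classical
  by_contra hne
  set D : Set Γ := {x | a x ≠ b x} with hD
  have hDne : D.Nonempty := by
    obtain ⟨x, hx⟩ := Function.ne_iff.1 hne
    exact ⟨x, hx⟩
  have hDwf : D.IsWF := by
    refine ((hapwo.union hbpwo).mono fun x hx => ?_).isWF
    by_contra h
    simp only [Set.mem_union, Function.mem_support, not_or, not_not] at h
    exact hx (h.1.trans h.2.symm)
  set x := hDwf.min hDne with hx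
  have hxD : a x ≠ b x := hDwf.min_mem hDne
  have hlt : ∀ y < x, a y = b y := fun y hy => by
    by_contra h
    exact hDwf.not_lt_min hDne h hy
  obtain ⟨F, h1, h2, h3⟩ :=
    ((hf.ev x).and ((hg.ev x).and (eventually_ge_atTop {x}))).exists
  have hxF : x ∈ F := h3 (Finset.mem_singleton_self x)
  have hxF' : x ∈ F.filter (· ≤ x) := by simp [hxF]
  rw [← coeff_eprod_filter_le ha, coeff_eprod_eq_neg_add ha hxF'] at h1
  rw [← coeff_eprod_filter_le hb, coeff_eprod_eq_neg_add hb hxF', ← h1,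
    eprod_congr (a := b) (b := a)] at h2
  · exact hxD (neg_injective (add_right_cancel h2)).symm
  · intro y hy
    simp only [Finset.mem_erase, Finset.mem_filter] at hy
    exact (hlt y (lt_of_le_of_ne hy.2.2 hy.1)).symm

lemma exists_eprod_of_isPosOne {p : HahnSeries Γ R} (hp : IsPosOne p) :
    ∃ a : Γ → R, (∀ x, a x ≠ 0 → 0 < x) ∧ (Function.support a).IsPWO ∧
      TendstoCoeff atTop (eprod a) p := by
  classical
  have hsupp : ∀ x ∈ p.support, 0 ≤ x := fun x hx => by
    by_contra h
    exact hx (hp.neg x (not_le.1 h))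
  set S : Set Γ := (AddSubmonoid.closure p.support : Set Γ) with hS
  have hSpwo : S.IsPWO := p.isPWO_support.addSubmonoid_closure hsupp
  have hS0 : ∀ x ∈ S, 0 ≤ x := fun x hx =>
    AddSubmonoid.closure_induction (motive := fun x _ => 0 ≤ x) hsupp le_rfl
      (fun _ _ _ _ h1 h2 => add_nonneg h1 h2) hx
  let F₀ : Γ → Finset Γ := fun z => (Finset.antidiagonal hSpwo hSpwo z).image Prod.fst
  have hF₀ : ∀ z y, y ∈ F₀ z ↔ y ∈ S ∧ z - y ∈ S := by
    intro z y
    simp only [F₀, Finset.mem_image, Finset.mem_antidiagonal, Prod.exists, exists_and_right,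
      exists_eq_right]
    constructor
    · rintro ⟨w, h1, h2, h3⟩
      exact ⟨h1, by rw [← h3]; simpa using h2⟩
    · rintro ⟨h1, h2⟩
      exact ⟨z - y, h1, h2, by simp⟩
  have hwf : WellFounded fun x y : S => (x : Γ) < y := hSpwo.isWF
  -- The recursion solves for `a x` so that the coefficient of the product at `x` becomes `p.coeff
  -- x`. Indices in `F₀ x` other than `x` are smaller elements of `S`, so the default factor `1`
  -- never occurs.
  let α : S → R := hwf.fix fun x ih =>
    if 0 < (x : Γ) then
    - p.coeff x + (∏ y ∈ (F₀ x).erase x,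
      if h : ∃ hy : y ∈ S, y < x then 1 - single y (ih ⟨y, h.1⟩ h.2) else 1).coeff x else 0
  let a : Γ → R := fun x => if h : x ∈ S then α ⟨x, h⟩ else 0
  have haS : ∀ x, a x ≠ 0 → x ∈ S := fun x hx => by
    by_contra h
    exact hx (dif_neg h)
  have hpos : ∀ x, a x ≠ 0 → 0 < x := fun x hx => by
    by_contra h
    refine hx ?_
    simp only [a]
    rw [dif_pos (haS x hx)]
    simp only [α]
    rw [hwf.fix_eq, if_neg h]
  have haeq : ∀ x ∈ S, 0 < x → a x = - p.coeff x + (eprod a ((F₀ x).erase x)).coeff x := by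
    intro x hx hx0
    have h1 : a x = α ⟨x, hx⟩ := dif_pos hx
    rw [h1]
    simp only [α]
    rw [hwf.fix_eq, if_pos hx0]
    congr 2
    refine Finset.prod_congr rfl fun y hy => ?_
    rw [Finset.mem_erase, hF₀] at hy
    have hyx : y < x := lt_of_le_of_ne (by simpa using hS0 _ hy.2.2) hy.1
    rw [dif_pos ⟨hy.2.1, hyx⟩]
    have h2 : a y = α ⟨y, hy.2.1⟩ := dif_pos hy.2.1
    rw [h2]
  have hsub : Function.support a ⊆ S := haS
  have hSS : ∀ F, (eprod a F).support ⊆ S := fun F z hz =>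
    (AddSubmonoid.closure_le.2 hsub) (support_eprod_subset_closure a F hz)
  refine ⟨a, hpos, hSpwo.mono haS, ⟨S, hSpwo, hSS⟩, fun z => ?_⟩
  by_cases hz : z ∈ S
  · filter_upwards [eventually_ge_atTop (F₀ z)] with F hF
    rw [coeff_eprod_eq_of_subset hSS (fun y _ h1 h2 => (hF₀ z y).2 ⟨haS y h1, h2⟩) hF]
    rcases (hS0 z hz).eq_or_lt with h | h
    · rw [← h, (isPosOne_eprod hpos _).zero, hp.zero]
    · rw [coeff_eprod_eq_neg_add hpos ((hF₀ z z).2 ⟨hz, by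
        rw [sub_self]; exact zero_mem (AddSubmonoid.closure p.support)⟩), haeq z hz h]
      ring
  · refine Eventually.of_forall fun F => ?_
    have h1 : (eprod a F).coeff z = 0 := by
      by_contra h
      exact hz (hSS F h)
    have h2 : p.coeff z = 0 := by
      by_contra h
      exact hz (AddSubmonoid.subset_closure h)
    rw [h1, h2]

end EulerProducts

/-! ### Powers with locally constant exponents and base change -/

section LocallyConstantPowers

variable {R : Type*} [CommRing R]

lemma idem_eq_one {ν : LocInt R} {n : ℤ} (h : ∀ p, ν p = n) : idem ν n = 1 := by
  refine (IsIdempotentElem.iff_eq_one_of_isUnit ?_).1 (isIdempotentElem_idem ν n)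
  by_contra hnu
  obtain ⟨M, hM, hmem⟩ := exists_max_ideal_of_mem_nonunits hnu
  exact (idem_notMem_iff ν n ⟨M, hM.isPrime⟩).2 (h _) hmem

lemma idem_eq_zero {ν : LocInt R} {n : ℤ} (h : n ∉ Set.range ν) : idem ν n = 0 := by
  apply PrimeSpectrum.basicOpen_injOn_isIdempotentElem (isIdempotentElem_idem ν n)
    IsIdempotentElem.zero
  ext p
  simp only [PrimeSpectrum.basicOpen_zero]
  constructor
  · intro hp
    exact (h ⟨p, (idem_notMem_iff ν n p).1 hp⟩).elim
  · intro hp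
    exact hp.elim

variable {A B : Type*} [CommRing A] [CommRing B]

lemma lpow_eq_zpow {φ : R →+* A} {ν : LocInt R} {n : ℤ} (h : φ (idem ν n) = 1) (a : Aˣ) :
    lpow φ a ν = a ^ n := by
  have h0 : ∀ m, m ≠ n → φ (idem ν m) = 0 := fun m hm => by
    rw [← mul_one (φ (idem ν m)), ← h, ← map_mul, idem_mul_idem ν hm, map_zero]
  ext
  change powVal φ a ν = _
  unfold powVal
  rw [Finset.sum_eq_single n (fun m _ hm => by rw [h0 m hm, zero_mul]), h, one_mul]
  intro hn
  -- If the value `n` is not attained, the idempotent is `0`, so `0 = 1` in `A` and the claim is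
  -- trivial.
  rw [idem_eq_zero (by simpa using hn), map_zero] at h
  have := subsingleton_of_zero_eq_one h
  exact Subsingleton.elim _ _

lemma lpow_of_const {φ : R →+* A} {ν : LocInt R} {n : ℤ} (h : ∀ p, ν p = n) (a : Aˣ) :
    lpow φ a ν = a ^ n :=
  lpow_eq_zpow (by rw [idem_eq_one h, map_one]) a

lemma map_lpow (ψ : A →+* B) (φ : R →+* A) (a : Aˣ) (ν : LocInt R) :
    Units.map (ψ : A →* B) (lpow φ a ν) = lpow (ψ.comp φ) (Units.map (ψ : A →* B) a) ν := by
  ext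
  change ψ (powVal φ a ν) = powVal _ _ ν
  unfold powVal
  rw [map_sum]
  refine Finset.sum_congr rfl fun n _ => ?_
  rw [map_mul, ← map_zpow]
  rfl

lemma lpow_one (φ : R →+* A) (ν : LocInt R) : lpow φ (1 : Aˣ) ν = 1 := by
  ext
  change powVal φ 1 ν = 1
  unfold powVal
  simp only [one_zpow, Units.val_one, mul_one]
  rw [← map_sum, sum_idem, map_one]

/-- The pullback of a locally constant function on the spectrum along a ring homomorphism. -/
def LocInt.map (φ : R →+* A) (ν : LocInt R) : LocInt A :=
  ν.comap ⟨PrimeSpectrum.comap φ, PrimeSpectrum.continuous_comap φ⟩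

/-- Both sides are idempotents with the same basic open set, and an idempotent is determined by that
set. -/
lemma map_idem (φ : R →+* A) (ν : LocInt R) (n : ℤ) :
    φ (idem ν n) = idem (LocInt.map φ ν) n := by
  apply PrimeSpectrum.basicOpen_injOn_isIdempotentElem ((isIdempotentElem_idem ν n).map φ)
    (isIdempotentElem_idem _ n)
  ext p
  have h1 := idem_notMem_iff ν n (PrimeSpectrum.comap φ p)
  have h2 := idem_notMem_iff (LocInt.map φ ν) n p
  exact h1.trans h2.symm

lemma lpow_comp (ψ : A →+* B) (φ : R →+* A) (a : Bˣ) (ν : LocInt R) :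
    lpow (ψ.comp φ) a ν = lpow ψ a (LocInt.map φ ν) := by
  ext
  change powVal _ a ν = powVal _ a _
  unfold powVal
  have hc : ∀ n, ψ.comp φ (idem ν n) = ψ (idem (LocInt.map φ ν) n) := fun n => by
    rw [RingHom.comp_apply, map_idem]
  simp only [hc]
  refine (Finset.sum_subset ?_ fun n _ hn => ?_).symm
  · intro n hn
    simp only [Set.Finite.mem_toFinset, Set.mem_range] at hn ⊢
    obtain ⟨p, hp⟩ := hn
    exact ⟨PrimeSpectrum.comap φ p, hp⟩
  · rw [idem_eq_zero (by simpa using hn), map_zero, zero_mul]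

lemma map_lpow_id (φ : R →+* A) (a : Rˣ) (ν : LocInt R) :
    Units.map (φ : R →* A) (lpow (RingHom.id R) a ν) =
      lpow (RingHom.id A) (Units.map (φ : R →* A) a) (LocInt.map φ ν) := by
  rw [map_lpow, RingHom.comp_id, ← lpow_comp, RingHom.id_comp]

lemma mk_idem (p : PrimeSpectrum R) (ν : LocInt R) :
    Ideal.Quotient.mk p.asIdeal (idem ν (ν p)) = 1 := by
  have h := (isIdempotentElem_idem ν (ν p)).map (Ideal.Quotient.mk p.asIdeal)
  rcases IsIdempotentElem.iff_eq_zero_or_one.1 h with h | h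
  · exact absurd (Ideal.Quotient.eq_zero_iff_mem.1 h) ((idem_notMem_iff ν _ p).2 rfl)
  · exact h

end LocallyConstantPowers

/-! ### Iterated Laurent series as Hahn series over the lexicographic plane -/

section Iterated

variable {R S : Type*} [CommRing R] [CommRing S]

/-- The coefficientwise map of Hahn series induced by a ring homomorphism. -/
def hmap {Γ : Type*} [AddCommGroup Γ] [LinearOrder Γ] [IsOrderedAddMonoid Γ] (φ : R →+* S) :
    HahnSeries Γ R →+* HahnSeries Γ S where
  toFun f := f.map φ
  map_zero' := by ext; simp
  map_one' := by
    ext z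
    simp only [map_coeff, coeff_one]
    split_ifs <;> simp
  map_add' f g := by ext; simp
  map_mul' f g := HahnSeries.map_mul (φ : R →ₙ+* S)

section

variable {Γ : Type*} [AddCommGroup Γ] [LinearOrder Γ] [IsOrderedAddMonoid Γ]

@[simp] lemma coeff_hmap (φ : R →+* S) (f : HahnSeries Γ R) (z : Γ) :
    (hmap φ f).coeff z = φ (f.coeff z) := rfl

@[simp] lemma hmap_single (φ : R →+* S) (z : Γ) (r : R) :
    hmap φ (single z r) = single z (φ r) := by
  ext w
  simp only [coeff_hmap, coeff_single]
  split_ifs <;> simp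

@[simp] lemma hmap_C (φ : R →+* S) (r : R) :
    hmap φ (C r : HahnSeries Γ R) = C (φ r) := hmap_single φ 0 r

lemma hmap_eprod (φ : R →+* S) (a : Γ → R) (F : Finset Γ) :
    hmap φ (eprod a F) = eprod (fun x => φ (a x)) F := by
  simp [eprod, map_prod]

lemma TendstoCoeff.hmap {ι : Type*} {l : Filter ι} {f : ι → HahnSeries Γ R} {g : HahnSeries Γ R}
    (h : TendstoCoeff l f g) (φ : R →+* S) :
    TendstoCoeff l (fun i => hmap φ (f i)) (ContouCarrere.hmap φ g) := by
  obtain ⟨T, hT, hf⟩ := h.bdd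
  refine ⟨⟨T, hT, fun i z hz => hf i fun h => hz ?_⟩, fun z => ?_⟩
  · rw [coeff_hmap, h, map_zero]
  · filter_upwards [h.ev z] with i hi
    simp [hi]

/-- The unit `X ^ x`. -/
def xpow (R : Type*) [CommRing R] (x : Γ) : (HahnSeries Γ R)ˣ where
  val := single x 1
  inv := single (-x) 1
  val_inv := by simp [single_mul_single]
  inv_val := by simp [single_mul_single]

lemma coe_xpow (x : Γ) : (xpow R x : HahnSeries Γ R) = single x 1 := rfl

lemma xpow_add (x y : Γ) : xpow R (x + y) = xpow R x * xpow R y := by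
  ext1; simp [coe_xpow, single_mul_single]

lemma xpow_zsmul (x : Γ) (n : ℤ) : xpow R (n • x) = xpow R x ^ n := by
  let h : Multiplicative Γ →* (HahnSeries Γ R)ˣ :=
    { toFun := fun x => xpow R x.toAdd
      map_one' := by ext1; rfl
      map_mul' := fun x y => xpow_add _ _ }
  exact map_zpow h (Multiplicative.ofAdd x) n

lemma map_xpow (φ : R →+* S) (x : Γ) :
    Units.map ((hmap φ : HahnSeries Γ R →+* HahnSeries Γ S) : HahnSeries Γ R →* HahnSeries Γ S)
      (xpow R x) = xpow S x := by
  ext1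
  simp [coe_xpow]

end

/-- The lexicographically ordered group `ℤ × ℤ`. -/
abbrev LexZ : Type := ℤ ×ₗ ℤ

/-- The identification of iterated Laurent series with Hahn series over `ℤ × ℤ`. -/
def toHahn : Iterated R ≃+* HahnSeries LexZ R :=
  { iterateEquiv (Γ := ℤ) (Γ' := ℤ) with
    map_add' := fun f g => by ext z; rfl
    map_mul' := fun f g => by
      ext z
      change ((f * g).coeff (ofLex z).1).coeff (ofLex z).2 =
        (ofIterate f * ofIterate g).coeff z
      rw [coeff_mul, coeff_mul, coeff_sum]
      simp only [coeff_mul]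
      rw [Finset.sum_sigma']
      -- The nested sum over pairs of powers of `t` and then of `u` is the sum over pairs of
      -- lexicographic indices; a nonzero inner coefficient forces the outer one to be nonzero, so
      -- the supports match.
      refine Finset.sum_bij'
        (fun s _ => (toLex (s.1.1, s.2.1), toLex (s.1.2, s.2.2)))
        (fun w _ => ⟨((ofLex w.1).1, (ofLex w.2).1), ((ofLex w.1).2, (ofLex w.2).2)⟩)
        ?_ ?_ ?_ ?_ ?_
      · rintro ⟨⟨i, k⟩, ⟨j, l⟩⟩ h
        simp only [Finset.mem_sigma, Finset.mem_antidiagonal, mem_support] at h ⊢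
        refine ⟨h.2.1, h.2.2.1, ?_⟩
        rw [← toLex_add, Prod.mk_add_mk, h.1.2.2, h.2.2.2]
        rfl
      · rintro ⟨x, y⟩ h
        simp only [Finset.mem_sigma, Finset.mem_antidiagonal, mem_support] at h ⊢
        refine ⟨⟨ne_zero_of_coeff_ne_zero h.1, ne_zero_of_coeff_ne_zero h.2.1, ?_⟩,
          h.1, h.2.1, ?_⟩
        · rw [← h.2.2]; rfl
        · rw [← h.2.2]; rfl
      · rintro ⟨⟨i, k⟩, ⟨j, l⟩⟩ h
        rfl
      · rintro ⟨x, y⟩ h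
        rfl
      · rintro ⟨⟨i, k⟩, ⟨j, l⟩⟩ h
        rfl }

lemma coeff_toHahn (f : Iterated R) (z : LexZ) :
    (toHahn f).coeff z = (f.coeff (ofLex z).1).coeff (ofLex z).2 := rfl

lemma toHahn_mono (i j : ℤ) (r : R) : toHahn (mono i j r) = single (toLex (i, j)) r := by
  ext z
  rw [coeff_toHahn, mono, coeff_single, coeff_single]
  by_cases h1 : (ofLex z).1 = i
  · rw [if_pos h1, coeff_single]
    by_cases h2 : (ofLex z).2 = j
    · rw [if_pos h2, if_pos]
      rw [← h1, ← h2]; rfl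
    · rw [if_neg h2, if_neg]
      rintro rfl
      exact h2 rfl
  · rw [if_neg h1, if_neg, coeff_zero]
    rintro rfl
    exact h1 rfl

lemma toHahn_comp_constHom : (toHahn (R := R)).toRingHom.comp (constHom R) = C := by
  ext r : 1
  exact toHahn_mono 0 0 r

lemma map_toHahn_monoUnit (i j : ℤ) :
    Units.map ((toHahn (R := R)).toRingHom : Iterated R →* HahnSeries LexZ R) (monoUnit R i j) =
      xpow R (toLex (i, j)) := by
  ext1
  exact toHahn_mono i j 1

/-! ### Partially well-ordered sets in `ℤ × ℤ` -/

lemma isPWO_of_bddBelow {T : Set ℤ} (h : BddBelow T) : T.IsPWO :=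
  Set.isPWO_iff_isWF.2 h.wellFoundedOn_lt

lemma isPWO_lexZ {T : Set LexZ} {n : ℤ} {m : ℤ → ℤ} (h : ∀ x ∈ T, n ≤ (ofLex x).1 ∧
    m (ofLex x).1 ≤ (ofLex x).2) : T.IsPWO := by
  refine Set.PartiallyWellOrderedOn.subsetProdLex ?_ ?_
  · refine isPWO_of_bddBelow ⟨n, ?_⟩
    rintro _ ⟨x, hx, rfl⟩
    exact (h x hx).1
  · intro i
    refine isPWO_of_bddBelow ⟨m i, ?_⟩
    intro j hj
    exact (h _ hj).2

/-- Together with `isPWO_lexZ` this identifies partial well-ordering with the conditions in the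
decomposition: the powers of `t` are bounded below, and so are the powers of `u` for each power of
`t`. -/
lemma exists_bound_of_isPWO {T : Set LexZ} (hT : T.IsPWO) :
    ∃ (n : ℤ) (m : ℤ → ℤ), ∀ x ∈ T, n < (ofLex x).1 ∧ m (ofLex x).1 < (ofLex x).2 := by
  have key : ∀ {U : Set ℤ}, U.IsPWO → ∃ n : ℤ, ∀ x ∈ U, n < x := by
    intro U hU
    rcases U.eq_empty_or_nonempty with h | h
    · exact ⟨0, by simp [h]⟩
    · exact ⟨hU.isWF.min h - 1, fun x hx => by have := hU.isWF.min_le h hx; omega⟩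
  obtain ⟨n, hn⟩ := key (Set.PartiallyWellOrderedOn.imageProdLex hT)
  choose m hm using fun i => key (Set.PartiallyWellOrderedOn.fiberProdLex hT i)
  exact ⟨n, m, fun x hx => ⟨hn _ ⟨x, hx, rfl⟩, hm _ _ hx⟩⟩

/-- For series supported in `T`, membership in a basic neighbourhood of zero is a condition on
finitely many coefficients. This links the topology to coefficientwise stabilization. -/
lemma finite_window {T : Set LexZ} (hT : T.IsPWO) (m : ℤ) (k : ℤ → ℤ) :
    {x ∈ T | (ofLex x).1 < m ∧ (ofLex x).2 < k (ofLex x).1}.Finite := by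
  obtain ⟨n, b, h⟩ := exists_bound_of_isPWO hT
  refine ((Set.finite_Ico n m).biUnion (t := fun i =>
    Set.image (fun j => toLex (i, j)) (Set.Ico (b i) (k i)))
    fun i _ => (Set.finite_Ico _ _).image _).subset ?_
  rintro x ⟨hx, h1, h2⟩
  simp only [Set.mem_iUnion]
  exact ⟨(ofLex x).1, ⟨(h x hx).1.le, h1⟩, (ofLex x).2, ⟨(h x hx).2.le, h2⟩, rfl⟩

lemma isInfProd_iff {φ : ℤ × ℤ → Iterated R} {a : LexZ → R}
    (hφ : ∀ x, toHahn (φ x) = 1 - single (toLex x) (a (toLex x)))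
    (hex : ∃ g, TendstoCoeff atTop (eprod a) g) (f : Iterated R) :
    IsInfProd φ f ↔ TendstoCoeff atTop (eprod a) (toHahn f) := by
  have hprod : ∀ F : Finset (ℤ × ℤ),
      toHahn (∏ x ∈ F, φ x) = eprod a (F.map toLex.toEmbedding) := by
    intro F
    rw [map_prod, eprod, Finset.prod_map]
    exact Finset.prod_congr rfl fun x _ => hφ x
  have hmapmap : ∀ F : Finset LexZ,
      (F.map ofLex.toEmbedding).map (toLex (α := ℤ × ℤ)).toEmbedding = F := by
    intro F
    ext x
    simp
  constructor
  · intro h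
    obtain ⟨g, hg⟩ := hex
    refine ⟨hg.bdd, fun z => ?_⟩
    -- The smallest window of this shape that contains the index `z`; the inequalities in `basicNhd`
    -- are strict.
    obtain ⟨F₀, hF₀⟩ := h ((ofLex z).1 + 1) (fun _ => (ofLex z).2 + 1)
    filter_upwards [eventually_ge_atTop (F₀.map toLex.toEmbedding)] with F hF
    have h1 := hF₀ (F.map ofLex.toEmbedding) (fun x hx => by
      have : toLex x ∈ F := hF (by simpa using hx)
      simpa using this)
    have h2 := h1 (ofLex z).1 (by omega) (ofLex z).2 (by simp)
    rw [← coeff_toHahn, map_sub, hprod, hmapmap, coeff_sub, sub_eq_zero] at h2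
    exact h2
  · intro h m k
    obtain ⟨T, hT, hsub⟩ := h.bdd
    have hev : ∀ᶠ F in atTop, ∀ x ∈ {x ∈ T | (ofLex x).1 < m ∧ (ofLex x).2 < k (ofLex x).1},
        (eprod a F).coeff x = (toHahn f).coeff x := by
      rw [Filter.eventually_all_finite (finite_window hT m k)]
      exact fun x _ => h.ev x
    obtain ⟨F₀, hF₀⟩ := eventually_atTop.1 hev
    refine ⟨F₀.map ofLex.toEmbedding, fun F hF i hi j hj => ?_⟩
    have h1 := hF₀ (F.map toLex.toEmbedding) (fun x hx => by
      have : ofLex x ∈ F := hF (by simpa using hx)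
      simpa using this)
    change (toHahn (∏ x ∈ F, φ x - f)).coeff (toLex (i, j)) = 0
    rw [map_sub, hprod, coeff_sub, sub_eq_zero]
    by_cases hx : toLex (i, j) ∈ T
    · exact h1 _ ⟨hx, hi, hj⟩
    · have h2 : ∀ {g : HahnSeries LexZ R}, g.support ⊆ T → g.coeff (toLex (i, j)) = 0 := by
        intro g hg
        by_contra hne
        exact hx (hg hne)
      rw [h2 (hsub _), h2 (h.support_subset hsub)]

end Iterated

/-! ### Existence and uniqueness of the product decomposition -/

section Decomposition

variable {R S : Type*} [CommRing R] [CommRing S]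

lemma lexNeg_iff (x : ℤ × ℤ) : LexNeg x ↔ toLex x < 0 := by
  rw [Prod.Lex.lt_iff]; rfl

lemma lexPos_iff (x : ℤ × ℤ) : LexPos x ↔ 0 < toLex x := by
  rw [Prod.Lex.lt_iff]
  simp only [LexPos, ofLex_zero, Prod.fst_zero, Prod.snd_zero, ofLex_toLex, eq_comm]

namespace Factorization

/-- The coefficients at negative indices. -/
def aNeg (D : Factorization R) (x : LexZ) : R := if x < 0 then D.a (ofLex x) else 0

/-- The coefficients at positive indices. -/
def aPos (D : Factorization R) (x : LexZ) : R := if 0 < x then D.a (ofLex x) else 0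

lemma a_eq (D : Factorization R) (x : ℤ × ℤ) : D.a x = D.aNeg (toLex x) + D.aPos (toLex x) := by
  rcases lt_trichotomy (toLex x) 0 with h | h | h
  · simp [aNeg, aPos, h, h.le]
  · have : x = (0, 0) := h
    simp [aNeg, aPos, this, D.a_zero]
  · simp [aNeg, aPos, h, h.le]

lemma aNeg_lt (D : Factorization R) (x : LexZ) (h : D.aNeg x ≠ 0) : x < 0 := by
  by_contra hx
  simp [aNeg, hx] at h

lemma aPos_lt (D : Factorization R) (x : LexZ) (h : D.aPos x ≠ 0) : 0 < x := by
  by_contra hx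
  simp [aPos, hx] at h

lemma aNeg_mem (D : Factorization R) (x : LexZ) : D.aNeg x ∈ nilradical R := by
  rw [aNeg]
  split_ifs with h
  · exact D.nilp _ ((lexNeg_iff _).2 h)
  · simp

lemma isPWO_aNeg (D : Factorization R) : (Function.support D.aNeg).IsPWO := by
  obtain ⟨n, m, h⟩ := D.bdd_neg
  refine isPWO_lexZ (n := n) (m := fun _ => m) fun x hx => ?_
  have hlt := D.aNeg_lt x hx
  have := h (ofLex x) ((lexNeg_iff _).2 hlt) (by simpa [aNeg, hlt] using hx)
  exact ⟨this.1.le, this.2.le⟩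

lemma isPWO_aPos (D : Factorization R) : (Function.support D.aPos).IsPWO := by
  choose m h using D.bdd_pos
  refine isPWO_lexZ (n := 0) (m := m) fun x hx => ?_
  have hlt := D.aPos_lt x hx
  have := h (ofLex x).1 (ofLex x).2 ((lexPos_iff _).2 hlt) (by simpa [aPos, hlt] using hx)
  refine ⟨?_, this.le⟩
  rcases (lexPos_iff (ofLex x)).2 hlt with h1 | h1
  · exact h1.le
  · exact h1.1.ge

/-- The unit `u ^ ν₂ * t ^ ν₁`. -/
def monomial (ν₁ ν₂ : LocInt R) : (HahnSeries LexZ R)ˣ :=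
  lpow C (xpow R (toLex (0, 1))) ν₂ * lpow C (xpow R (toLex (1, 0))) ν₁

/-- The decomposition in terms of Hahn series over `ℤ × ℤ`. -/
def Decomposes (D : Factorization R) (f : HahnSeries LexZ R) : Prop :=
  ∃ n p : HahnSeries LexZ R, TendstoCoeff atTop (eprod D.aNeg) n ∧
    TendstoCoeff atTop (eprod D.aPos) p ∧
    f = C (D.c : R) * n * p * (monomial D.ν₁ D.ν₂).val

lemma exists_tendsto_aNeg (hR : IsNilpotent (nilradical R)) (D : Factorization R) :
    ∃ n, TendstoCoeff atTop (eprod D.aNeg) n :=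
  exists_tendstoCoeff_eprod_nilpotent hR D.aNeg_mem D.isPWO_aNeg

lemma exists_tendsto_aPos (D : Factorization R) :
    ∃ p, TendstoCoeff atTop (eprod D.aPos) p :=
  exists_tendstoCoeff_eprod_pos D.isPWO_aPos D.aPos_lt

lemma toHahn_factor_lexNeg (D : Factorization R) (x : ℤ × ℤ) :
    toHahn (D.factor LexNeg x) = 1 - single (toLex x) (D.aNeg (toLex x)) := by
  rw [factor, aNeg]
  by_cases h : LexNeg x
  · rw [if_pos h, if_pos ((lexNeg_iff x).1 h), map_sub, map_one, toHahn_mono]; rfl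
  · rw [if_neg h, if_neg (fun h' => h ((lexNeg_iff x).2 h')), map_one, single_eq_zero, sub_zero]

lemma toHahn_factor_lexPos (D : Factorization R) (x : ℤ × ℤ) :
    toHahn (D.factor LexPos x) = 1 - single (toLex x) (D.aPos (toLex x)) := by
  rw [factor, aPos]
  by_cases h : LexPos x
  · rw [if_pos h, if_pos ((lexPos_iff x).1 h), map_sub, map_one, toHahn_mono]; rfl
  · rw [if_neg h, if_neg (fun h' => h ((lexPos_iff x).2 h')), map_one, single_eq_zero, sub_zero]

lemma toHahn_lpow (i j : ℤ) (ν : LocInt R) :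
    toHahn (lpow (constHom R) (monoUnit R i j) ν : (Iterated R)ˣ).val =
      (lpow C (xpow R (toLex (i, j))) ν : (HahnSeries LexZ R)ˣ).val := by
  have := map_lpow (toHahn (R := R)).toRingHom (constHom R) (monoUnit R i j) ν
  rw [toHahn_comp_constHom, map_toHahn_monoUnit] at this
  exact congrArg Units.val this

lemma represents_iff (hR : IsNilpotent (nilradical R)) (D : Factorization R) (f : (Iterated R)ˣ) :
    D.Represents f ↔ D.Decomposes (toHahn (f : Iterated R)) := by
  have hc : toHahn (constHom R (D.c : R)) = C (D.c : R) :=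
    congrArg (fun φ : R →+* HahnSeries LexZ R => φ (D.c : R)) toHahn_comp_constHom
  have hN := isInfProd_iff D.toHahn_factor_lexNeg (D.exists_tendsto_aNeg hR)
  have hP := isInfProd_iff D.toHahn_factor_lexPos D.exists_tendsto_aPos
  constructor
  · rintro ⟨g₁, g₂, h1, h2, h3⟩
    refine ⟨toHahn g₁, toHahn g₂, (hN _).1 h1, (hP _).1 h2, ?_⟩
    rw [h3]
    simp only [map_mul, toHahn_lpow, hc, monomial, Units.val_mul]
    ring
  · rintro ⟨n, p, h1, h2, h3⟩
    refine ⟨toHahn.symm n, toHahn.symm p, (hN _).2 (by simpa using h1),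
      (hP _).2 (by simpa using h2), ?_⟩
    apply toHahn.injective
    rw [h3]
    simp only [map_mul, toHahn_lpow, hc, monomial, Units.val_mul, RingEquiv.apply_symm_apply]
    ring

lemma isNegOne_of_tendsto {D : Factorization R} {n : HahnSeries LexZ R}
    (h : TendstoCoeff atTop (eprod D.aNeg) n) : IsNegOne (nilradical R) n :=
  IsNegOne.of_tendsto (isNegOne_eprod D.aNeg_mem D.aNeg_lt) h

lemma isPosOne_of_tendsto {D : Factorization R} {p : HahnSeries LexZ R}
    (h : TendstoCoeff atTop (eprod D.aPos) p) : IsPosOne p :=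
  IsPosOne.of_tendsto (isPosOne_eprod D.aPos_lt) h

end Factorization

/-! ### The order of a unit at a prime -/

/-- The lexicographic order of `f` modulo the prime `p`. -/
def ordAt (f : HahnSeries LexZ R) (p : PrimeSpectrum R) : LexZ :=
  (hmap (Ideal.Quotient.mk p.asIdeal) f).order

lemma coeff_mem_of_lt_ordAt {f : HahnSeries LexZ R} {p : PrimeSpectrum R} {z : LexZ}
    (hz : z < ordAt f p) : f.coeff z ∈ p.asIdeal := by
  have := coeff_eq_zero_of_lt_order hz
  rwa [coeff_hmap, Ideal.Quotient.eq_zero_iff_mem] at this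

lemma ordAt_le {f : HahnSeries LexZ R} {p : PrimeSpectrum R} {z : LexZ}
    (hz : f.coeff z ∉ p.asIdeal) : ordAt f p ≤ z := by
  refine order_le_of_coeff_ne_zero ?_
  rwa [coeff_hmap, Ne, Ideal.Quotient.eq_zero_iff_mem]

lemma coeff_ordAt_notMem {f : HahnSeries LexZ R} (hf : IsUnit f) (p : PrimeSpectrum R) :
    f.coeff (ordAt f p) ∉ p.asIdeal := by
  intro h
  rw [← Ideal.Quotient.eq_zero_iff_mem, ← coeff_hmap] at h
  exact (hf.map (hmap (Ideal.Quotient.mk p.asIdeal))).ne_zero (coeff_order_eq_zero.1 h)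

lemma ordAt_mul {f g : HahnSeries LexZ R} (hf : IsUnit f) (hg : IsUnit g) (p : PrimeSpectrum R) :
    ordAt (f * g) p = ordAt f p + ordAt g p := by
  unfold ordAt
  rw [map_mul, order_mul (hf.map _).ne_zero (hg.map _).ne_zero]

lemma ordAt_one (p : PrimeSpectrum R) : ordAt (1 : HahnSeries LexZ R) p = 0 := by
  unfold ordAt
  rw [map_one, order_one]

/-- Near `p` the leading coefficients of `f` and of `f⁻¹` stay nonzero, so neither order can
increase. Their sum is always zero, so neither can decrease. -/
lemma isLocallyConstant_ordAt (f : (HahnSeries LexZ R)ˣ) :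
    IsLocallyConstant (ordAt (f : HahnSeries LexZ R)) := by
  rw [IsLocallyConstant.iff_exists_open]
  intro p
  have hadd : ∀ q, ordAt (f : HahnSeries LexZ R) q + ordAt (f⁻¹ : (HahnSeries LexZ R)ˣ) q = 0 := by
    intro q
    rw [← ordAt_mul f.isUnit (f⁻¹).isUnit, Units.mul_inv, ordAt_one]
  set x := ordAt (f : HahnSeries LexZ R) p with hx
  set y := ordAt ((f⁻¹ : (HahnSeries LexZ R)ˣ) : HahnSeries LexZ R) p with hy
  refine ⟨PrimeSpectrum.basicOpen ((f : HahnSeries LexZ R).coeff x) ⊓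
    PrimeSpectrum.basicOpen (((f⁻¹ : (HahnSeries LexZ R)ˣ) : HahnSeries LexZ R).coeff y),
    (PrimeSpectrum.basicOpen _ ⊓ PrimeSpectrum.basicOpen _).isOpen,
    ⟨coeff_ordAt_notMem f.isUnit p, coeff_ordAt_notMem (f⁻¹).isUnit p⟩, ?_⟩
  rintro q ⟨h1, h2⟩
  have h1' := ordAt_le (p := q) h1
  have h2' := ordAt_le (p := q) h2
  refine le_antisymm h1' ?_
  have e1 := hadd p
  have e2 := hadd q
  rw [← hx, ← hy] at e1
  rw [eq_neg_of_add_eq_zero_left e1, eq_neg_of_add_eq_zero_left e2]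
  exact neg_le_neg h2'

/-- Modulo `p` the idempotent of the locus through `p` becomes `1`, which turns the locally constant
exponents into the integers `ν₁ p` and `ν₂ p`. -/
lemma hmap_mk_monomial (ν₁ ν₂ : LocInt R) (p : PrimeSpectrum R) :
    hmap (Ideal.Quotient.mk p.asIdeal) (Factorization.monomial ν₁ ν₂ : (HahnSeries LexZ R)ˣ) =
      single (toLex (ν₁ p, ν₂ p)) 1 := by
  have h : ∀ (x : LexZ) (ν : LocInt R), hmap (Ideal.Quotient.mk p.asIdeal)
      (lpow C (xpow R x) ν : (HahnSeries LexZ R)ˣ) = single (ν p • x) 1 := by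
    intro x ν
    have := map_lpow (hmap (Ideal.Quotient.mk p.asIdeal)) C (xpow R x) ν
    rw [map_xpow] at this
    refine congrArg Units.val (this.trans ((lpow_eq_zpow ?_ _).trans (xpow_zsmul x (ν p)).symm))
    change hmap (Ideal.Quotient.mk p.asIdeal) (C (idem ν (ν p))) = 1
    rw [hmap_C, mk_idem, map_one]
  rw [Factorization.monomial, Units.val_mul, map_mul, h, h, single_mul_single, mul_one]
  have hx : ν₂ p • toLex ((0 : ℤ), (1 : ℤ)) + ν₁ p • toLex ((1 : ℤ), (0 : ℤ)) =
      toLex (ν₁ p, ν₂ p) := by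
    apply ofLex.injective
    ext <;> simp
  rw [hx]

lemma ordAt_monomial (ν₁ ν₂ : LocInt R) (p : PrimeSpectrum R) :
    ordAt (Factorization.monomial ν₁ ν₂ : (HahnSeries LexZ R)ˣ) p = toLex (ν₁ p, ν₂ p) := by
  unfold ordAt
  rw [hmap_mk_monomial, order_single one_ne_zero]

lemma ordAt_eq_zero {f : HahnSeries LexZ R} {p : PrimeSpectrum R}
    (h0 : f.coeff 0 ∉ p.asIdeal) (hneg : ∀ z < 0, f.coeff z ∈ p.asIdeal) : ordAt f p = 0 := by
  refine le_antisymm (ordAt_le h0) (not_lt.1 fun h => ?_)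
  have hne : hmap (Ideal.Quotient.mk p.asIdeal) f ≠ 0 := by
    refine ne_zero_of_coeff_ne_zero (g := 0) ?_
    rwa [coeff_hmap, Ne, Ideal.Quotient.eq_zero_iff_mem]
  refine hne (coeff_order_eq_zero.1 ?_)
  rw [coeff_hmap, Ideal.Quotient.eq_zero_iff_mem]
  exact hneg _ h

lemma IsNegOne.coeff_mul_sub_mem {I : Ideal R} {n : HahnSeries LexZ R} (hn : IsNegOne I n)
    (p : HahnSeries LexZ R) (z : LexZ) : (n * p).coeff z - p.coeff z ∈ I := by
  have : (n * p).coeff z - p.coeff z = ((n - 1) * p).coeff z := by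
    rw [sub_mul, one_mul, coeff_sub]
  rw [this]
  exact Ideal.mul_mem_right _ _ hn.sub_one_mem z

lemma coeff_C_mul_mul_of_neg {I : Ideal R} {n p : HahnSeries LexZ R} (hn : IsNegOne I n)
    (hp : IsPosOne p) (c : R) {z : LexZ} (hz : z < 0) : (C c * n * p).coeff z ∈ I := by
  have := hn.coeff_mul_sub_mem p z
  rw [hp.neg z hz, sub_zero] at this
  rw [mul_assoc, C_mul_eq_smul, coeff_smul, smul_eq_mul]
  exact I.mul_mem_left _ this

lemma coeff_C_mul_mul_zero {I : Ideal R} {n p : HahnSeries LexZ R} (hn : IsNegOne I n)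
    (hp : IsPosOne p) (c : R) : (C c * n * p).coeff 0 - c ∈ I := by
  have := hn.coeff_mul_sub_mem p 0
  rw [hp.zero] at this
  rw [mul_assoc, C_mul_eq_smul, coeff_smul, smul_eq_mul]
  have h2 := I.mul_mem_left c this
  rwa [mul_sub, mul_one] at h2

namespace Factorization

/-- Modulo a prime the coefficients at negative indices of the non-monomial part die and its
constant coefficient stays nonzero, so the order comes from the monomial alone. Hence `ν₁` and `ν₂`
are determined by `f`. -/
lemma ordAt_of_decomposes (hR : IsNilpotent (nilradical R)) {D : Factorization R}
    {f : HahnSeries LexZ R} (h : D.Decomposes f)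
    (p : PrimeSpectrum R) : ordAt f p = toLex (D.ν₁ p, D.ν₂ p) := by
  obtain ⟨n, q, hn, hq, rfl⟩ := h
  have hn' := isNegOne_of_tendsto hn
  have hq' := isPosOne_of_tendsto hq
  have hle : nilradical R ≤ p.asIdeal := nilradical_le_prime p.asIdeal
  have hu : IsUnit (C (D.c : R) * n * q) :=
    ((D.c.isUnit.map C).mul (hn'.isUnit hR)).mul hq'.isUnit
  rw [ordAt_mul hu (Units.isUnit _), ordAt_monomial, ordAt_eq_zero, zero_add]
  · intro hmem
    have h1 := hle (coeff_C_mul_mul_zero hn' hq' (D.c : R))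
    have h2 : (D.c : R) ∈ p.asIdeal := by
      have := sub_mem hmem h1
      rwa [sub_sub_cancel] at this
    exact p.isPrime.ne_top (Ideal.eq_top_of_isUnit_mem _ h2 D.c.isUnit)
  · exact fun z hz => hle (coeff_C_mul_mul_of_neg hn' hq' (D.c : R) hz)

lemma decomposes_unique (hR : IsNilpotent (nilradical R)) {D E : Factorization R}
    {f : HahnSeries LexZ R} (hD : D.Decomposes f) (hE : E.Decomposes f) : D = E := by
  have hord : ∀ p, toLex (D.ν₁ p, D.ν₂ p) = toLex (E.ν₁ p, E.ν₂ p) := fun p => by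
    rw [← ordAt_of_decomposes hR hD p, ← ordAt_of_decomposes hR hE p]
  have h1 : D.ν₁ = E.ν₁ := by
    ext p
    exact congrArg Prod.fst (toLex.injective (hord p))
  have h2 : D.ν₂ = E.ν₂ := by
    ext p
    exact congrArg Prod.snd (toLex.injective (hord p))
  obtain ⟨n, p, hn, hp, hf⟩ := hD
  obtain ⟨n', p', hn', hp', hf'⟩ := hE
  rw [hf, h1, h2, Units.mul_left_inj] at hf'
  obtain ⟨hc, rfl, rfl⟩ := birkhoff_unique hR (isNegOne_of_tendsto hn) (isNegOne_of_tendsto hn')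
    (isPosOne_of_tendsto hp) (isPosOne_of_tendsto hp') E.c.isUnit hf'
  have ha1 := eprod_nilpotent_unique hR D.aNeg_mem E.aNeg_mem hn hn'
  have ha2 := eprod_pos_unique D.aPos_lt E.aPos_lt D.isPWO_aPos E.isPWO_aPos hp hp'
  ext1
  · exact Units.ext hc
  · exact h1
  · exact h2
  · funext x
    rw [D.a_eq, E.a_eq, ha1, ha2]

/-- The factorization with given coefficients at negative and positive indices. -/
def ofParts (c : Rˣ) (ν₁ ν₂ : LocInt R) (a b : LexZ → R) (ha : ∀ x, a x ≠ 0 → x < 0)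
    (hb : ∀ x, b x ≠ 0 → 0 < x) (haN : ∀ x, a x ∈ nilradical R)
    (hapwo : (Function.support a).IsPWO) (hbpwo : (Function.support b).IsPWO) :
    Factorization R where
  c := c
  ν₁ := ν₁
  ν₂ := ν₂
  a x := a (toLex x) + b (toLex x)
  a_zero := by
    have h1 : a 0 = 0 := by by_contra h; exact lt_irrefl _ (ha 0 h)
    have h2 : b 0 = 0 := by by_contra h; exact lt_irrefl _ (hb 0 h)
    have : toLex ((0 : ℤ), (0 : ℤ)) = 0 := rfl
    rw [this, h1, h2, add_zero]
  nilp x hx := by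
    rw [lexNeg_iff] at hx
    have h2 : b (toLex x) = 0 := by by_contra h; exact lt_asymm hx (hb _ h)
    rw [h2, add_zero]
    exact haN _
  bdd_neg := by
    obtain ⟨n, m, h⟩ := exists_bound_of_isPWO hapwo
    -- For negative indices the power of `t` lies in the finite range `n < i ≤ 0`, so the separate
    -- bounds on the powers of `u` have a common one.
    obtain ⟨l, hl⟩ : ∃ l : ℤ, ∀ i : ℤ, n < i → i ≤ 0 → l ≤ m i := by
      obtain ⟨l, hl⟩ := ((Set.finite_Ioc n 0).image m).bddBelow
      exact ⟨l, fun i h1 h2 => hl ⟨i, ⟨h1, h2⟩, rfl⟩⟩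
    refine ⟨n, l, fun x hx hne => ?_⟩
    have hx' := (lexNeg_iff x).1 hx
    have h2 : b (toLex x) = 0 := by by_contra h; exact lt_asymm hx' (hb _ h)
    rw [h2, add_zero] at hne
    have h3 := h (toLex x) hne
    refine ⟨h3.1, (hl _ h3.1 ?_).trans_lt h3.2⟩
    rcases hx with h | h
    · exact h.le
    · exact h.1.le
  bdd_pos i := by
    obtain ⟨n, m, h⟩ := exists_bound_of_isPWO hbpwo
    refine ⟨m i, fun j hx hne => ?_⟩
    have hx' := (lexPos_iff _).1 hx
    have h2 : a (toLex (i, j)) = 0 := by by_contra h; exact lt_asymm hx' (ha _ h)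
    rw [h2, zero_add] at hne
    exact (h _ hne).2

lemma aNeg_ofParts {c : Rˣ} {ν₁ ν₂ : LocInt R} {a b : LexZ → R} (ha : ∀ x, a x ≠ 0 → x < 0)
    (hb : ∀ x, b x ≠ 0 → 0 < x) (haN : ∀ x, a x ∈ nilradical R)
    (hapwo : (Function.support a).IsPWO) (hbpwo : (Function.support b).IsPWO) :
    (ofParts c ν₁ ν₂ a b ha hb haN hapwo hbpwo).aNeg = a := by
  funext x
  rw [aNeg]
  split_ifs with h
  · have h2 : b x = 0 := by by_contra h'; exact lt_asymm h (hb _ h')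
    change a x + b x = a x
    rw [h2, add_zero]
  · by_contra h'
    exact h (ha x (Ne.symm h'))

lemma aPos_ofParts {c : Rˣ} {ν₁ ν₂ : LocInt R} {a b : LexZ → R} (ha : ∀ x, a x ≠ 0 → x < 0)
    (hb : ∀ x, b x ≠ 0 → 0 < x) (haN : ∀ x, a x ∈ nilradical R)
    (hapwo : (Function.support a).IsPWO) (hbpwo : (Function.support b).IsPWO) :
    (ofParts c ν₁ ν₂ a b ha hb haN hapwo hbpwo).aPos = b := by
  funext x
  rw [aPos]
  split_ifs with h
  · have h2 : a x = 0 := by by_contra h'; exact lt_asymm h (ha _ h')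
    change a x + b x = b x
    rw [h2, zero_add]
  · by_contra h'
    exact h (hb x (Ne.symm h'))

/-- After division by the monomial of its locally constant order, the series has order zero at every
prime. Its coefficients at negative indices then lie in all primes, and its constant coefficient
lies in no maximal ideal, which is what `exists_birkhoff` needs. -/
lemma exists_decomposes (hR : IsNilpotent (nilradical R)) (f : (HahnSeries LexZ R)ˣ) :
    ∃ D : Factorization R, D.Decomposes (f : HahnSeries LexZ R) := by
  let o : LocallyConstant (PrimeSpectrum R) LexZ := ⟨_, isLocallyConstant_ordAt f⟩
  let ν₁ : LocInt R := o.map fun x => (ofLex x).1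
  let ν₂ : LocInt R := o.map fun x => (ofLex x).2
  set g : (HahnSeries LexZ R)ˣ := f * (monomial ν₁ ν₂)⁻¹ with hg
  have hfg : f = g * monomial ν₁ ν₂ := by rw [hg, inv_mul_cancel_right]
  have hord : ∀ p, ordAt (g : HahnSeries LexZ R) p = 0 := by
    intro p
    have h1 : ordAt (f : HahnSeries LexZ R) p = toLex (ν₁ p, ν₂ p) := rfl
    rw [hfg, Units.val_mul, ordAt_mul g.isUnit (Units.isUnit _), ordAt_monomial] at h1
    exact left_eq_add.1 (h1.symm.trans (add_comm _ _)) |>.trans rfl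
  have hneg : ∀ z < 0, (g : HahnSeries LexZ R).coeff z ∈ nilradical R := by
    intro z hz
    rw [nilradical_eq_sInf, Ideal.mem_sInf]
    intro P hP
    exact coeff_mem_of_lt_ordAt (p := ⟨P, hP⟩) (by rwa [hord])
  have h0 : IsUnit ((g : HahnSeries LexZ R).coeff 0) := by
    by_contra hnu
    obtain ⟨M, hM, hmem⟩ := exists_max_ideal_of_mem_nonunits hnu
    have := coeff_ordAt_notMem g.isUnit ⟨M, hM.isPrime⟩
    rw [hord] at this
    exact this hmem
  obtain ⟨c, n, p, hn, hp, hgeq⟩ := exists_birkhoff hR hneg h0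
  obtain ⟨a, haN, ha, hapwo, hat⟩ := exists_eprod_of_isNegOne hR hn
  obtain ⟨b, hb, hbpwo, hbt⟩ := exists_eprod_of_isPosOne hp
  refine ⟨ofParts c ν₁ ν₂ a b ha hb haN hapwo hbpwo, n, p, ?_, ?_, ?_⟩
  · rwa [aNeg_ofParts]
  · rwa [aPos_ofParts]
  · rw [hfg, Units.val_mul, hgeq]
    rfl

end Factorization

/-- Existence and uniqueness of the decomposition. -/
theorem existsUnique_represents (hR : IsNilpotent (nilradical R)) (f : (Iterated R)ˣ) :
    ∃! D : Factorization R, D.Represents f := by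
  obtain ⟨D, hD⟩ := Factorization.exists_decomposes hR
    (Units.map ((toHahn (R := R)).toRingHom : Iterated R →* HahnSeries LexZ R) f)
  refine ⟨D, (D.represents_iff hR f).2 hD, fun E hE => ?_⟩
  exact Factorization.decomposes_unique hR ((E.represents_iff hR f).1 hE) hD

end Decomposition

/-! ### Positive relations between two or three lattice vectors -/

section Relations

/-! ### Linear relations between vectors in `ℤ × ℤ` -/

/-- The determinants of the three pairs are all positive or all negative. -/
def SameSign (x y z : ℤ × ℤ) : Prop :=
  (0 < det y z ∧ 0 < det z x ∧ 0 < det x y) ∨ (det y z < 0 ∧ det z x < 0 ∧ det x y < 0)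

/-- The greatest common divisor of the determinants of the three pairs. -/
def detGcd (x y z : ℤ × ℤ) : ℕ := (det y z).gcd ((det z x).gcd (det x y))

lemma detGcd_pos {x y z : ℤ × ℤ} (h : SameSign x y z) : 0 < detGcd x y z := by
  refine Nat.pos_of_ne_zero fun h0 => ?_
  rw [detGcd, Int.gcd_eq_zero_iff] at h0
  rcases h with h | h <;> omega

lemma detGcd_dvd (x y z : ℤ × ℤ) : detGcd x y z ∣ (det y z).natAbs ∧
    detGcd x y z ∣ (det z x).natAbs ∧ detGcd x y z ∣ (det x y).natAbs := by
  have h1 : ((detGcd x y z : ℕ) : ℤ) ∣ ((det z x).gcd (det x y) : ℕ) := Int.gcd_dvd_right ..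
  refine ⟨Int.natCast_dvd.1 (Int.gcd_dvd_left ..), ?_, ?_⟩
  · exact Int.natCast_dvd.1 (h1.trans (Int.gcd_dvd_left ..))
  · exact Int.natCast_dvd.1 (h1.trans (Int.gcd_dvd_right ..))

/-- Cramer's identity `det y z • x + det z x • y + det x y • z = 0`, divided by the gcd with the
common sign, is a positive primitive relation. Relations between three vectors spanning the plane
form a line, so the others are multiples of it. The quotients are the exponents in `tArg`. -/
lemma exists_relation_of_sameSign {x y z : ℤ × ℤ} (h : SameSign x y z) :
    ∃ P Q S : ℕ, 0 < P ∧ 0 < Q ∧ 0 < S ∧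
      (det y z).natAbs / detGcd x y z = P ∧ (det z x).natAbs / detGcd x y z = Q ∧
      (det x y).natAbs / detGcd x y z = S ∧ (det y z).natAbs = P * detGcd x y z ∧
      (det z x).natAbs = Q * detGcd x y z ∧ (det x y).natAbs = S * detGcd x y z ∧
      P • x + Q • y + S • z = 0 ∧
      ∀ m n r : ℕ, m • x + n • y + r • z = 0 → ∃ s, m = s * P ∧ n = s * Q ∧ r = s * S := by
  have hg := detGcd_pos h
  obtain ⟨h1, h2, h3⟩ := detGcd_dvd x y z
  set g := detGcd x y z with hgdef
  obtain ⟨P, hP⟩ := h1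
  obtain ⟨Q, hQ⟩ := h2
  obtain ⟨S, hS⟩ := h3
  have hPpos : 0 < P := by
    rcases Nat.eq_zero_or_pos P with h0 | h0
    · rw [h0] at hP; rcases h with h | h <;> omega
    · exact h0
  have hQpos : 0 < Q := by
    rcases Nat.eq_zero_or_pos Q with h0 | h0
    · rw [h0] at hQ; rcases h with h | h <;> omega
    · exact h0
  have hSpos : 0 < S := by
    rcases Nat.eq_zero_or_pos S with h0 | h0
    · rw [h0] at hS; rcases h with h | h <;> omega
    · exact h0
  obtain ⟨ε, hε, hp, hq, hs⟩ : ∃ ε : ℤ, ε ≠ 0 ∧ det y z = ε * g * P ∧ det z x = ε * g * Q ∧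
      det x y = ε * g * S := by
    rcases h with h | h
    · refine ⟨1, one_ne_zero, ?_, ?_, ?_⟩ <;> rw [one_mul, ← Nat.cast_mul]
      · rw [← hP]; omega
      · rw [← hQ]; omega
      · rw [← hS]; omega
    · refine ⟨-1, by norm_num, ?_, ?_, ?_⟩ <;> rw [neg_one_mul, neg_mul, ← Nat.cast_mul]
      · rw [← hP]; omega
      · rw [← hQ]; omega
      · rw [← hS]; omega
  have hεg : ε * g ≠ 0 := mul_ne_zero hε (by exact_mod_cast hg.ne')
  have hcop : Nat.gcd P (Nat.gcd Q S) = 1 := by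
    have : g = g * Nat.gcd P (Nat.gcd Q S) := by
      conv_lhs => rw [hgdef, detGcd, Int.gcd, Int.gcd, Int.natAbs_natCast, hP, hQ, hS]
      rw [Nat.gcd_mul_left, Nat.gcd_mul_left]
    exact (Nat.eq_of_mul_eq_mul_left hg (by rw [mul_one]; exact this)).symm
  refine ⟨P, Q, S, hPpos, hQpos, hSpos, ?_, ?_, ?_, ?_, ?_, ?_, ?_, ?_⟩
  · rw [hP, Nat.mul_div_cancel_left _ hg]
  · rw [hQ, Nat.mul_div_cancel_left _ hg]
  · rw [hS, Nat.mul_div_cancel_left _ hg]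
  · rw [hP, mul_comm]
  · rw [hQ, mul_comm]
  · rw [hS, mul_comm]
  · ext
    · simp only [Prod.fst_add, Prod.smul_fst, Prod.fst_zero]
      simp only [nsmul_eq_mul]
      refine (mul_eq_zero.1 ?_).resolve_left hεg
      have : ε * g * (P * x.1 + Q * y.1 + S * z.1) =
        (ε * g * P) * x.1 + (ε * g * Q) * y.1 + (ε * g * S) * z.1 := by ring
      rw [this, ← hp, ← hq, ← hs]
      unfold det
      ring
    · simp only [Prod.snd_add, Prod.smul_snd, Prod.snd_zero]
      simp only [nsmul_eq_mul]
      refine (mul_eq_zero.1 ?_).resolve_left hεg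
      have : ε * g * (P * x.2 + Q * y.2 + S * z.2) =
        (ε * g * P) * x.2 + (ε * g * Q) * y.2 + (ε * g * S) * z.2 := by ring
      rw [this, ← hp, ← hq, ← hs]
      unfold det
      ring
  · intro m n r hrel
    have e1 : (m : ℤ) * x.1 + n * y.1 + r * z.1 = 0 := by simpa using congrArg Prod.fst hrel
    have e2 : (m : ℤ) * x.2 + n * y.2 + r * z.2 = 0 := by simpa using congrArg Prod.snd hrel
    have f1 : m * S = r * P := by
      have : (m : ℤ) * det x y = r * det y z := by
        unfold det; linear_combination y.1 * e2 - y.2 * e1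
      rw [hs, hp] at this
      have h2 : (ε * g) * (m * S : ℤ) = (ε * g) * (r * P) := by linear_combination this
      exact_mod_cast mul_left_cancel₀ hεg h2
    have f2 : n * P = m * Q := by
      have : (n : ℤ) * det y z = m * det z x := by
        unfold det; linear_combination z.1 * e2 - z.2 * e1
      rw [hp, hq] at this
      have h2 : (ε * g) * (n * P : ℤ) = (ε * g) * (m * Q) := by linear_combination this
      exact_mod_cast mul_left_cancel₀ hεg h2
    have hdvd : P ∣ m := by
      have h1 : P ∣ Nat.gcd (m * P) (Nat.gcd (m * Q) (m * S)) :=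
        Nat.dvd_gcd (dvd_mul_left _ _) (Nat.dvd_gcd (by rw [← f2]; exact dvd_mul_left _ _)
          (by rw [f1]; exact dvd_mul_left _ _))
      rwa [Nat.gcd_mul_left, Nat.gcd_mul_left, hcop, mul_one] at h1
    obtain ⟨s, rfl⟩ := hdvd
    refine ⟨s, mul_comm _ _, ?_, ?_⟩
    · refine Nat.eq_of_mul_eq_mul_left hPpos ?_
      linarith
    · refine Nat.eq_of_mul_eq_mul_left hPpos ?_
      linarith

/-- A positive relation between three vectors forces the determinants to vanish or to have the
same sign. -/
lemma sameSign_or_of_relation {x y z : ℤ × ℤ} {m n r : ℕ} (hm : 0 < m) (hn : 0 < n) (hr : 0 < r)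
    (hrel : m • x + n • y + r • z = 0) :
    SameSign x y z ∨ (det y z = 0 ∧ det z x = 0 ∧ det x y = 0) := by
  have e1 : (m : ℤ) * x.1 + n * y.1 + r * z.1 = 0 := by simpa using congrArg Prod.fst hrel
  have e2 : (m : ℤ) * x.2 + n * y.2 + r * z.2 = 0 := by simpa using congrArg Prod.snd hrel
  have f1 : (m : ℤ) * det x y = r * det y z := by
    unfold det; linear_combination y.1 * e2 - y.2 * e1
  have f2 : (n : ℤ) * det y z = m * det z x := by
    unfold det; linear_combination z.1 * e2 - z.2 * e1
  have hm' : (0 : ℤ) < m := by exact_mod_cast hm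
  have hn' : (0 : ℤ) < n := by exact_mod_cast hn
  have hr' : (0 : ℤ) < r := by exact_mod_cast hr
  rcases lt_trichotomy (det y z) 0 with h | h | h
  · left; right
    refine ⟨h, ?_, ?_⟩
    · have : (m : ℤ) * det z x < 0 := by rw [← f2]; exact mul_neg_of_pos_of_neg hn' h
      exact neg_of_mul_neg_right this hm'.le
    · have : (m : ℤ) * det x y < 0 := by rw [f1]; exact mul_neg_of_pos_of_neg hr' h
      exact neg_of_mul_neg_right this hm'.le
  · right
    rw [h, mul_zero] at f1 f2
    exact ⟨h, (mul_eq_zero.1 f2.symm).resolve_left hm'.ne', (mul_eq_zero.1 f1).resolve_left hm'.ne'⟩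
  · left; left
    refine ⟨h, ?_, ?_⟩
    · have : 0 < (m : ℤ) * det z x := by rw [← f2]; exact mul_pos hn' h
      exact pos_of_mul_pos_right this hm'.le
    · have : 0 < (m : ℤ) * det x y := by rw [f1]; exact mul_pos hr' h
      exact pos_of_mul_pos_right this hm'.le

/-- The primitive relation between two opposite vectors, in terms of a nonzero coordinate. -/
lemma exists_relation_of_opposite {i j k l : ℤ} (hdet : j * k - l * i = 0)
    (hdot : j * l + i * k < 0) (hjl : j * l ≠ 0) :
    ∃ m n : ℕ, 0 < m ∧ 0 < n ∧ l.natAbs / j.gcd l = m ∧ j.natAbs / j.gcd l = n ∧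
      l.sign * j.gcd l * m = l ∧ l.sign * j.gcd l * n = -j ∧
      m * i + n * k = 0 ∧ m * j + n * l = 0 ∧
      ∀ m' n' : ℕ, m' * j + n' * l = 0 → ∃ s, m' = s * m ∧ n' = s * n := by
  have hj : j ≠ 0 := left_ne_zero_of_mul hjl
  have hl : l ≠ 0 := right_ne_zero_of_mul hjl
  have hneg : j * l < 0 := by
    -- For collinear vectors the product of one pair of coordinates has the sign of the scalar
    -- product, as long as it is nonzero.
    have h1 : (j ^ 2 + i ^ 2) * (j * l) = j ^ 2 * (j * l + i * k) := by
      linear_combination (-(i * j)) * hdet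
    have h2 : 0 < j ^ 2 := by positivity
    have h3 : (j ^ 2 + i ^ 2) * (j * l) < 0 := by
      rw [h1]; exact mul_neg_of_pos_of_neg h2 hdot
    exact neg_of_mul_neg_right h3 (by positivity)
  have hg : 0 < j.gcd l := Int.gcd_pos_of_ne_zero_left _ hj
  obtain ⟨m, hm⟩ : j.gcd l ∣ l.natAbs := Int.natCast_dvd.1 (Int.gcd_dvd_right ..)
  obtain ⟨n, hn⟩ : j.gcd l ∣ j.natAbs := Int.natCast_dvd.1 (Int.gcd_dvd_left ..)
  have hmpos : 0 < m := by
    rcases Nat.eq_zero_or_pos m with h0 | h0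
    · rw [h0] at hm; omega
    · exact h0
  have hnpos : 0 < n := by
    rcases Nat.eq_zero_or_pos n with h0 | h0
    · rw [h0] at hn; omega
    · exact h0
  set g := j.gcd l with hgdef
  have hl' : l.sign * g * m = l := by
    rw [mul_assoc, ← Nat.cast_mul, ← hm, Int.sign_mul_natAbs]
  have hsign : l.sign = - j.sign := by
    rcases lt_trichotomy j 0 with h | h | h
    · have : 0 < l := by by_contra h'; nlinarith
      rw [Int.sign_eq_one_of_pos this, Int.sign_eq_neg_one_of_neg h, neg_neg]
    · exact absurd h hj
    · have : l < 0 := by by_contra h'; nlinarith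
      rw [Int.sign_eq_one_of_pos h, Int.sign_eq_neg_one_of_neg this]
  have hj' : l.sign * g * n = -j := by
    rw [hsign, neg_mul, neg_mul, mul_assoc, ← Nat.cast_mul, ← hn, Int.sign_mul_natAbs]
  have hsg : l.sign * (g : ℤ) ≠ 0 :=
    mul_ne_zero (by rwa [Ne, Int.sign_eq_zero_iff_zero]) (by exact_mod_cast hg.ne')
  have hrel : (m : ℤ) * j + n * l = 0 := by
    refine (mul_eq_zero.1 ?_).resolve_left hsg
    linear_combination j * hl' + l * hj'
  have hcop : Nat.gcd n m = 1 := by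
    have : g = g * Nat.gcd n m := by
      conv_lhs => rw [hgdef, Int.gcd, hm, hn]
      rw [Nat.gcd_mul_left]
    exact (Nat.eq_of_mul_eq_mul_left hg (by rw [mul_one]; exact this)).symm
  refine ⟨m, n, hmpos, hnpos, ?_, ?_, hl', hj', ?_, hrel, ?_⟩
  · rw [hm, Nat.mul_div_cancel_left _ hg]
  · rw [hn, Nat.mul_div_cancel_left _ hg]
  · refine (mul_eq_zero.1 ?_).resolve_left hj
    linear_combination i * hrel + n * hdet
  · intro m' n' h
    have h1 : m' * n = n' * m := by
      have h2 : (l.sign * (g : ℤ)) * (m' * n) = (l.sign * g) * (n' * m) := by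
        linear_combination m' * hj' - n' * hl' - h
      exact_mod_cast mul_left_cancel₀ hsg h2
    have hdvd : m ∣ m' := by
      have : m ∣ m' * n := by rw [h1]; exact dvd_mul_left _ _
      exact (Nat.Coprime.symm hcop).dvd_of_dvd_mul_right this
    obtain ⟨s, rfl⟩ := hdvd
    refine ⟨s, mul_comm _ _, Nat.eq_of_mul_eq_mul_left hmpos ?_⟩
    linarith

/-- A positive relation makes `y` a negative multiple of `x`; up to the vanishing coordinates, these
are the conditions under which `symS` and `symQ` are nontrivial. -/
lemma opposite_of_relation {x y : ℤ × ℤ} {m n : ℕ} (hm : 0 < m) (hn : 0 < n) (hx : x ≠ 0)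
    (hrel : m • x + n • y = 0) : det x y = 0 ∧ x.2 * y.2 + x.1 * y.1 < 0 := by
  have e1 : (m : ℤ) * x.1 + n * y.1 = 0 := by simpa using congrArg Prod.fst hrel
  have e2 : (m : ℤ) * x.2 + n * y.2 = 0 := by simpa using congrArg Prod.snd hrel
  have hm' : (0 : ℤ) < m := by exact_mod_cast hm
  have hn' : (0 : ℤ) < n := by exact_mod_cast hn
  constructor
  · refine (mul_eq_zero.1 (?_ : (n : ℤ) * det x y = 0)).resolve_left hn'.ne'
    unfold det
    linear_combination x.2 * e1 - x.1 * e2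
  · have h1 : (n : ℤ) * (x.2 * y.2 + x.1 * y.1) = -(m * (x.2 ^ 2 + x.1 ^ 2)) := by
      linear_combination x.2 * e2 + x.1 * e1
    have h2 : 0 < x.2 ^ 2 + x.1 ^ 2 := by
      by_cases h : x.1 = 0
      · have : x.2 ≠ 0 := fun h' => hx (Prod.ext h h')
        positivity
      · positivity
    have h3 : (n : ℤ) * (x.2 * y.2 + x.1 * y.1) < 0 := by
      rw [h1]; exact neg_neg_of_pos (mul_pos hm' h2)
    exact neg_of_mul_neg_right h3 hn'.le

end Relations

/-! ### Finiteness of the products and nilpotency of their arguments -/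

section Finiteness

variable {R S : Type*} [CommRing R] [CommRing S]

lemma oneSubPow_zero (d : ℤ) : oneSubPow (0 : R) d = 1 := by
  rw [oneSubPow, dif_pos IsNilpotent.zero]
  have : (IsNilpotent.zero : IsNilpotent (0 : R)).isUnit_one_sub.unit = 1 := by
    ext; simp
  rw [this, one_zpow]

lemma oneSubPow_eq {x : R} (hx : IsNilpotent x) (d : ℤ) :
    oneSubPow x d = hx.isUnit_one_sub.unit ^ d := dif_pos hx

lemma map_oneSubPow (φ : R →+* S) {x : R} (hx : IsNilpotent x) (d : ℤ) :
    Units.map (φ : R →* S) (oneSubPow x d) = oneSubPow (φ x) d := by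
  rw [oneSubPow_eq hx, oneSubPow_eq (hx.map φ), map_zpow]
  congr 1
  ext
  simp

lemma symT_of_not_sameSign {x y z : ℤ × ℤ} (h : ¬ SameSign x y z) (a b c : R) :
    symT x y z a b c = 1 := by
  rw [SameSign, not_or] at h
  rw [symT, if_neg h.1, if_neg h.2]

/-- The exponent of `symT`. -/
def tExp (x y z : ℤ × ℤ) : ℤ :=
  if 0 < det y z then (detGcd x y z : ℤ) else -(detGcd x y z : ℤ)

lemma symT_of_sameSign {x y z : ℤ × ℤ} (h : SameSign x y z) (a b c : R) :
    symT x y z a b c = oneSubPow (tArg x y z a b c) (tExp x y z) := by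
  rcases h with h | h
  · rw [symT, if_pos h, tExp, if_pos h.1]; rfl
  · rw [symT, if_neg (fun h' => lt_asymm h.1 h'.1), if_pos h, tExp, if_neg (lt_asymm h.1)]; rfl

namespace Factorization

lemma a_ne_zero_of_ne (D : Factorization R) {x : ℤ × ℤ} (h : D.a x ≠ 0) : x ≠ 0 := by
  rintro rfl
  exact h D.a_zero

/-- A partially well-ordered set containing all multiples `m • x` with `D.a x ^ m ≠ 0`. -/
def cone (D : Factorization R) (k : ℕ) : Set LexZ :=
  (AddSubmonoid.closure (Function.support D.aPos) : Set LexZ) +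
    k • (insert 0 (Function.support D.aNeg))

lemma isPWO_cone (D : Factorization R) (k : ℕ) : (D.cone k).IsPWO :=
  (D.isPWO_aPos.addSubmonoid_closure fun x hx => (D.aPos_lt x hx).le).add
    (isPWO_nsmul (D.isPWO_aNeg.insert 0) k)

lemma nsmul_mem_nsmul {T : Set LexZ} (h0 : 0 ∈ T) {x : LexZ} (hx : x ∈ T) {m k : ℕ} (hmk : m ≤ k) :
    m • x ∈ k • T := by
  induction k generalizing m with
  | zero => simp [Nat.le_zero.1 hmk]
  | succ k ih =>
    rw [succ_nsmul]
    cases m with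
    | zero => exact ⟨0, by simpa using ih (Nat.zero_le k), 0, h0, by simp⟩
    | succ m => exact ⟨m • x, ih (Nat.le_of_succ_le_succ hmk), x, hx, (succ_nsmul x m).symm⟩

/-- Multiples of a positive index stay in the monoid generated by positive indices. At a negative
index the coefficient has vanishing `k`-th power, so only multiples up to `k` occur. -/
lemma nsmul_mem_cone {k : ℕ} (hk : nilradical R ^ k = 0) (D : Factorization R) {x : ℤ × ℤ} {m : ℕ}
    (h : D.a x ^ m ≠ 0) : toLex (m • x) ∈ D.cone k := by
  have hz : (0 : LexZ) ∈ insert (0 : LexZ) (Function.support D.aNeg) := Set.mem_insert _ _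
  have hxm : toLex (m • x) = m • toLex x := rfl
  have h0k : (0 : LexZ) ∈ k • (insert 0 (Function.support D.aNeg)) := by
    have := nsmul_mem_nsmul hz hz (Nat.zero_le k)
    rwa [zero_nsmul] at this
  rw [hxm]
  rcases Nat.eq_zero_or_pos m with rfl | hm
  · exact ⟨0, zero_mem (AddSubmonoid.closure _), 0, h0k, by simp⟩
  have hx : D.a x ≠ 0 := fun h' => h (by rw [h', zero_pow hm.ne'])
  rcases lt_trichotomy (toLex x) 0 with hlt | heq | hlt
  · have hmem : toLex x ∈ insert (0 : LexZ) (Function.support D.aNeg) :=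
      Set.mem_insert_of_mem _ (by simpa [aNeg, hlt] using hx)
    refine ⟨0, zero_mem (AddSubmonoid.closure _), m • toLex x, nsmul_mem_nsmul hz hmem ?_, by simp⟩
    by_contra hmk
    have hnil : D.a x ∈ nilradical R := D.nilp x ((lexNeg_iff x).2 hlt)
    have hmem := Ideal.pow_mem_pow hnil k
    rw [hk] at hmem
    have h0 : D.a x ^ k = 0 := by simpa using hmem
    exact h (pow_eq_zero_of_le (by omega) h0)
  · exact absurd heq (D.a_ne_zero_of_ne hx)
  · have hmem : toLex x ∈ AddSubmonoid.closure (Function.support D.aPos) :=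
      AddSubmonoid.subset_closure (by simpa [aPos, hlt] using hx)
    exact ⟨m • toLex x, nsmul_mem hmem m, 0, h0k, by simp⟩

lemma isPWO_support (D : Factorization R) : {x : LexZ | D.a (ofLex x) ≠ 0}.IsPWO := by
  refine (D.isPWO_aNeg.union D.isPWO_aPos).mono fun x hx => ?_
  by_contra h
  simp only [Set.mem_union, Function.mem_support, not_or, not_not] at h
  exact hx (by rw [D.a_eq, toLex_ofLex, h.1, h.2, add_zero])

/-- Only finitely many indices occur in positive relations with nonzero products of powers of
coefficients. -/
lemma finite_relation (hR : IsNilpotent (nilradical R)) (D E F : Factorization R) :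
    ∃ Ω : Set (ℤ × ℤ), Ω.Finite ∧ ∀ (x y z : ℤ × ℤ) (m n r : ℕ), 0 < m →
      m • x + n • y + r • z = 0 → D.a x ^ m * E.a y ^ n * F.a z ^ r ≠ 0 → x ∈ Ω := by
  obtain ⟨k, hk⟩ := hR
  have hU : (D.cone k + E.cone k + F.cone k).IsPWO :=
    ((D.isPWO_cone k).add (E.isPWO_cone k)).add (F.isPWO_cone k)
  refine ⟨_, ((Finset.antidiagonal D.isPWO_support hU 0).image
    fun w => ofLex w.1).finite_toSet, fun x y z m n r hm hrel hne => ?_⟩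
  have h1 : D.a x ^ m ≠ 0 := left_ne_zero_of_mul (left_ne_zero_of_mul hne)
  have h2 : E.a y ^ n ≠ 0 := right_ne_zero_of_mul (left_ne_zero_of_mul hne)
  have h3 : F.a z ^ r ≠ 0 := right_ne_zero_of_mul hne
  obtain ⟨m, rfl⟩ : ∃ m', m = m' + 1 := ⟨m - 1, by omega⟩
  have h1' : D.a x ^ m ≠ 0 := fun h => h1 (by rw [pow_succ, h, zero_mul])
  have hx : D.a x ≠ 0 := fun h => h1 (by rw [pow_succ, h, mul_zero])
  simp only [Finset.coe_image, Set.mem_image, Finset.mem_coe, Finset.mem_antidiagonal]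
  -- One copy of `x` is split off the relation. The rest lies in the sum of the three cones and
  -- equals `-x`, so `x` comes from a finite antidiagonal at `0`.
  refine ⟨(toLex x, toLex (m • x + n • y + r • z)), ⟨hx, ?_, ?_⟩, rfl⟩
  · exact ⟨_, ⟨_, D.nsmul_mem_cone hk h1', _, E.nsmul_mem_cone hk h2, rfl⟩, _,
      F.nsmul_mem_cone hk h3, rfl⟩
  · rw [← toLex_add]
    have : x + (m • x + n • y + r • z) = (m + 1) • x + n • y + r • z := by
      rw [succ_nsmul]; abel
    rw [this, hrel]
    rfl

end Factorization

lemma symT_ne_one {x y z : ℤ × ℤ} {a b c : R} (h : symT x y z a b c ≠ 1) :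
    ∃ P Q S : ℕ, 0 < P ∧ 0 < Q ∧ 0 < S ∧ P • x + Q • y + S • z = 0 ∧
      a ^ P * b ^ Q * c ^ S ≠ 0 := by
  by_cases hs : SameSign x y z
  · obtain ⟨P, Q, S, hP, hQ, hS, eP, eQ, eS, -, -, -, hrel, -⟩ := exists_relation_of_sameSign hs
    refine ⟨P, Q, S, hP, hQ, hS, hrel, fun h0 => h ?_⟩
    have : tArg x y z a b c = 0 := by
      change a ^ ((det y z).natAbs / detGcd x y z) * b ^ ((det z x).natAbs / detGcd x y z) *
        c ^ ((det x y).natAbs / detGcd x y z) = 0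
      rw [eP, eQ, eS, h0]
    rw [symT_of_sameSign hs, this, oneSubPow_zero]
  · exact absurd (symT_of_not_sameSign hs a b c) h

lemma symS_ne_one {x y : ℤ × ℤ} {a b : R} (h : symS x y a b ≠ 1) :
    ∃ m n : ℕ, 0 < m ∧ 0 < n ∧ m • x + n • y = 0 ∧ a ^ m * b ^ n ≠ 0 := by
  rw [symS] at h
  split_ifs at h with hc
  · exact absurd rfl h
  · simp only [not_or, not_not, not_le] at hc
    obtain ⟨m, n, hm, hn, em, en, -, -, r1, r2, -⟩ := exists_relation_of_opposite hc.1 hc.2.1 hc.2.2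
    refine ⟨m, n, hm, hn, ?_, fun h0 => h ?_⟩
    · ext
      · simpa using r1
      · simpa using r2
    · rw [em, en, h0, oneSubPow_zero]

lemma symQ_ne_one {x y : ℤ × ℤ} {a b : R} (h : symQ x y a b ≠ 1) :
    ∃ m n : ℕ, 0 < m ∧ 0 < n ∧ m • x + n • y = 0 ∧ a ^ m * b ^ n ≠ 0 := by
  rw [symQ] at h
  split_ifs at h with hc
  · exact absurd rfl h
  · simp only [not_or, not_not, not_le] at hc
    obtain ⟨m, n, hm, hn, em, en, -, -, r1, r2, -⟩ :=
      exists_relation_of_opposite (i := x.2) (k := y.2) (j := x.1) (l := y.1)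
        (by have := hc.1; unfold det at this; linarith) (by linarith [hc.2.1]) hc.2.2
    refine ⟨m, n, hm, hn, ?_, fun h0 => h ?_⟩
    · ext
      · simpa using r2
      · simpa using r1
    · rw [em, en, h0, oneSubPow_zero]

lemma finite_mulSupport_termT (hR : IsNilpotent (nilradical R)) (D E F : Factorization R) :
    (termT D E F).mulSupport.Finite := by
  obtain ⟨Ω₁, h1, H1⟩ := Factorization.finite_relation hR D E F
  obtain ⟨Ω₂, h2, H2⟩ := Factorization.finite_relation hR E F D
  obtain ⟨Ω₃, h3, H3⟩ := Factorization.finite_relation hR F D E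
  refine (h1.prod (h2.prod h3)).subset ?_
  rintro ⟨x, y, z⟩ hw
  obtain ⟨P, Q, S, hP, hQ, hS, hrel, hne⟩ := symT_ne_one hw
  refine ⟨H1 x y z P Q S hP hrel hne, H2 y z x Q S P hQ ?_ ?_, H3 z x y S P Q hS ?_ ?_⟩
  · rw [← hrel]; abel
  · intro h; apply hne; rw [← h]; ring
  · rw [← hrel]; abel
  · intro h; apply hne; rw [← h]; ring

lemma finite_relation_pair (hR : IsNilpotent (nilradical R)) (D E : Factorization R) :
    ∃ Ω : Set ((ℤ × ℤ) × (ℤ × ℤ)), Ω.Finite ∧ ∀ (x y : ℤ × ℤ) (m n : ℕ), 0 < m → 0 < n →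
      m • x + n • y = 0 → D.a x ^ m * E.a y ^ n ≠ 0 → (x, y) ∈ Ω := by
  obtain ⟨Ω₁, h1, H1⟩ := Factorization.finite_relation hR D E E
  obtain ⟨Ω₂, h2, H2⟩ := Factorization.finite_relation hR E D D
  refine ⟨_, h1.prod h2, fun x y m n hm hn hrel hne => ⟨H1 x y 0 m n 0 hm ?_ ?_,
    H2 y x 0 n m 0 hn ?_ ?_⟩⟩
  · simpa using hrel
  · simpa using hne
  · rw [← hrel]; simp [add_comm]
  · rwa [pow_zero, mul_one, mul_comm]

lemma finite_mulSupport_termS (hR : IsNilpotent (nilradical R)) (D E : Factorization R) :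
    (termS D E).mulSupport.Finite := by
  obtain ⟨Ω, h, H⟩ := finite_relation_pair hR D E
  refine h.subset ?_
  rintro ⟨x, y⟩ hw
  obtain ⟨m, n, hm, hn, hrel, hne⟩ := symS_ne_one hw
  exact H x y m n hm hn hrel hne

lemma finite_mulSupport_termQ (hR : IsNilpotent (nilradical R)) (D E : Factorization R) :
    (termQ D E).mulSupport.Finite := by
  obtain ⟨Ω, h, H⟩ := finite_relation_pair hR D E
  refine h.subset ?_
  rintro ⟨x, y⟩ hw
  obtain ⟨m, n, hm, hn, hrel, hne⟩ := symQ_ne_one hw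
  exact H x y m n hm hn hrel hne

/-! ### Nilpotency of the arguments -/

/-- If no index with a positive multiplicity were negative, then, as `x ≠ 0`, the left side of the
relation would be strictly positive. So some factor is a positive power of a nilpotent coefficient.
-/
lemma isNilpotent_of_relation (D E F : Factorization R) {x y z : ℤ × ℤ} {m n r : ℕ} (hm : 0 < m)
    (hn : 0 < n) (hx : x ≠ 0) (hrel : m • x + n • y + r • z = 0) :
    IsNilpotent (D.a x ^ m * E.a y ^ n * F.a z ^ r) := by
  have key : ∀ (G : Factorization R) (w : ℤ × ℤ) (j : ℕ), 0 < j → toLex w < 0 →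
      IsNilpotent (G.a w ^ j) := fun G w j hj hw =>
    (G.nilp w ((lexNeg_iff w).2 hw)).pow_of_pos hj.ne'
  by_cases hx0 : toLex x < 0
  · exact ((Commute.all _ _).isNilpotent_mul_right
      ((Commute.all _ _).isNilpotent_mul_right (key D x m hm hx0)))
  by_cases hy0 : toLex y < 0
  · exact ((Commute.all _ _).isNilpotent_mul_right
      ((Commute.all _ _).isNilpotent_mul_left (key E y n hn hy0)))
  rcases Nat.eq_zero_or_pos r with rfl | hr
  · exfalso
    have h1 : 0 < toLex x := lt_of_le_of_ne (not_lt.1 hx0) fun h => hx h.symm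
    have h2 : m • toLex x + n • toLex y + 0 • toLex z = 0 := hrel
    have h3 : 0 < m • toLex x + n • toLex y + 0 • toLex z := by
      rw [zero_nsmul, add_zero]
      exact add_pos_of_pos_of_nonneg (nsmul_pos h1 hm.ne') (nsmul_nonneg (not_lt.1 hy0) n)
    exact h3.ne' h2
  by_cases hz0 : toLex z < 0
  · exact ((Commute.all _ _).isNilpotent_mul_left (key F z r hr hz0))
  · exfalso
    have h1 : 0 < toLex x := lt_of_le_of_ne (not_lt.1 hx0) fun h => hx h.symm
    have h2 : m • toLex x + n • toLex y + r • toLex z = 0 := hrel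
    have h3 : 0 < m • toLex x + n • toLex y + r • toLex z :=
      add_pos_of_pos_of_nonneg (add_pos_of_pos_of_nonneg (nsmul_pos h1 hm.ne')
        (nsmul_nonneg (not_lt.1 hy0) n)) (nsmul_nonneg (not_lt.1 hz0) r)
    exact h3.ne' h2

lemma isNilpotent_tArg (D E F : Factorization R) {x y z : ℤ × ℤ} (h : SameSign x y z) :
    IsNilpotent (tArg x y z (D.a x) (E.a y) (F.a z)) := by
  obtain ⟨P, Q, S, hP, hQ, hS, eP, eQ, eS, -, -, -, hrel, -⟩ := exists_relation_of_sameSign h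
  change IsNilpotent (D.a x ^ ((det y z).natAbs / detGcd x y z) *
    E.a y ^ ((det z x).natAbs / detGcd x y z) * F.a z ^ ((det x y).natAbs / detGcd x y z))
  rw [eP, eQ, eS]
  refine isNilpotent_of_relation D E F hP hQ ?_ hrel
  rintro rfl
  rcases h with h | h <;> simp [det] at h

lemma isNilpotent_of_relation_pair (D E : Factorization R) {x y : ℤ × ℤ} {m n : ℕ} (hm : 0 < m)
    (hn : 0 < n) (hx : x ≠ 0) (hrel : m • x + n • y = 0) :
    IsNilpotent (D.a x ^ m * E.a y ^ n) := by
  have := isNilpotent_of_relation D E E (z := 0) (r := 0) hm hn hx (by simpa using hrel)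
  simpa using this

end Finiteness

/-! ### Base change of decompositions and of the formula -/

section Functoriality

variable {R S : Type*} [CommRing R] [CommRing S]

/-- The image of a factorization under a ring homomorphism. -/
def Factorization.map (φ : R →+* S) (D : Factorization R) : Factorization S where
  c := Units.map (φ : R →* S) D.c
  ν₁ := LocInt.map φ D.ν₁
  ν₂ := LocInt.map φ D.ν₂
  a x := φ (D.a x)
  a_zero := by rw [D.a_zero, map_zero]
  nilp x hx := (D.nilp x hx).map φ
  bdd_neg := by
    obtain ⟨n, m, h⟩ := D.bdd_neg
    exact ⟨n, m, fun x hx hne => h x hx fun h0 => hne (by rw [h0, map_zero])⟩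
  bdd_pos i := by
    obtain ⟨m, h⟩ := D.bdd_pos i
    exact ⟨m, fun j hx hne => h j hx fun h0 => hne (by rw [h0, map_zero])⟩

namespace Factorization

lemma aNeg_map (φ : R →+* S) (D : Factorization R) :
    (D.map φ).aNeg = fun x => φ (D.aNeg x) := by
  funext x
  simp only [aNeg]
  split_ifs <;> simp [map]

lemma aPos_map (φ : R →+* S) (D : Factorization R) :
    (D.map φ).aPos = fun x => φ (D.aPos x) := by
  funext x
  simp only [aPos]
  split_ifs <;> simp [map]

lemma hmap_monomial (φ : R →+* S) (ν₁ ν₂ : LocInt R) :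
    hmap φ (monomial ν₁ ν₂).val = (monomial (LocInt.map φ ν₁) (LocInt.map φ ν₂)).val := by
  have h : ∀ (x : LexZ) (ν : LocInt R), hmap φ (lpow C (xpow R x) ν).val =
      (lpow C (xpow S x) (LocInt.map φ ν)).val := by
    intro x ν
    have h1 := map_lpow (hmap φ) C (xpow R x) ν
    rw [map_xpow] at h1
    have h2 : (hmap φ).comp C = (C : S →+* HahnSeries LexZ S).comp φ := by
      ext r : 1
      exact hmap_C φ r
    refine congrArg Units.val (h1.trans ?_)
    rw [← lpow_comp]
    congr 1
  rw [monomial, monomial, Units.val_mul, map_mul, h, h, Units.val_mul]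

lemma Decomposes.map {D : Factorization R} {f : HahnSeries LexZ R} (h : D.Decomposes f)
    (φ : R →+* S) : (D.map φ).Decomposes (hmap φ f) := by
  obtain ⟨n, p, hn, hp, rfl⟩ := h
  refine ⟨hmap φ n, hmap φ p, ?_, ?_, ?_⟩
  · rw [aNeg_map]
    have := hn.hmap φ
    simpa only [hmap_eprod] using this
  · rw [aPos_map]
    have := hp.hmap φ
    simpa only [hmap_eprod] using this
  · simp only [map_mul, hmap_C, hmap_monomial]
    rfl

end Factorization

/-- Nilpotency of the argument over `R` matters: `oneSubPow` takes the default value `1` on other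
elements, and these may become nilpotent in `S`. -/
lemma map_termT (φ : R →+* S) (D E F : Factorization R) (w : (ℤ × ℤ) × (ℤ × ℤ) × (ℤ × ℤ)) :
    Units.map (φ : R →* S) (termT D E F w) = termT (D.map φ) (E.map φ) (F.map φ) w := by
  unfold termT
  by_cases h : SameSign w.1 w.2.1 w.2.2
  · rw [symT_of_sameSign h, symT_of_sameSign h, map_oneSubPow φ (isNilpotent_tArg D E F h)]
    simp only [tArg, map_mul, map_pow]
    rfl
  · rw [symT_of_not_sameSign h, symT_of_not_sameSign h, map_one]

lemma map_termS (φ : R →+* S) (D E : Factorization R) (w : (ℤ × ℤ) × (ℤ × ℤ)) :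
    Units.map (φ : R →* S) (termS D E w) = termS (D.map φ) (E.map φ) w := by
  obtain ⟨x, y⟩ := w
  simp only [termS, symS]
  split_ifs with hc
  · exact map_one _
  · simp only [not_or, not_not, not_le] at hc
    obtain ⟨m, n, hm, hn, em, en, -, -, r1, r2, -⟩ := exists_relation_of_opposite hc.1 hc.2.1 hc.2.2
    have hx : x ≠ 0 := by rintro rfl; simp at hc
    rw [em, en, map_oneSubPow φ (isNilpotent_of_relation_pair D E hm hn hx
      (by ext; exacts [by simpa using r1, by simpa using r2]))]
    simp only [map_mul, map_pow]
    rfl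

lemma map_termQ (φ : R →+* S) (D E : Factorization R) (w : (ℤ × ℤ) × (ℤ × ℤ)) :
    Units.map (φ : R →* S) (termQ D E w) = termQ (D.map φ) (E.map φ) w := by
  obtain ⟨x, y⟩ := w
  simp only [termQ, symQ]
  split_ifs with hc
  · exact map_one _
  · simp only [not_or, not_not, not_le] at hc
    obtain ⟨m, n, hm, hn, em, en, -, -, r1, r2, -⟩ :=
      exists_relation_of_opposite (i := x.2) (k := y.2) (j := x.1) (l := y.1)
        (by have := hc.1; unfold det at this; linarith) (by linarith [hc.2.1]) hc.2.2
    have hx : x ≠ 0 := by rintro rfl; simp at hc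
    rw [em, en, map_oneSubPow φ (isNilpotent_of_relation_pair D E hm hn hx
      (by ext; exacts [by simpa using r2, by simpa using r1]))]
    simp only [map_mul, map_pow]
    rfl

lemma map_nu (φ : R →+* S) (D E : Factorization R) :
    LocInt.map φ (nu D E) = nu (D.map φ) (E.map φ) := rfl

lemma map_signExp (φ : R →+* S) (D E F : Factorization R) :
    LocInt.map φ (signExp D E F) = signExp (D.map φ) (E.map φ) (F.map φ) := rfl

lemma map_finprod_lpow (φ : R →+* S) {ι : Type*} {t : ι → Rˣ} (ht : t.mulSupport.Finite)
    (ν : LocInt R) : Units.map (φ : R →* S) (∏ᶠ w, lpow (RingHom.id R) (t w) ν) =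
      ∏ᶠ w, lpow (RingHom.id S) (Units.map (φ : R →* S) (t w)) (LocInt.map φ ν) := by
  rw [MonoidHom.map_finprod]
  · exact finprod_congr fun w => map_lpow_id φ _ _
  · refine ht.subset fun w hw h => hw ?_
    simp only [h, lpow_one]

/-- The explicit formula is compatible with ring homomorphisms. -/
lemma map_formula (hR : IsNilpotent (nilradical R)) (φ : R →+* S) (D E F : Factorization R) :
    Units.map (φ : R →* S) (formula D E F) = formula (D.map φ) (E.map φ) (F.map φ) := by
  simp only [formula, _root_.map_mul, map_lpow_id,
    map_finprod_lpow φ (finite_mulSupport_termS hR _ _),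
    map_finprod_lpow φ (finite_mulSupport_termQ hR _ _),
    MonoidHom.map_finprod _ (finite_mulSupport_termT hR _ _ _), map_termT, map_termS, map_termQ,
    map_nu, map_signExp]
  have h1 : Units.map (φ : R →* S) (-1) = -1 := by ext; simp
  rw [h1]
  rfl

end Functoriality

/-! ### Logarithmic derivatives of units -/

section LogDerivative

variable {B : Type*} [CommRing B]

/-- The logarithmic derivative of a unit. -/
def dlog (δ : Derivation ℤ B B) (u : Bˣ) : B := ((u⁻¹ : Bˣ) : B) * δ (u : B)

variable (δ : Derivation ℤ B B)

lemma dlog_mul (u v : Bˣ) : dlog δ (u * v) = dlog δ u + dlog δ v := by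
  have h1 : ((u⁻¹ : Bˣ) : B) * u = 1 := u.inv_mul
  have h2 : ((v⁻¹ : Bˣ) : B) * v = 1 := v.inv_mul
  simp only [dlog, mul_inv, Units.val_mul, Derivation.leibniz, smul_eq_mul]
  linear_combination ((v⁻¹ : Bˣ) : B) * δ v * h1 + ((u⁻¹ : Bˣ) : B) * δ u * h2

lemma dlog_one : dlog δ 1 = 0 := by simp [dlog]

/-- The logarithmic derivative as a homomorphism. -/
def dlogHom : Bˣ →* Multiplicative B where
  toFun u := Multiplicative.ofAdd (dlog δ u)
  map_one' := by rw [dlog_one]; rfl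
  map_mul' u v := by rw [dlog_mul]; rfl

lemma dlog_inv (u : Bˣ) : dlog δ u⁻¹ = - dlog δ u := map_inv (dlogHom δ) u

lemma dlog_zpow (u : Bˣ) (n : ℤ) : dlog δ (u ^ n) = n * dlog δ u := by
  have h : dlog δ (u ^ n) = n • dlog δ u := map_zpow (dlogHom δ) u n
  rw [h, zsmul_eq_mul]

lemma dlog_prod {ι : Type*} (s : Finset ι) (u : ι → Bˣ) :
    dlog δ (∏ i ∈ s, u i) = ∑ i ∈ s, dlog δ (u i) := map_prod (dlogHom δ) u s

lemma dlog_neg_one : dlog δ (-1) = 0 := by simp [dlog]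

lemma eq_zero_of_dlog_eq_zero {u : Bˣ} (h : dlog δ u = 0) : δ (u : B) = 0 := by
  have := congrArg (fun b => (u : B) * b) h
  simpa [dlog] using this

end LogDerivative

/-! ### The 3 × 3 determinant -/

section Determinant

variable {B : Type*} [CommRing B]

/-- The determinant of three vectors. -/
def det3 (p q r : Fin 3 → B) : B :=
  p 0 * (q 1 * r 2 - q 2 * r 1) + p 1 * (q 2 * r 0 - q 0 * r 2) + p 2 * (q 0 * r 1 - q 1 * r 0)

lemma det3_cycle (p q r : Fin 3 → B) : det3 p q r = det3 q r p := by unfold det3; ring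

lemma det3_add_left (p p' q r : Fin 3 → B) : det3 (p + p') q r = det3 p q r + det3 p' q r := by
  simp only [det3, Pi.add_apply]; ring

lemma det3_sum_left {ι : Type*} (s : Finset ι) (p : ι → Fin 3 → B) (q r : Fin 3 → B) :
    det3 (∑ i ∈ s, p i) q r = ∑ i ∈ s, det3 (p i) q r := by
  simp only [det3, Finset.sum_apply, Finset.sum_mul, ← Finset.sum_add_distrib]

lemma det3_add_mid (p q q' r : Fin 3 → B) : det3 p (q + q') r = det3 p q r + det3 p q' r := by
  simp only [det3, Pi.add_apply]; ring

lemma det3_add_right (p q r r' : Fin 3 → B) : det3 p q (r + r') = det3 p q r + det3 p q r' := by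
  simp only [det3, Pi.add_apply]; ring

lemma det3_sum_mid {ι : Type*} (s : Finset ι) (p : Fin 3 → B) (q : ι → Fin 3 → B)
    (r : Fin 3 → B) : det3 p (∑ i ∈ s, q i) r = ∑ i ∈ s, det3 p (q i) r := by
  simp only [det3_cycle p, det3_sum_left]

lemma det3_sum_right {ι : Type*} (s : Finset ι) (p q : Fin 3 → B) (r : ι → Fin 3 → B) :
    det3 p q (∑ i ∈ s, r i) = ∑ i ∈ s, det3 p q (r i) := by
  simp only [← det3_cycle _ p q, det3_sum_left]

lemma det3_smul (a b c : B) (p q r : Fin 3 → B) :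
    det3 (fun i => a * p i) (fun i => b * q i) (fun i => c * r i) = a * b * c * det3 p q r := by
  simp only [det3]; ring

lemma map_det3 {B' : Type*} [CommRing B'] (φ : B →+* B') (p q r : Fin 3 → B) :
    det3 (fun i => φ (p i)) (fun i => φ (q i)) (fun i => φ (r i)) = φ (det3 p q r) := by
  simp only [det3, map_add, map_mul, map_sub]

end Determinant

/-! ### Derivations of Hahn series and limits of inverses -/

section CoefficientwiseDerivations

variable {Γ A : Type*} [AddCommGroup Γ] [LinearOrder Γ] [IsOrderedAddMonoid Γ] [CommRing A]

/-- A family of additive maps that acts coefficientwise as a derivation on Hahn series. -/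
structure CoeffDerivation (Γ A : Type*) [AddCommGroup Γ] [CommRing A] where
  /-- the action on the coefficients with a given index -/
  d : Γ → A →+ A
  leibniz : ∀ x y a b, d (x + y) (a * b) = d x a * b + a * d y b

namespace CoeffDerivation

/-- The additive map on Hahn series. -/
def opFun (E : CoeffDerivation Γ A) (f : HahnSeries Γ A) : HahnSeries Γ A where
  coeff z := E.d z (f.coeff z)
  isPWO_support' := f.isPWO_support.mono fun z hz h => hz (by
    change E.d z (f.coeff z) = 0
    rw [h, map_zero])

/-- The derivation on Hahn series. -/
def op (E : CoeffDerivation Γ A) : Derivation ℤ (HahnSeries Γ A) (HahnSeries Γ A) :=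
  Derivation.mk' (AddMonoidHom.toIntLinearMap
    { toFun := E.opFun
      map_zero' := by ext z; exact map_zero (E.d z)
      map_add' := fun f g => by ext z; exact map_add (E.d z) _ _ }) fun f g => by
    have hsub : ∀ f : HahnSeries Γ A, (E.opFun f).support ⊆ f.support := by
      intro f z hz h
      refine hz ?_
      change E.d z (f.coeff z) = 0
      rw [h, map_zero]
    ext z
    change E.d z ((f * g).coeff z) = (f * E.opFun g + g * E.opFun f).coeff z
    rw [coeff_add, mul_comm g, coeff_mul, map_sum,
      coeff_mul_of_support_subset f.isPWO_support g.isPWO_support subset_rfl (hsub g),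
      coeff_mul_of_support_subset f.isPWO_support g.isPWO_support (hsub f) subset_rfl,
      ← Finset.sum_add_distrib]
    refine Finset.sum_congr rfl fun ij hij => ?_
    rw [Finset.mem_antidiagonal] at hij
    rw [← hij.2.2, E.leibniz, add_comm]
    rfl

lemma coeff_op (E : CoeffDerivation Γ A) (f : HahnSeries Γ A) (z : Γ) :
    (E.op f).coeff z = E.d z (f.coeff z) := rfl

lemma op_single (E : CoeffDerivation Γ A) (x : Γ) (a : A) :
    E.op (single x a) = single x (E.d x a) := by
  ext z
  rw [coeff_op, coeff_single, coeff_single]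
  split_ifs with h
  · rw [h]
  · exact map_zero _

lemma tendsto_op (E : CoeffDerivation Γ A) {ι : Type*} {l : Filter ι} {f : ι → HahnSeries Γ A}
    {g : HahnSeries Γ A} (h : TendstoCoeff l f g) :
    TendstoCoeff l (fun i => E.op (f i)) (E.op g) := by
  obtain ⟨T, hT, hf⟩ := h.bdd
  refine ⟨⟨T, hT, fun i z hz => hf i fun h => hz ?_⟩, fun z => ?_⟩
  · rw [coeff_op, h, map_zero]
  · filter_upwards [h.ev z] with i hi
    rw [coeff_op, coeff_op, hi]

/-- A derivation of the coefficients. -/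
def ofDerivation (δ : Derivation ℤ A A) : CoeffDerivation Γ A where
  d _ := δ.toLinearMap.toAddMonoidHom
  leibniz x y a b := by
    change δ (a * b) = δ a * b + a * δ b
    rw [Derivation.leibniz, smul_eq_mul, smul_eq_mul]; ring

/-- The derivation `X ^ x ↦ w x • X ^ x` given by an additive function `w`. -/
def ofWeight (w : Γ →+ ℤ) : CoeffDerivation Γ A where
  d x := AddMonoidHom.mulLeft ((w x : ℤ) : A)
  leibniz x y a b := by
    simp only [AddMonoidHom.coe_mulLeft, map_add, Int.cast_add]; ring

end CoeffDerivation

/-! ### Limits of inverses -/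

lemma TendstoCoeff.bdd_mul {ι : Type*} {l : Filter ι} [l.NeBot] {f h : ι → HahnSeries Γ A}
    (hf : ∃ S : Set Γ, S.IsPWO ∧ ∀ i, (f i).support ⊆ S) (hh : TendstoCoeff l h 0) :
    TendstoCoeff l (fun i => f i * h i) 0 := by
  obtain ⟨S, hS, hf⟩ := hf
  obtain ⟨T, hT, hh'⟩ := hh.bdd
  refine ⟨⟨S + T, hS.add hT, fun i => ?_⟩, fun z => ?_⟩
  · exact support_mul_subset.trans (Set.add_subset_add (hf i) (hh' i))
  · have : ∀ᶠ i in l, ∀ ij ∈ Finset.antidiagonal hS hT z, (h i).coeff ij.2 = 0 := by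
      rw [eventually_all_finset]
      exact fun ij _ => hh.ev _
    filter_upwards [this] with i hi
    rw [coeff_mul_of_support_subset hS hT (hf i) (hh' i), coeff_zero]
    exact Finset.sum_eq_zero fun ij hij => by rw [hi ij hij, mul_zero]

/-- It follows from `f⁻¹ = g⁻¹ + g⁻¹ * (f⁻¹ * (g - f))`, where `g - f` tends to zero and `f⁻¹` only
needs supports in a common set. -/
lemma TendstoCoeff.inv {ι : Type*} {l : Filter ι} [l.NeBot] {f : ι → (HahnSeries Γ A)ˣ}
    {g : (HahnSeries Γ A)ˣ} (h : TendstoCoeff l (fun i => (f i : HahnSeries Γ A)) g)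
    (hf : ∃ S : Set Γ, S.IsPWO ∧ ∀ i, ((f i)⁻¹ : (HahnSeries Γ A)ˣ).val.support ⊆ S) :
    TendstoCoeff l (fun i => ((f i)⁻¹ : (HahnSeries Γ A)ˣ).val) (g⁻¹ : (HahnSeries Γ A)ˣ).val := by
  have h0 : TendstoCoeff l (fun i => g.val - (f i).val) 0 := by
    simpa using (TendstoCoeff.const (g : HahnSeries Γ A)).sub h
  have h1 := (TendstoCoeff.const (l := l) (g⁻¹ : (HahnSeries Γ A)ˣ).val).add
    ((TendstoCoeff.const (l := l) (g⁻¹ : (HahnSeries Γ A)ˣ).val).mul (TendstoCoeff.bdd_mul hf h0))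
  rw [mul_zero, add_zero] at h1
  convert h1 using 2 with i
  have e1 : ((f i)⁻¹ : (HahnSeries Γ A)ˣ).val * (f i).val = 1 := (f i).inv_mul
  have e2 : (g⁻¹ : (HahnSeries Γ A)ˣ).val * g.val = 1 := g.inv_mul
  linear_combination (g⁻¹ : (HahnSeries Γ A)ˣ).val * e1 - ((f i)⁻¹ : (HahnSeries Γ A)ˣ).val * e2

/-- In `g = 1 + (1 - f) * g`, a least index of `g` outside `M` would be the sum of a positive
element of `M` and a smaller index of `g`, which already lies in `M`. -/
lemma support_subset_of_isPosOne_inv {f g : HahnSeries Γ A} {M : AddSubmonoid Γ}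
    (hf : IsPosOne f) (hfM : f.support ⊆ M) (h : f * g = 1) : g.support ⊆ M := by
  by_contra hne
  set D : Set Γ := g.support \ M with hD
  have hDne : D.Nonempty := Set.sdiff_nonempty.2 hne
  have hwf : D.IsWF := (g.isPWO_support.mono Set.sdiff_subset).isWF
  set z := hwf.min hDne with hz
  obtain ⟨hz1, hz2⟩ : z ∈ D := hwf.min_mem hDne
  have hz0 : z ≠ 0 := fun h0 => hz2 (by rw [h0]; exact zero_mem M)
  have hg : g = 1 + (1 - f) * g := by rw [sub_mul, h]; ring
  refine hz1 ?_
  rw [hg, coeff_add, coeff_one, if_neg hz0, zero_add, coeff_mul]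
  refine Finset.sum_eq_zero fun ij hij => ?_
  rw [Finset.mem_antidiagonal] at hij
  exfalso
  have hi0 : ij.1 ≠ 0 := fun h0 => hij.1 (by rw [h0, coeff_sub, coeff_one, if_pos rfl, hf.zero,
    sub_self])
  have hfi : f.coeff ij.1 ≠ 0 := fun h0 => hij.1 (by
    rw [coeff_sub, coeff_one, if_neg hi0, h0, sub_zero])
  have hipos : 0 < ij.1 := by
    rcases lt_trichotomy ij.1 0 with h' | h' | h'
    · exact absurd (hf.neg _ h') hfi
    · exact absurd h' hi0
    · exact h'
  have hlt : ij.2 < z := by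
    rw [← hij.2.2]; exact lt_add_of_pos_left _ hipos
  have hjM : ij.2 ∈ M := by
    by_contra hj
    exact hwf.not_lt_min hDne ⟨hij.2.1, hj⟩ hlt
  exact hz2 (by rw [← hij.2.2]; exact add_mem (hfM hfi) hjM)

lemma support_pow_subset_nsmul {f : HahnSeries Γ A} {S : Set Γ} (hf : f.support ⊆ S) (j : ℕ) :
    (f ^ j).support ⊆ j • S := by
  induction j with
  | zero =>
    intro z hz
    rw [pow_zero, mem_support, coeff_one] at hz
    rw [zero_nsmul]
    by_contra h
    exact hz (if_neg h)
  | succ j ih =>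
    rw [pow_succ, succ_nsmul]
    exact support_mul_subset.trans (Set.add_subset_add ih hf)

lemma nsmul_subset_nsmul {S : Set Γ} (h0 : 0 ∈ S) {j k : ℕ} (h : j ≤ k) : j • S ⊆ k • S := by
  induction k, h using Nat.le_induction with
  | base => exact subset_rfl
  | succ k _ ih =>
    rw [succ_nsmul]
    exact ih.trans fun x hx => ⟨x, hx, 0, h0, add_zero x⟩

/-- The inverse is the finite geometric sum of the powers of `1 - f` below `k`. -/
lemma support_subset_of_nilpotent_inv {f g : HahnSeries Γ A} {S : Set Γ} (h0 : 0 ∈ S) {k : ℕ}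
    (hk : (1 - f) ^ k = 0) (hf : f.support ⊆ S) (h : f * g = 1) : g.support ⊆ k • S := by
  have hsub : (1 - f).support ⊆ S := by
    intro z hz
    by_cases hz0 : z = 0
    · rwa [hz0]
    · refine hf fun h' => hz ?_
      rw [coeff_sub, coeff_one, if_neg hz0, h', sub_zero]
  have hg : g = ∑ j ∈ Finset.range k, (1 - f) ^ j := by
    have h1 := mul_neg_geom_sum (1 - f) k
    rw [sub_sub_cancel, hk, sub_zero] at h1
    calc g = (f * ∑ j ∈ Finset.range k, (1 - f) ^ j) * g := by rw [h1, one_mul]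
      _ = (f * g) * ∑ j ∈ Finset.range k, (1 - f) ^ j := by ring
      _ = _ := by rw [h, one_mul]
  intro z hz
  rw [hg, mem_support, coeff_sum] at hz
  obtain ⟨j, hj, hne⟩ := Finset.exists_ne_zero_of_sum_ne_zero hz
  exact nsmul_subset_nsmul h0 (Finset.mem_range.1 hj).le (support_pow_subset_nsmul hsub j hne)

end CoefficientwiseDerivations

/-! ### Constant terms of products of geometric series -/

section GeometricSeries

variable {Γ A : Type*} [AddCommGroup Γ] [LinearOrder Γ] [IsOrderedAddMonoid Γ] [CommRing A]

lemma TendstoCoeff.prod {ι κ : Type*} {l : Filter ι} [l.NeBot] (s : Finset κ)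
    {f : κ → ι → HahnSeries Γ A} {g : κ → HahnSeries Γ A}
    (h : ∀ k ∈ s, TendstoCoeff l (f k) (g k)) :
    TendstoCoeff l (fun i => ∏ k ∈ s, f k i) (∏ k ∈ s, g k) := by
  classical
  induction s using Finset.induction_on with
  | empty => simpa using TendstoCoeff.const (1 : HahnSeries Γ A)
  | insert k s hk ih =>
    simp only [Finset.prod_insert hk]
    exact (h k (Finset.mem_insert_self k s)).mul
      (ih fun j hj => h j (Finset.mem_insert_of_mem hj))

lemma eventually_nsmul_ne {x : Γ} (hx : x ≠ 0) (z : Γ) : ∀ᶠ m : ℕ in atTop, m • x ≠ z := by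
  by_cases h : ∃ k : ℕ, k • x = z
  · obtain ⟨k, rfl⟩ := h
    filter_upwards [eventually_gt_atTop k] with m hm h
    have h0 : ((m : ℤ) - k) • x = 0 := by
      rw [sub_zsmul, natCast_zsmul, natCast_zsmul, h, add_neg_cancel]
    rcases smul_eq_zero.1 h0 with h1 | h1
    · omega
    · exact hx h1
  · exact Eventually.of_forall fun m hm => h ⟨m, hm⟩

lemma tendsto_single_pow {x : Γ} (hx : x ≠ 0) {a : A} (ha : 0 < x ∨ IsNilpotent a) :
    TendstoCoeff atTop (fun m : ℕ => single (m • x) (a ^ m)) (0 : HahnSeries Γ A) := by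
  have hsup : ∀ m : ℕ, (single (m • x) (a ^ m)).support ⊆ {z | ∃ m : ℕ, a ^ m ≠ 0 ∧ m • x = z} := by
    intro m z hz
    rw [mem_support, coeff_single] at hz
    split_ifs at hz with h
    · exact ⟨m, hz, h.symm⟩
    · exact absurd rfl hz
  refine ⟨⟨_, ?_, hsup⟩, fun z => ?_⟩
  · rcases ha with hpos | ⟨k, hk⟩
    · have hmono : Monotone fun m : ℕ => m • x := fun _ _ h => nsmul_le_nsmul_left hpos.le h
      refine (Set.IsPWO.image_of_monotone (s := Set.univ) (Set.isPWO_of_wellQuasiOrderedLE _)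
        hmono).mono ?_
      rintro z ⟨m, -, rfl⟩
      exact ⟨m, trivial, rfl⟩
    · refine ((Finset.range k).image fun m => m • x).finite_toSet.isPWO.mono ?_
      rintro z ⟨m, hm, rfl⟩
      simp only [Finset.coe_image, Set.mem_image, Finset.mem_coe, Finset.mem_range]
      refine ⟨m, ?_, rfl⟩
      by_contra hmk
      exact hm (pow_eq_zero_of_le (not_lt.1 hmk) hk)
  · filter_upwards [eventually_nsmul_ne hx z] with m hm
    rw [coeff_single, if_neg (Ne.symm hm), coeff_zero]

/-- The geometric series converges to the inverse of `1 - a X ^ x`. -/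
lemma tendsto_geometric {x : Γ} (hx : x ≠ 0) {a : A} (ha : 0 < x ∨ IsNilpotent a)
    {v : HahnSeries Γ A} (hv : (1 - single x a) * v = 1) :
    TendstoCoeff atTop (fun M : ℕ => ∑ m ∈ Finset.range M, single (m • x) (a ^ m)) v := by
  have h1 := (TendstoCoeff.const (l := atTop) v).mul
    ((TendstoCoeff.const (l := atTop) (1 : HahnSeries Γ A)).sub (tendsto_single_pow hx ha))
  rw [sub_zero, mul_one] at h1
  convert h1 using 2 with M
  have h2 := mul_neg_geom_sum (single x a) M
  simp only [single_pow] at h2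
  rw [← h2]
  linear_combination (-(∑ m ∈ Finset.range M, single (m • x) (a ^ m))) * hv

variable {ι : Type*} [Fintype ι] [DecidableEq ι]

lemma tendsto_prod_geometric {x : ι → Γ} {a : ι → A} (hx : ∀ i, x i ≠ 0)
    (ha : ∀ i, 0 < x i ∨ IsNilpotent (a i)) {v : ι → HahnSeries Γ A}
    (hv : ∀ i, (1 - single (x i) (a i)) * v i = 1) :
    TendstoCoeff atTop (fun M : ℕ => ∑ m ∈ Fintype.piFinset fun _ : ι => Finset.range M,
      single (∑ i, (m i + 1) • x i) (∏ i, a i ^ m i)) (∏ i, single (x i) 1 * v i) := by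
  have h := TendstoCoeff.prod (l := atTop) Finset.univ fun i _ =>
    (TendstoCoeff.const (single (x i) (1 : A))).mul (tendsto_geometric (hx i) (ha i) (hv i))
  convert h using 2 with M
  simp only [Finset.mul_sum, single_mul_single, one_mul]
  rw [Finset.prod_univ_sum]
  refine Finset.sum_congr rfl fun m _ => ?_
  have key : ∀ s : Finset ι, ∏ i ∈ s, single (x i + m i • x i) (a i ^ m i) =
      single (∑ i ∈ s, (m i + 1) • x i) (∏ i ∈ s, a i ^ m i) := by
    intro s
    induction s using Finset.induction_on with
    | empty => simp
    | insert k s hk ih =>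
      rw [Finset.prod_insert hk, ih, single_mul_single, Finset.sum_insert hk,
        Finset.prod_insert hk, succ_nsmul', add_comm (x k)]
  exact (key _).symm

/-- If no relation with positive coefficients holds between the exponents, the constant term of
`∏ X ^ x / (1 - a X ^ x)` vanishes. -/
lemma coeff_zero_prod_eq_zero {x : ι → Γ} {a : ι → A} (hx : ∀ i, x i ≠ 0)
    (ha : ∀ i, 0 < x i ∨ IsNilpotent (a i)) {v : ι → HahnSeries Γ A}
    (hv : ∀ i, (1 - single (x i) (a i)) * v i = 1)
    (hrel : ∀ m : ι → ℕ, (∀ i, 0 < m i) → ∑ i, m i • x i ≠ 0) :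
    (∏ i, single (x i) 1 * v i).coeff 0 = 0 := by
  obtain ⟨M, hM⟩ := ((tendsto_prod_geometric hx ha hv).ev 0).exists
  rw [← hM, coeff_sum]
  refine Finset.sum_eq_zero fun m _ => ?_
  rw [coeff_single, if_neg]
  exact fun h => hrel (fun i => m i + 1) (fun i => Nat.succ_pos _) h.symm

/-- The constant term of `∏ X ^ x / (1 - a X ^ x)` if the relations with positive coefficients
between the exponents are the multiples of `P`. -/
lemma coeff_zero_prod_mul [Nonempty ι] {x : ι → Γ} {a : ι → A} (hx : ∀ i, x i ≠ 0)
    (ha : ∀ i, 0 < x i ∨ IsNilpotent (a i)) {v : ι → HahnSeries Γ A}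
    (hv : ∀ i, (1 - single (x i) (a i)) * v i = 1) {P : ι → ℕ} (hP : ∀ i, 0 < P i)
    (hPx : ∑ i, P i • x i = 0)
    (hrel : ∀ m : ι → ℕ, (∀ i, 0 < m i) → ∑ i, m i • x i = 0 → ∃ s : ℕ, ∀ i, m i = s * P i)
    (hw : IsNilpotent (∏ i, a i ^ P i)) :
    (∏ i, single (x i) 1 * v i).coeff 0 * (1 - ∏ i, a i ^ P i) = ∏ i, a i ^ (P i - 1) := by
  obtain ⟨k, hk⟩ := hw
  set w := ∏ i, a i ^ P i with hwdef
  -- The truncation is taken so large that the box of exponents contains the tuples of the first `k`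
  -- multiples of `P`; the further multiples contribute zero because `w ^ k = 0`.
  obtain ⟨M, hM, hMk⟩ := (((tendsto_prod_geometric hx ha hv).ev 0).and
    (eventually_ge_atTop (k * ∑ i, P i))).exists
  -- The factor `X ^ x` shifts each exponent by one, so the tuple `m` contributes to the constant
  -- term when `m + 1` is a relation, that is, a positive multiple `(s + 1) * P`.
  set ψ : ℕ → ι → ℕ := fun s i => (s + 1) * P i - 1 with hψ
  have hψ1 : ∀ s i, ψ s i + 1 = (s + 1) * P i := fun s i =>
    Nat.sub_add_cancel (Nat.mul_pos (Nat.succ_pos s) (hP i))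
  have hψprod : ∀ s, ∏ i, a i ^ ψ s i = (∏ i, a i ^ (P i - 1)) * w ^ s := by
    intro s
    rw [hwdef, ← Finset.prod_pow, ← Finset.prod_mul_distrib]
    refine Finset.prod_congr rfl fun i _ => ?_
    rw [← pow_mul, ← _root_.pow_add]
    congr 1
    have := hψ1 s i
    have := hP i
    have e : (s + 1) * P i = P i * s + P i := by ring
    omega
  have hψinj : Function.Injective ψ := by
    intro s t hst
    obtain ⟨i⟩ := ‹Nonempty ι›
    have h1 := hψ1 s i
    have h2 := hψ1 t i
    rw [hst, h2] at h1
    have := Nat.eq_of_mul_eq_mul_right (hP i) h1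
    omega
  have hsum : (∏ i, single (x i) 1 * v i).coeff 0 =
      ∑ s ∈ Finset.range k, (∏ i, a i ^ (P i - 1)) * w ^ s := by
    rw [← hM, coeff_sum]
    rw [← Finset.sum_subset (s₁ := (Finset.range k).image ψ)]
    · rw [Finset.sum_image fun s _ t _ h => hψinj h]
      refine Finset.sum_congr rfl fun s _ => ?_
      rw [coeff_single, if_pos, hψprod]
      simp only [hψ1, mul_nsmul', ← Finset.smul_sum, hPx, smul_zero]
    · intro m hm
      obtain ⟨s, hs, rfl⟩ := Finset.mem_image.1 hm
      rw [Fintype.mem_piFinset]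
      intro i
      rw [Finset.mem_range] at hs ⊢
      have h1 := hψ1 s i
      have h2 : P i ≤ ∑ i, P i := Finset.single_le_sum (fun _ _ => Nat.zero_le _)
        (Finset.mem_univ i)
      have h3 : (s + 1) * P i ≤ k * ∑ i, P i := Nat.mul_le_mul hs h2
      omega
    · intro m _ hm
      rw [coeff_single]
      split_ifs with h
      · obtain ⟨s, hs⟩ := hrel (fun i => m i + 1) (fun i => Nat.succ_pos _) h.symm
        obtain ⟨s, rfl⟩ : ∃ t, s = t + 1 := by
          refine ⟨s - 1, ?_⟩
          obtain ⟨i⟩ := ‹Nonempty ι›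
          have := hs i
          rcases s with _ | s
          · simp at this
          · rfl
        have hmψ : m = ψ s := by
          funext i
          have := hs i
          have := hψ1 s i
          omega
        rw [hmψ, hψprod, pow_eq_zero_of_le (m := k) _ hk, mul_zero]
        by_contra hsk
        exact hm (Finset.mem_image.2 ⟨s, Finset.mem_range.2 (not_le.1 hsk), hmψ.symm⟩)
      · rfl
  rw [hsum, ← Finset.mul_sum, mul_assoc, mul_comm _ (1 - w), mul_neg_geom_sum, hk, sub_zero,
    mul_one]

end GeometricSeries

/-! ### The vector of logarithmic derivatives and its limit -/

section LogVector

variable {A : Type*} [CommRing A]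

/-- The three derivations: a derivation of the coefficients, `u ∂/∂u` and `t ∂/∂t`. -/
def coordDerivation (δ : Derivation ℤ A A) : Fin 3 → CoeffDerivation LexZ A :=
  ![CoeffDerivation.ofDerivation δ,
    CoeffDerivation.ofWeight ⟨⟨fun x => (ofLex x).2, rfl⟩, fun _ _ => rfl⟩,
    CoeffDerivation.ofWeight ⟨⟨fun x => (ofLex x).1, rfl⟩, fun _ _ => rfl⟩]

/-- The vector of the three logarithmic derivatives. -/
def logVec (δ : Derivation ℤ A A) (f : (HahnSeries LexZ A)ˣ) : Fin 3 → HahnSeries LexZ A :=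
  fun i => dlog (coordDerivation δ i).op f

/-- The derivatives of `a X ^ x`, divided by `X ^ x`. -/
def dvec (δ : Derivation ℤ A A) (x : ℤ × ℤ) (a : A) : Fin 3 → A :=
  fun i => (coordDerivation δ i).d (toLex x) a

variable (δ : Derivation ℤ A A)

@[simp] lemma dvec_zero' (x : ℤ × ℤ) (a : A) : dvec δ x a 0 = δ a := rfl
@[simp] lemma dvec_one' (x : ℤ × ℤ) (a : A) : dvec δ x a 1 = (x.2 : A) * a := rfl
@[simp] lemma dvec_two' (x : ℤ × ℤ) (a : A) : dvec δ x a 2 = (x.1 : A) * a := rfl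

lemma logVec_mul (f g : (HahnSeries LexZ A)ˣ) : logVec δ (f * g) = logVec δ f + logVec δ g := by
  funext i; exact dlog_mul _ f g

lemma logVec_prod {ι : Type*} (s : Finset ι) (f : ι → (HahnSeries LexZ A)ˣ) :
    logVec δ (∏ i ∈ s, f i) = ∑ i ∈ s, logVec δ (f i) := by
  funext j
  rw [Finset.sum_apply]
  exact dlog_prod _ s f

lemma logVec_map_C (c : Aˣ) :
    logVec δ (Units.map (C : A →+* HahnSeries LexZ A) c) = fun i => C (![dlog δ c, 0, 0] i) := by
  have h : ∀ i, logVec δ (Units.map (C : A →+* HahnSeries LexZ A) c) i =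
      C ((c⁻¹ : Aˣ).val * dvec δ 0 c.val i) := by
    intro i
    have h1 : (Units.map (C : A →+* HahnSeries LexZ A).toMonoidHom c).val = single 0 c.val := rfl
    have h2 : ((Units.map (C : A →+* HahnSeries LexZ A).toMonoidHom c)⁻¹).val =
      single 0 (c⁻¹ : Aˣ).val := rfl
    change ((Units.map (C : A →+* HahnSeries LexZ A).toMonoidHom c)⁻¹).val *
      (coordDerivation δ i).op (Units.map (C : A →+* HahnSeries LexZ A).toMonoidHom c).val = _
    rw [h1, h2, CoeffDerivation.op_single, single_mul_single, add_zero]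
    rfl
  funext i
  rw [h]
  fin_cases i <;> simp [dlog]

lemma logVec_xpow (x : ℤ × ℤ) :
    logVec δ (xpow A (toLex x)) = fun i => C (![0, (x.2 : A), (x.1 : A)] i) := by
  have h : ∀ i, logVec δ (xpow A (toLex x)) i = C (dvec δ x 1 i) := by
    intro i
    have h1 : (xpow A (toLex x)).val = single (toLex x) 1 := rfl
    have h2 : ((xpow A (toLex x))⁻¹).val = single (-toLex x) 1 := rfl
    change ((xpow A (toLex x))⁻¹).val * (coordDerivation δ i).op (xpow A (toLex x)).val = _
    rw [h1, h2, CoeffDerivation.op_single, single_mul_single, neg_add_cancel, one_mul]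
    rfl
  funext i
  rw [h]
  fin_cases i <;> simp

lemma TendstoCoeff.det3 {ι : Type*} {l : Filter ι} [l.NeBot]
    {p q r : ι → Fin 3 → HahnSeries LexZ A} {p' q' r' : Fin 3 → HahnSeries LexZ A}
    (hp : ∀ i, TendstoCoeff l (fun j => p j i) (p' i))
    (hq : ∀ i, TendstoCoeff l (fun j => q j i) (q' i))
    (hr : ∀ i, TendstoCoeff l (fun j => r j i) (r' i)) :
    TendstoCoeff l (fun j => det3 (p j) (q j) (r j)) (det3 p' q' r') :=
  (((hp 0).mul (((hq 1).mul (hr 2)).sub ((hq 2).mul (hr 1)))).add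
    ((hp 1).mul (((hq 2).mul (hr 0)).sub ((hq 0).mul (hr 2))))).add
    ((hp 2).mul (((hq 0).mul (hr 1)).sub ((hq 1).mul (hr 0))))

namespace Factorization

variable (D E F : Factorization A)

lemma pos_or_isNilpotent {x : ℤ × ℤ} (hx : x ≠ 0) : 0 < toLex x ∨ IsNilpotent (D.a x) := by
  rcases lt_trichotomy (toLex x) 0 with h | h | h
  · exact Or.inr (D.nilp x ((lexNeg_iff x).2 h))
  · exact absurd h hx
  · exact Or.inl h

lemma isUnit_factor (x : ℤ × ℤ) : IsUnit (1 - single (toLex x) (D.a x) : HahnSeries LexZ A) := by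
  by_cases hx : x = 0
  · have : D.a x = 0 := by rw [hx]; exact D.a_zero
    rw [this, single_eq_zero, sub_zero]
    exact isUnit_one
  rcases D.pos_or_isNilpotent hx with h | h
  · have : IsPosOne (1 - single (toLex x) (D.a x) : HahnSeries LexZ A) := by
      have := isPosOne_eprod D.aPos_lt {toLex x}
      simpa [eprod, aPos, h] using this
    exact this.isUnit
  · refine IsNilpotent.isUnit_one_sub ?_
    obtain ⟨k, hk⟩ := h
    exact ⟨k, by rw [single_pow, hk, single_eq_zero]⟩

/-- The unit `1 - a X ^ x`. -/
def unitFactor (x : ℤ × ℤ) : (HahnSeries LexZ A)ˣ := (D.isUnit_factor x).unit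

lemma coe_unitFactor (x : ℤ × ℤ) : (D.unitFactor x).val = 1 - single (toLex x) (D.a x) := rfl

/-- The partial product over a finite set of indices. -/
def partialUnit (G : Finset (ℤ × ℤ)) : (HahnSeries LexZ A)ˣ :=
  Units.map (C : A →+* HahnSeries LexZ A) D.c * monomial D.ν₁ D.ν₂ * ∏ x ∈ G, D.unitFactor x

lemma coe_prod_unitFactor (G : Finset (ℤ × ℤ)) :
    (∏ x ∈ G, D.unitFactor x).val = eprod D.aNeg G * eprod D.aPos G := by
  change _ = (∏ x ∈ G, (1 - single (toLex x) (D.aNeg (toLex x)))) *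
    ∏ x ∈ G, (1 - single (toLex x) (D.aPos (toLex x)))
  rw [Units.coe_prod, ← Finset.prod_mul_distrib]
  refine Finset.prod_congr rfl fun x _ => ?_
  rw [coe_unitFactor, D.a_eq x]
  rcases lt_trichotomy (toLex x) 0 with h | h | h
  · have : D.aPos (toLex x) = 0 := by simp [aPos, h.le]
    simp [this]
  · have h1 : D.aPos (toLex x) = 0 := by simp [aPos, h.le]
    have h2 : D.aNeg (toLex x) = 0 := by simp [aNeg, h.ge]
    simp [h1, h2]
  · have : D.aNeg (toLex x) = 0 := by simp [aNeg, h.le]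
    simp [this]

lemma tendsto_partialUnit {f : (HahnSeries LexZ A)ˣ} (hf : D.Decomposes f.val) :
    TendstoCoeff atTop (fun G => (D.partialUnit G).val) f.val := by
  obtain ⟨n, p, hn, hp, h⟩ := hf
  have h1 := (TendstoCoeff.const (l := atTop) (C (D.c : A) * (monomial D.ν₁ D.ν₂).val)).mul
    (hn.mul hp)
  have h2 : (fun G => (D.partialUnit G).val) =
      fun G => C (D.c : A) * (monomial D.ν₁ D.ν₂).val * (eprod D.aNeg G * eprod D.aPos G) := by
    funext G
    rw [partialUnit, Units.val_mul, coe_prod_unitFactor, Units.val_mul]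
    rfl
  have h3 : f.val = C (D.c : A) * (monomial D.ν₁ D.ν₂).val * (n * p) := by rw [h]; ring
  rw [h2, h3]
  exact h1

/-- The inverse of a negative partial product is a geometric sum of bounded length, and the inverse
of a positive one stays in the monoid of its indices. This is the uniform bound required by
`TendstoCoeff.inv`. -/
lemma bdd_inv_partialUnit (hA : IsNilpotent (nilradical A)) :
    ∃ S : Set LexZ, S.IsPWO ∧
      ∀ G, ((D.partialUnit G)⁻¹ : (HahnSeries LexZ A)ˣ).val.support ⊆ S := by
  obtain ⟨n, hn⟩ := D.exists_tendsto_aNeg hA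
  obtain ⟨S, hS, hSn⟩ := hn.bdd
  obtain ⟨k, hk⟩ := hA
  set M := AddSubmonoid.closure (Function.support D.aPos)
  have hM : (M : Set LexZ).IsPWO :=
    D.isPWO_aPos.addSubmonoid_closure fun x hx => (D.aPos_lt x hx).le
  set w : (HahnSeries LexZ A)ˣ :=
    (Units.map (C : A →+* HahnSeries LexZ A) D.c * monomial D.ν₁ D.ν₂)⁻¹ with hw
  refine ⟨w.val.support + (k • insert 0 S + M), w.val.isPWO_support.add
    ((isPWO_nsmul (hS.insert 0) k).add hM), fun G => ?_⟩
  obtain ⟨un, hun⟩ := (isNegOne_eprod D.aNeg_mem D.aNeg_lt G).isUnit ⟨k, hk⟩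
  obtain ⟨up, hup⟩ := (isPosOne_eprod D.aPos_lt G).isUnit
  have hprod : ∏ x ∈ G, D.unitFactor x = un * up := by
    ext1
    rw [coe_prod_unitFactor, Units.val_mul, hun, hup]
  have hneg : (un⁻¹).val.support ⊆ k • insert 0 S := by
    refine support_subset_of_nilpotent_inv (f := un.val) (Set.mem_insert _ _) ?_ ?_ un.mul_inv
    · have h1 := (isNegOne_eprod D.aNeg_mem D.aNeg_lt G).sub_one_mem
      have h2 : 1 - un.val ∈ coeffIdeal LexZ (nilradical A) := by
        rw [hun, ← neg_sub]; exact neg_mem h1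
      have h3 := pow_mem_coeffIdeal h2 k
      rw [hk] at h3
      exact eq_zero_of_mem_coeffIdeal_bot h3
    · rw [hun]
      exact (hSn G).trans (Set.subset_insert _ _)
  have hpos : (up⁻¹).val.support ⊆ M := by
    refine support_subset_of_isPosOne_inv (f := up.val) ?_ ?_ up.mul_inv
    · rw [hup]; exact isPosOne_eprod D.aPos_lt G
    · rw [hup]; exact support_eprod_subset_closure _ _
  rw [partialUnit, mul_inv, ← hw, hprod, mul_inv, Units.val_mul, Units.val_mul]
  exact support_mul_subset.trans (Set.add_subset_add subset_rfl
    (support_mul_subset.trans (Set.add_subset_add hneg hpos)))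

lemma tendsto_logVec (hA : IsNilpotent (nilradical A)) {f : (HahnSeries LexZ A)ˣ}
    (hf : D.Decomposes f.val) (i : Fin 3) :
    TendstoCoeff atTop (fun G => logVec δ (D.partialUnit G) i) (logVec δ f i) :=
  ((D.tendsto_partialUnit hf).inv (D.bdd_inv_partialUnit hA)).mul
    ((coordDerivation δ i).tendsto_op (D.tendsto_partialUnit hf))

/-- The series `X ^ x / (1 - a X ^ x)`. -/
def geom (x : ℤ × ℤ) : HahnSeries LexZ A := single (toLex x) 1 * (D.unitFactor x)⁻¹.val

lemma logVec_unitFactor (x : ℤ × ℤ) :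
    logVec δ (D.unitFactor x) = fun i => D.geom x * C (- dvec δ x (D.a x) i) := by
  funext i
  change (D.unitFactor x)⁻¹.val * (coordDerivation δ i).op (D.unitFactor x).val = _
  rw [coe_unitFactor, map_sub, Derivation.map_one_eq_zero, CoeffDerivation.op_single, zero_sub]
  have : single (toLex x) ((coordDerivation δ i).d (toLex x) (D.a x)) =
      single (toLex x) 1 * C (dvec δ x (D.a x) i) := by
    rw [C_apply, single_mul_single, add_zero, one_mul]; rfl
  rw [this, geom, map_neg]
  ring

/-- The constant part of the vector of logarithmic derivatives. -/
def constVec (v₁ v₂ : ℤ) : Fin 3 → A := ![dlog δ D.c, (v₂ : A), (v₁ : A)]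

/-- Constant orders are needed here: the monomial is then an honest `X ^ (v₁, v₂)`, with integers as
its logarithmic derivatives under `u ∂/∂u` and `t ∂/∂t`. -/
lemma logVec_partialUnit {v₁ v₂ : ℤ} (h₁ : ∀ p, D.ν₁ p = v₁) (h₂ : ∀ p, D.ν₂ p = v₂)
    (G : Finset (ℤ × ℤ)) : logVec δ (D.partialUnit G) =
      (fun i => C (D.constVec δ v₁ v₂ i)) +
        ∑ x ∈ G, fun i => D.geom x * C (- dvec δ x (D.a x) i) := by
  have hm : monomial D.ν₁ D.ν₂ = xpow A (toLex (v₁, v₂)) := by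
    rw [monomial, lpow_of_const h₂, lpow_of_const h₁, ← xpow_zsmul, ← xpow_zsmul, ← xpow_add]
    congr 1
    change v₂ • ((0, 1) : ℤ × ℤ) + v₁ • ((1, 0) : ℤ × ℤ) = (v₁, v₂)
    ext <;> simp
  rw [partialUnit, logVec_mul, logVec_mul, logVec_map_C, hm, logVec_xpow, logVec_prod]
  simp only [logVec_unitFactor]
  congr 1
  funext i
  rw [Pi.add_apply, ← map_add]
  fin_cases i <;> simp [constVec]

end Factorization

end LogVector

/-! ### Logarithmic derivatives of `T`, `S`, `Q` as residues -/

section Residues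

variable {A : Type*} [CommRing A] (δ : Derivation ℤ A A)

/-- Here `κ` stands for `a ^ (m - 1) * b ^ (n - 1) / (1 - a ^ m * b ^ n)`. In the application it is
the constant term of a product of two geometric series. -/
lemma dlog_one_sub_mul_pow {a b : A} {m n : ℕ} (hm : 0 < m) (hn : 0 < n)
    (hw : IsNilpotent (a ^ m * b ^ n)) {κ : A}
    (hκ : κ * (1 - a ^ m * b ^ n) = a ^ (m - 1) * b ^ (n - 1)) :
    dlog δ hw.isUnit_one_sub.unit = - (κ * (m * δ a * b + n * a * δ b)) := by
  set u := hw.isUnit_one_sub.unit with hu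
  have h1 : u.val = 1 - a ^ m * b ^ n := rfl
  have h2 : (u⁻¹).val * u.val = 1 := u.inv_mul
  obtain ⟨m, rfl⟩ : ∃ n, m = n + 1 := ⟨m - 1, by omega⟩
  obtain ⟨n, rfl⟩ : ∃ k, n = k + 1 := ⟨n - 1, by omega⟩
  simp only [Nat.add_sub_cancel] at hκ
  rw [dlog, h1]
  rw [← h1] at hκ
  simp only [map_sub, Derivation.map_one_eq_zero, Derivation.leibniz, Derivation.leibniz_pow,
    smul_eq_mul, nsmul_eq_mul, Nat.add_sub_cancel]
  push_cast
  linear_combination (-(κ * ((m + 1) * δ a * b + (n + 1) * a * δ b))) * h2 +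
    (u⁻¹).val * ((m + 1) * δ a * b + (n + 1) * a * δ b) * hκ

lemma dlog_one_sub_mul_pow₃ {a b c : A} {m n r : ℕ} (hm : 0 < m) (hn : 0 < n) (hr : 0 < r)
    (hw : IsNilpotent (a ^ m * b ^ n * c ^ r)) {κ : A}
    (hκ : κ * (1 - a ^ m * b ^ n * c ^ r) = a ^ (m - 1) * b ^ (n - 1) * c ^ (r - 1)) :
    dlog δ hw.isUnit_one_sub.unit =
      - (κ * (m * δ a * b * c + n * a * δ b * c + r * a * b * δ c)) := by
  set u := hw.isUnit_one_sub.unit with hu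
  have h1 : u.val = 1 - a ^ m * b ^ n * c ^ r := rfl
  have h2 : (u⁻¹).val * u.val = 1 := u.inv_mul
  obtain ⟨m, rfl⟩ : ∃ n, m = n + 1 := ⟨m - 1, by omega⟩
  obtain ⟨n, rfl⟩ : ∃ k, n = k + 1 := ⟨n - 1, by omega⟩
  obtain ⟨r, rfl⟩ : ∃ k, r = k + 1 := ⟨r - 1, by omega⟩
  simp only [Nat.add_sub_cancel] at hκ
  rw [dlog, h1]
  rw [← h1] at hκ
  simp only [map_sub, Derivation.map_one_eq_zero, Derivation.leibniz, Derivation.leibniz_pow,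
    smul_eq_mul, nsmul_eq_mul, Nat.add_sub_cancel]
  push_cast
  linear_combination
    (-(κ * ((m + 1) * δ a * b * c + (n + 1) * a * δ b * c + (r + 1) * a * b * δ c))) * h2 +
    (u⁻¹).val * ((m + 1) * δ a * b * c + (n + 1) * a * δ b * c + (r + 1) * a * b * δ c) * hκ

namespace Factorization

variable (D E F : Factorization A)

lemma factor_mul_inv (x : ℤ × ℤ) :
    (1 - single (toLex x) (D.a x)) * (D.unitFactor x)⁻¹.val = 1 := (D.unitFactor x).mul_inv

lemma coeff_geom_zero {x : ℤ × ℤ} (hx : x ≠ 0) : (D.geom x).coeff 0 = 0 := by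
  have h := coeff_zero_prod_eq_zero (ι := Fin 1) (x := fun _ => toLex x) (a := fun _ => D.a x)
    (fun _ => hx) (fun _ => D.pos_or_isNilpotent hx) (fun _ => D.factor_mul_inv x)
    (fun m hm h => by
      simp only [Fin.sum_univ_one] at h
      rcases smul_eq_zero.1 h with h | h
      · exact (hm 0).ne' h
      · exact hx h)
  simpa [geom] using h

lemma coeff_geom_mul_geom_eq_zero {x y : ℤ × ℤ} (hx : x ≠ 0) (hy : y ≠ 0)
    (h : ∀ m n : ℕ, 0 < m → 0 < n → m • x + n • y ≠ 0) :
    (D.geom x * E.geom y).coeff 0 = 0 := by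
  have h := coeff_zero_prod_eq_zero (ι := Fin 2) (x := ![toLex x, toLex y]) (a := ![D.a x, E.a y])
    (v := ![(D.unitFactor x)⁻¹.val, (E.unitFactor y)⁻¹.val])
    (by intro i; fin_cases i; exacts [hx, hy])
    (by intro i; fin_cases i; exacts [D.pos_or_isNilpotent hx, E.pos_or_isNilpotent hy])
    (by intro i; fin_cases i; exacts [D.factor_mul_inv x, E.factor_mul_inv y])
    (fun m hm h' => h (m 0) (m 1) (hm 0) (hm 1) (by
      simp only [Fin.sum_univ_two] at h'
      exact h'))
  simpa [geom, Fin.prod_univ_two] using h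

lemma coeff_geom_mul_geom {x y : ℤ × ℤ} (hx : x ≠ 0) (hy : y ≠ 0) {m n : ℕ} (hm : 0 < m)
    (hn : 0 < n) (hrel : m • x + n • y = 0)
    (h : ∀ m' n' : ℕ, m' • x + n' • y = 0 → ∃ s, m' = s * m ∧ n' = s * n) :
    (D.geom x * E.geom y).coeff 0 * (1 - D.a x ^ m * E.a y ^ n) =
      D.a x ^ (m - 1) * E.a y ^ (n - 1) := by
  have h := coeff_zero_prod_mul (ι := Fin 2) (x := ![toLex x, toLex y]) (a := ![D.a x, E.a y])
    (v := ![(D.unitFactor x)⁻¹.val, (E.unitFactor y)⁻¹.val])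
    (by intro i; fin_cases i; exacts [hx, hy])
    (by intro i; fin_cases i; exacts [D.pos_or_isNilpotent hx, E.pos_or_isNilpotent hy])
    (by intro i; fin_cases i; exacts [D.factor_mul_inv x, E.factor_mul_inv y])
    (P := ![m, n]) (by intro i; fin_cases i; exacts [hm, hn])
    (by rw [Fin.sum_univ_two]; exact hrel)
    (fun k _ hk => by
      rw [Fin.sum_univ_two] at hk
      obtain ⟨s, h1, h2⟩ := h (k 0) (k 1) hk
      exact ⟨s, by intro i; fin_cases i; exacts [h1, h2]⟩)
    (by
      rw [Fin.prod_univ_two]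
      exact isNilpotent_of_relation_pair D E hm hn hx hrel)
  simpa [geom, Fin.prod_univ_two] using h

lemma coeff_geom₃_eq_zero {x y z : ℤ × ℤ} (hx : x ≠ 0) (hy : y ≠ 0) (hz : z ≠ 0)
    (h : ∀ m n r : ℕ, 0 < m → 0 < n → 0 < r → m • x + n • y + r • z ≠ 0) :
    (D.geom x * E.geom y * F.geom z).coeff 0 = 0 := by
  have h := coeff_zero_prod_eq_zero (ι := Fin 3) (x := ![toLex x, toLex y, toLex z])
    (a := ![D.a x, E.a y, F.a z])
    (v := ![(D.unitFactor x)⁻¹.val, (E.unitFactor y)⁻¹.val, (F.unitFactor z)⁻¹.val])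
    (by intro i; fin_cases i; exacts [hx, hy, hz])
    (by
      intro i; fin_cases i
      exacts [D.pos_or_isNilpotent hx, E.pos_or_isNilpotent hy, F.pos_or_isNilpotent hz])
    (by
      intro i; fin_cases i
      exacts [D.factor_mul_inv x, E.factor_mul_inv y, F.factor_mul_inv z])
    (fun m hm h' => h (m 0) (m 1) (m 2) (hm 0) (hm 1) (hm 2) (by
      simp only [Fin.sum_univ_three] at h'
      exact h'))
  simpa [geom, Fin.prod_univ_three] using h

lemma coeff_geom₃ {x y z : ℤ × ℤ} (hx : x ≠ 0) (hy : y ≠ 0) (hz : z ≠ 0) {m n r : ℕ}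
    (hm : 0 < m) (hn : 0 < n) (hr : 0 < r) (hrel : m • x + n • y + r • z = 0)
    (h : ∀ m' n' r' : ℕ, m' • x + n' • y + r' • z = 0 →
      ∃ s, m' = s * m ∧ n' = s * n ∧ r' = s * r) :
    (D.geom x * E.geom y * F.geom z).coeff 0 * (1 - D.a x ^ m * E.a y ^ n * F.a z ^ r) =
      D.a x ^ (m - 1) * E.a y ^ (n - 1) * F.a z ^ (r - 1) := by
  have h := coeff_zero_prod_mul (ι := Fin 3) (x := ![toLex x, toLex y, toLex z])
    (a := ![D.a x, E.a y, F.a z])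
    (v := ![(D.unitFactor x)⁻¹.val, (E.unitFactor y)⁻¹.val, (F.unitFactor z)⁻¹.val])
    (by intro i; fin_cases i; exacts [hx, hy, hz])
    (by
      intro i; fin_cases i
      exacts [D.pos_or_isNilpotent hx, E.pos_or_isNilpotent hy, F.pos_or_isNilpotent hz])
    (by
      intro i; fin_cases i
      exacts [D.factor_mul_inv x, E.factor_mul_inv y, F.factor_mul_inv z])
    (P := ![m, n, r]) (by intro i; fin_cases i; exacts [hm, hn, hr])
    (by rw [Fin.sum_univ_three]; exact hrel)
    (fun k _ hk => by
      rw [Fin.sum_univ_three] at hk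
      obtain ⟨s, h1, h2, h3⟩ := h (k 0) (k 1) (k 2) hk
      exact ⟨s, by intro i; fin_cases i; exacts [h1, h2, h3]⟩)
    (by
      rw [Fin.prod_univ_three]
      exact isNilpotent_of_relation D E F hm hn hx hrel)
  simpa [geom, Fin.prod_univ_three] using h

/-- For determinants of the same sign, the constant term is the quotient `κ` of
`dlog_one_sub_mul_pow₃`, and the exponent of `symT` times the primitive relation gives back the
determinants. Otherwise either no positive relation exists and the constant term vanishes, or the
vectors are collinear and the determinants vanish. -/
lemma dlog_termT (x y z : ℤ × ℤ) :
    dlog δ (termT D E F (x, y, z)) = - ((D.geom x * E.geom y * F.geom z).coeff 0 *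
      det3 (dvec δ x (D.a x)) (dvec δ y (E.a y)) (dvec δ z (F.a z))) := by
  have hdet : det3 (dvec δ x (D.a x)) (dvec δ y (E.a y)) (dvec δ z (F.a z)) =
      det y z * δ (D.a x) * E.a y * F.a z + det z x * D.a x * δ (E.a y) * F.a z +
        det x y * D.a x * E.a y * δ (F.a z) := by
    simp only [det3, dvec_zero', dvec_one', dvec_two', det]
    push_cast
    ring
  rw [hdet]
  by_cases hs : SameSign x y z
  · obtain ⟨P, Q, S, hP, hQ, hS, eP, eQ, eS, fP, fQ, fS, hrel, huniq⟩ :=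
      exists_relation_of_sameSign hs
    have hx : x ≠ 0 := by rintro rfl; rcases hs with h | h <;> simp [det] at h
    have hy : y ≠ 0 := by rintro rfl; rcases hs with h | h <;> simp [det] at h
    have hz : z ≠ 0 := by rintro rfl; rcases hs with h | h <;> simp [det] at h
    have hκ := coeff_geom₃ D E F hx hy hz hP hQ hS hrel huniq
    have hT : tArg x y z (D.a x) (E.a y) (F.a z) = D.a x ^ P * E.a y ^ Q * F.a z ^ S := by
      change D.a x ^ ((det y z).natAbs / detGcd x y z) * E.a y ^ ((det z x).natAbs / detGcd x y z) *
        F.a z ^ ((det x y).natAbs / detGcd x y z) = _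
      rw [eP, eQ, eS]
    have hnil := isNilpotent_of_relation D E F hP hQ hx hrel
    have hp : det y z = tExp x y z * P ∧ det z x = tExp x y z * Q ∧ det x y = tExp x y z * S := by
      rcases hs with h | h
      · rw [tExp, if_pos h.1]
        refine ⟨?_, ?_, ?_⟩ <;> rw [mul_comm]
        · have : ((det y z).natAbs : ℤ) = P * detGcd x y z := by exact_mod_cast fP
          omega
        · have : ((det z x).natAbs : ℤ) = Q * detGcd x y z := by exact_mod_cast fQ
          omega
        · have : ((det x y).natAbs : ℤ) = S * detGcd x y z := by exact_mod_cast fS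
          omega
      · rw [tExp, if_neg (lt_asymm h.1)]
        refine ⟨?_, ?_, ?_⟩ <;> rw [mul_comm, mul_neg]
        · have : ((det y z).natAbs : ℤ) = P * detGcd x y z := by exact_mod_cast fP
          omega
        · have : ((det z x).natAbs : ℤ) = Q * detGcd x y z := by exact_mod_cast fQ
          omega
        · have : ((det x y).natAbs : ℤ) = S * detGcd x y z := by exact_mod_cast fS
          omega
    rw [termT, symT_of_sameSign hs, hT, oneSubPow_eq hnil, dlog_zpow,
      dlog_one_sub_mul_pow₃ δ hP hQ hS hnil hκ]
    rw [hp.1, hp.2.1, hp.2.2]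
    push_cast
    ring
  · rw [termT, symT_of_not_sameSign hs, dlog_one]
    by_cases hx : x = 0
    · rw [hx, show D.a 0 = 0 from D.a_zero]; simp
    by_cases hy : y = 0
    · rw [hy, show E.a 0 = 0 from E.a_zero]; simp
    by_cases hz : z = 0
    · rw [hz, show F.a 0 = 0 from F.a_zero]; simp
    by_cases h : ∃ m n r : ℕ, 0 < m ∧ 0 < n ∧ 0 < r ∧ m • x + n • y + r • z = 0
    · obtain ⟨m, n, r, hm, hn, hr, hrel⟩ := h
      obtain ⟨h1, h2, h3⟩ := (sameSign_or_of_relation hm hn hr hrel).resolve_left hs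
      rw [h1, h2, h3]; simp
    · rw [coeff_geom₃_eq_zero D E F hx hy hz fun m n r hm hn hr hrel =>
        h ⟨m, n, r, hm, hn, hr, hrel⟩, zero_mul, neg_zero]

/-- The exponent of `symS` is minus the signed gcd, and the signed gcd times the primitive relation
`(m, n)` is `(y.2, -x.2)`; this produces the coefficients on the right. In the excluded cases the
constant term, a coefficient of the series, or both second coordinates vanish. -/
lemma dlog_termS (x y : ℤ × ℤ) :
    dlog δ (termS D E (x, y)) = (D.geom x * E.geom y).coeff 0 *
      (y.2 * δ (D.a x) * E.a y - x.2 * D.a x * δ (E.a y)) := by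
  simp only [termS, symS]
  split_ifs with hc
  · rw [dlog_one]
    by_cases hx : x = 0
    · rw [hx, show D.a 0 = 0 from D.a_zero]; simp
    by_cases hy : y = 0
    · rw [hy, show E.a 0 = 0 from E.a_zero]; simp
    by_cases h : ∃ m n : ℕ, 0 < m ∧ 0 < n ∧ m • x + n • y = 0
    · obtain ⟨m, n, hm, hn, hrel⟩ := h
      obtain ⟨h1, h2⟩ := opposite_of_relation hm hn hx hrel
      have h3 : x.2 * y.2 = 0 := by
        rcases hc with hc | hc | hc
        · exact absurd h1 hc
        · omega
        · exact hc
      have e2 : (m : ℤ) * x.2 + n * y.2 = 0 := by simpa using congrArg Prod.snd hrel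
      have hm' : (m : ℤ) ≠ 0 := by exact_mod_cast hm.ne'
      have hn' : (n : ℤ) ≠ 0 := by exact_mod_cast hn.ne'
      have : x.2 = 0 ∧ y.2 = 0 := by
        rcases mul_eq_zero.1 h3 with h | h <;> rw [h] at e2 <;> simp_all
      rw [this.1, this.2]; simp
    · rw [coeff_geom_mul_geom_eq_zero D E hx hy fun m n hm hn hrel => h ⟨m, n, hm, hn, hrel⟩,
        zero_mul]
  · simp only [not_or, not_not, not_le] at hc
    obtain ⟨m, n, hm, hn, em, en, s1, s2, r1, r2, huniq⟩ :=
      exists_relation_of_opposite hc.1 hc.2.1 hc.2.2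
    have hx : x ≠ 0 := by rintro rfl; simp at hc
    have hy : y ≠ 0 := by rintro rfl; simp at hc
    have hrel : m • x + n • y = 0 := by ext; exacts [by simpa using r1, by simpa using r2]
    have hnil := isNilpotent_of_relation_pair D E hm hn hx hrel
    have hκ := coeff_geom_mul_geom D E hx hy hm hn hrel fun m' n' h => huniq m' n'
      (by simpa using congrArg Prod.snd h)
    rw [em, en, oneSubPow_eq hnil, dlog_zpow, dlog_one_sub_mul_pow δ hm hn hnil hκ]
    have e1 : ((y.2.sign * x.2.gcd y.2 : ℤ) : A) * m = y.2 := by exact_mod_cast congrArg _ s1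
    have e2 : ((y.2.sign * x.2.gcd y.2 : ℤ) : A) * n = - x.2 := by
      have := congrArg (Int.cast : ℤ → A) s2
      push_cast at this ⊢
      exact this
    rw [Int.cast_neg]
    linear_combination (D.geom x * E.geom y).coeff 0 *
      (δ (D.a x) * E.a y * e1 + D.a x * δ (E.a y) * e2)

lemma dlog_termQ (x y : ℤ × ℤ) :
    dlog δ (termQ D E (x, y)) = (D.geom x * E.geom y).coeff 0 *
      (x.1 * D.a x * δ (E.a y) - y.1 * δ (D.a x) * E.a y) := by
  simp only [termQ, symQ]
  split_ifs with hc
  · rw [dlog_one]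
    by_cases hx : x = 0
    · rw [hx, show D.a 0 = 0 from D.a_zero]; simp
    by_cases hy : y = 0
    · rw [hy, show E.a 0 = 0 from E.a_zero]; simp
    by_cases h : ∃ m n : ℕ, 0 < m ∧ 0 < n ∧ m • x + n • y = 0
    · obtain ⟨m, n, hm, hn, hrel⟩ := h
      obtain ⟨h1, h2⟩ := opposite_of_relation hm hn hx hrel
      have h3 : x.1 * y.1 = 0 := by
        rcases hc with hc | hc | hc
        · exact absurd h1 hc
        · omega
        · exact hc
      have e2 : (m : ℤ) * x.1 + n * y.1 = 0 := by simpa using congrArg Prod.fst hrel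
      have hm' : (m : ℤ) ≠ 0 := by exact_mod_cast hm.ne'
      have hn' : (n : ℤ) ≠ 0 := by exact_mod_cast hn.ne'
      have : x.1 = 0 ∧ y.1 = 0 := by
        rcases mul_eq_zero.1 h3 with h | h <;> rw [h] at e2 <;> simp_all
      rw [this.1, this.2]; simp
    · rw [coeff_geom_mul_geom_eq_zero D E hx hy fun m n hm hn hrel => h ⟨m, n, hm, hn, hrel⟩,
        zero_mul]
  · simp only [not_or, not_not, not_le] at hc
    obtain ⟨m, n, hm, hn, em, en, s1, s2, r1, r2, huniq⟩ :=
      exists_relation_of_opposite (i := x.2) (k := y.2) (j := x.1) (l := y.1)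
        (by have := hc.1; unfold det at this; linarith) (by linarith [hc.2.1]) hc.2.2
    have hx : x ≠ 0 := by rintro rfl; simp at hc
    have hy : y ≠ 0 := by rintro rfl; simp at hc
    have hrel : m • x + n • y = 0 := by ext; exacts [by simpa using r2, by simpa using r1]
    have hnil := isNilpotent_of_relation_pair D E hm hn hx hrel
    have hκ := coeff_geom_mul_geom D E hx hy hm hn hrel fun m' n' h => huniq m' n'
      (by simpa using congrArg Prod.fst h)
    rw [em, en, oneSubPow_eq hnil, dlog_zpow, dlog_one_sub_mul_pow δ hm hn hnil hκ]
    have e1 : ((y.1.sign * x.1.gcd y.1 : ℤ) : A) * m = y.1 := by exact_mod_cast congrArg _ s1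
    have e2 : ((y.1.sign * x.1.gcd y.1 : ℤ) : A) * n = - x.1 := by
      have := congrArg (Int.cast : ℤ → A) s2
      push_cast at this ⊢
      exact this
    linear_combination - (D.geom x * E.geom y).coeff 0 *
      (δ (D.a x) * E.a y * e1 + D.a x * δ (E.a y) * e2)

/-- The contribution of a pair of factors. -/
lemma coeff_geom_mul_det3 (x y : ℤ × ℤ) (r : Fin 3 → A) :
    (D.geom x * E.geom y).coeff 0 * det3 (dvec δ x (D.a x)) (dvec δ y (E.a y)) r =
      r 2 * dlog δ (termS D E (x, y)) + r 1 * dlog δ (termQ D E (x, y)) := by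
  -- The component `r 0` must drop out: a nonzero constant term requires opposite vectors, whose
  -- determinant is zero. The factor `D.a x` covers the index `x = 0`.
  have hdet : (D.geom x * E.geom y).coeff 0 * ((det x y : ℤ) : A) * D.a x = 0 := by
    by_cases hx : x = 0
    · rw [hx, show D.a 0 = 0 from D.a_zero, mul_zero]
    by_cases hy : y = 0
    · rw [hy]; simp [det]
    by_cases h : ∃ m n : ℕ, 0 < m ∧ 0 < n ∧ m • x + n • y = 0
    · obtain ⟨m, n, hm, hn, hrel⟩ := h
      rw [(opposite_of_relation hm hn hx hrel).1]; simp
    · rw [coeff_geom_mul_geom_eq_zero D E hx hy fun m n hm hn hrel => h ⟨m, n, hm, hn, hrel⟩,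
        zero_mul, zero_mul]
  rw [dlog_termS, dlog_termQ]
  simp only [det] at hdet
  push_cast at hdet
  simp only [det3, dvec_zero', dvec_one', dvec_two']
  linear_combination (r 0 * E.a y) * hdet

end Factorization

end Residues

/-! ### The residue formula for the logarithmic derivative of the symbol -/

section Variation

variable {A : Type*} [CommRing A] (δ : Derivation ℤ A A)

lemma coeff_zero_mul_C (f : HahnSeries LexZ A) (r : A) : (f * C r).coeff 0 = f.coeff 0 * r := by
  rw [C_apply, coeff_mul_single_zero]

lemma det3_mul_C (p q r : HahnSeries LexZ A) (a b c : Fin 3 → A) :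
    (det3 (fun i => p * C (a i)) (fun i => q * C (b i)) (fun i => r * C (c i))).coeff 0 =
      (p * q * r).coeff 0 * det3 a b c := by
  rw [det3_smul, map_det3, coeff_zero_mul_C]

namespace Factorization

variable (D E F : Factorization A)

/-- The logarithmic derivative of the factor with index `x`. -/
def logFactor (x : ℤ × ℤ) : Fin 3 → HahnSeries LexZ A :=
  fun i => D.geom x * C (- dvec δ x (D.a x) i)

lemma coeff_det3_logFactor (x : ℤ × ℤ) (q r : Fin 3 → A) :
    (det3 (D.logFactor δ x) (fun i => C (q i)) (fun i => C (r i))).coeff 0 = 0 := by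
  have h := det3_mul_C (D.geom x) 1 1 (fun i => - dvec δ x (D.a x) i) q r
  simp only [one_mul, mul_one] at h
  unfold logFactor
  rw [h]
  by_cases hx : x = 0
  · rw [hx, show D.a 0 = 0 from D.a_zero]; simp [det3]
  · rw [D.coeff_geom_zero hx, zero_mul]

lemma coeff_det3_logFactor₂ (x y : ℤ × ℤ) (r : Fin 3 → A) :
    (det3 (D.logFactor δ x) (E.logFactor δ y) (fun i => C (r i))).coeff 0 =
      r 2 * dlog δ (termS D E (x, y)) + r 1 * dlog δ (termQ D E (x, y)) := by
  have h := det3_mul_C (D.geom x) (E.geom y) 1 (fun i => - dvec δ x (D.a x) i)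
    (fun i => - dvec δ y (E.a y) i) r
  simp only [one_mul, mul_one] at h
  unfold logFactor
  rw [h, ← coeff_geom_mul_det3]
  simp only [det3]
  ring

lemma coeff_det3_logFactor₃ (x y z : ℤ × ℤ) :
    (det3 (D.logFactor δ x) (E.logFactor δ y) (F.logFactor δ z)).coeff 0 =
      dlog δ (termT D E F (x, y, z)) := by
  unfold logFactor
  rw [det3_mul_C, dlog_termT]
  simp only [det3]
  ring

end Factorization

lemma eventually_subset_product {α : Type*} {W : Set (α × α)} (hW : W.Finite) :
    ∀ᶠ G : Finset α in atTop, W ⊆ ((G ×ˢ G : Finset (α × α)) : Set (α × α)) := by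
  classical
  filter_upwards [eventually_ge_atTop (hW.toFinset.image Prod.fst ∪ hW.toFinset.image Prod.snd)]
    with G hG w hw
  rw [Finset.coe_product]
  refine ⟨hG (Finset.mem_union_left _ (Finset.mem_image_of_mem _ (by simpa using hw))),
    hG (Finset.mem_union_right _ (Finset.mem_image_of_mem _ (by simpa using hw)))⟩

lemma eventually_subset_product₃ {α : Type*} {W : Set (α × α × α)} (hW : W.Finite) :
    ∀ᶠ G : Finset α in atTop, W ⊆ ((G ×ˢ G ×ˢ G : Finset (α × α × α)) : Set (α × α × α)) := by
  filter_upwards [eventually_subset_product (hW.image fun w => (w.1, w.2.1)),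
    eventually_subset_product (hW.image fun w => (w.1, w.2.2))] with G h1 h2 w hw
  have h1 := h1 ⟨w, hw, rfl⟩
  have h2 := h2 ⟨w, hw, rfl⟩
  simp only [Finset.coe_product, Set.mem_prod] at h1 h2 ⊢
  exact ⟨h1.1, h1.2, h2.2⟩

/-- A large `G` contains all indices with nontrivial factors, so the infinite product can be
compared with the partial products of the decompositions. -/
lemma eventually_dlog_finprod_lpow {α : Type*} {t : α × α → Aˣ} (ht : t.mulSupport.Finite)
    {ν : LocInt A} {v : ℤ} (hν : ∀ p, ν p = v) :
    ∀ᶠ G : Finset α in atTop, dlog δ (∏ᶠ w, lpow (RingHom.id A) (t w) ν) =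
      ∑ x ∈ G, ∑ y ∈ G, v * dlog δ (t (x, y)) := by
  filter_upwards [eventually_subset_product ht] with G hG
  rw [finprod_eq_prod_of_mulSupport_subset (s := G ×ˢ G), dlog_prod, Finset.sum_product]
  · simp only [lpow_of_const hν, dlog_zpow]
  · intro w hw
    refine hG fun h => hw ?_
    simp only [h, lpow_one]

lemma eventually_dlog_finprod {α : Type*} {t : α × α × α → Aˣ} (ht : t.mulSupport.Finite) :
    ∀ᶠ G : Finset α in atTop, dlog δ (∏ᶠ w, t w) =
      ∑ x ∈ G, ∑ y ∈ G, ∑ z ∈ G, dlog δ (t (x, y, z)) := by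
  filter_upwards [eventually_subset_product₃ ht] with G hG
  rw [finprod_eq_prod_of_mulSupport_subset (s := G ×ˢ G ×ˢ G) _ hG, dlog_prod, Finset.sum_product]
  exact Finset.sum_congr rfl fun x _ => Finset.sum_product _ _ _

namespace Factorization

variable (D E F : Factorization A)

/-- Of the eight terms of the trilinear expansion, the three with a single sum have no constant
term. The three with two sums give `S` and `Q`, brought to one shape by cyclic symmetry; the one
with three sums gives `T`. -/
lemma coeff_det3_sum (G : Finset (ℤ × ℤ)) (p q r : Fin 3 → A) :
    (det3 ((fun i => C (p i)) + ∑ x ∈ G, D.logFactor δ x)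
      ((fun i => C (q i)) + ∑ x ∈ G, E.logFactor δ x)
      ((fun i => C (r i)) + ∑ x ∈ G, F.logFactor δ x)).coeff 0 =
      det3 p q r + ∑ x ∈ G, ∑ y ∈ G, ∑ z ∈ G, dlog δ (termT D E F (x, y, z)) +
      ∑ x ∈ G, ∑ y ∈ G, (r 2 * dlog δ (termS D E (x, y)) + r 1 * dlog δ (termQ D E (x, y))) +
      ∑ x ∈ G, ∑ y ∈ G, (q 2 * dlog δ (termS F D (x, y)) + q 1 * dlog δ (termQ F D (x, y))) +
      ∑ x ∈ G, ∑ y ∈ G, (p 2 * dlog δ (termS E F (x, y)) + p 1 * dlog δ (termQ E F (x, y))) := by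
  have h1 : ∀ (D : Factorization A) (q r : Fin 3 → A),
      (det3 (∑ x ∈ G, D.logFactor δ x) (fun i => C (q i)) (fun i => C (r i))).coeff 0 = 0 := by
    intro D q r
    rw [det3_sum_left, coeff_sum]
    exact Finset.sum_eq_zero fun x _ => D.coeff_det3_logFactor δ x q r
  have h2 : ∀ (D E : Factorization A) (r : Fin 3 → A),
      (det3 (∑ x ∈ G, D.logFactor δ x) (∑ x ∈ G, E.logFactor δ x) (fun i => C (r i))).coeff 0 =
      ∑ x ∈ G, ∑ y ∈ G, (r 2 * dlog δ (termS D E (x, y)) + r 1 * dlog δ (termQ D E (x, y))) := by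
    intro D E r
    rw [det3_sum_left, coeff_sum]
    refine Finset.sum_congr rfl fun x _ => ?_
    rw [det3_sum_mid, coeff_sum]
    exact Finset.sum_congr rfl fun y _ => coeff_det3_logFactor₂ δ D E x y r
  have h3 : (det3 (∑ x ∈ G, D.logFactor δ x) (∑ x ∈ G, E.logFactor δ x)
      (∑ x ∈ G, F.logFactor δ x)).coeff 0 =
      ∑ x ∈ G, ∑ y ∈ G, ∑ z ∈ G, dlog δ (termT D E F (x, y, z)) := by
    rw [det3_sum_left, coeff_sum]
    refine Finset.sum_congr rfl fun x _ => ?_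
    rw [det3_sum_mid, coeff_sum]
    refine Finset.sum_congr rfl fun y _ => ?_
    rw [det3_sum_right, coeff_sum]
    exact Finset.sum_congr rfl fun z _ => coeff_det3_logFactor₃ δ D E F x y z
  have h0 : (det3 (fun i => C (p i)) (fun i => C (q i)) (fun i => C (r i)) :
      HahnSeries LexZ A).coeff 0 = det3 p q r := by
    rw [map_det3, C_apply, coeff_single_same]
  rw [← h2 D E, ← h2 F D, ← h2 E F, ← h3, ← h0]
  simp only [det3_add_left, det3_add_mid, det3_add_right, coeff_add]
  rw [h1 D, det3_cycle _ (∑ x ∈ G, E.logFactor δ x) (fun i => C (r i)), h1 E,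
    ← det3_cycle (∑ x ∈ G, F.logFactor δ x), h1 F,
    det3_cycle _ (∑ x ∈ G, E.logFactor δ x) (∑ x ∈ G, F.logFactor δ x),
    det3_cycle (∑ x ∈ G, F.logFactor δ x) (∑ x ∈ G, D.logFactor δ x)]
  ring

end Factorization

/-- The exponents of `t` and `u` are constant. -/
structure Factorization.HasOrder (D : Factorization A) (v : ℤ × ℤ) : Prop where
  fst : ∀ p, D.ν₁ p = v.1
  snd : ∀ p, D.ν₂ p = v.2

/-- The exponent of the sign of the tame symbol. -/
def tameExp (u v w : ℤ × ℤ) : ℤ :=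
  det u v * det u w + det v w * det v u + det w u * det w v + det u v * det u w * det v w

/-- The tame symbol of the monomials `a X ^ u`, `b X ^ v`, `c X ^ w`. -/
def tame (u v w : ℤ × ℤ) (a b c : Aˣ) : Aˣ :=
  (-1) ^ tameExp u v w * a ^ det v w * b ^ det w u * c ^ det u v

lemma nu_apply {D E : Factorization A} {u v : ℤ × ℤ} (hD : D.HasOrder u) (hE : E.HasOrder v)
    (p : PrimeSpectrum A) : nu D E p = det u v := by
  change D.ν₂ p * E.ν₁ p - E.ν₂ p * D.ν₁ p = _
  rw [hD.1, hD.2, hE.1, hE.2]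
  rfl

lemma signExp_apply {D E F : Factorization A} {u v w : ℤ × ℤ} (hD : D.HasOrder u)
    (hE : E.HasOrder v) (hF : F.HasOrder w) (p : PrimeSpectrum A) :
    signExp D E F p = tameExp u v w := by
  change nu D E p * nu D F p + nu E F p * nu E D p + nu F D p * nu F E p +
    nu D E p * nu D F p * nu E F p = _
  rw [nu_apply hD hE, nu_apply hD hF, nu_apply hE hF, nu_apply hE hD, nu_apply hF hD,
    nu_apply hF hE]
  rfl

lemma formula_eq_tame {D E F : Factorization A} {u v w : ℤ × ℤ} (hD : D.HasOrder u)
    (hE : E.HasOrder v) (hF : F.HasOrder w) : formula D E F = tame u v w D.c E.c F.c *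
      (∏ᶠ w, termT D E F w) *
      (∏ᶠ w, lpow (RingHom.id A) (termS D E w) F.ν₁) *
      (∏ᶠ w, lpow (RingHom.id A) (termQ D E w) F.ν₂) *
      (∏ᶠ w, lpow (RingHom.id A) (termS F D w) E.ν₁) *
      (∏ᶠ w, lpow (RingHom.id A) (termQ F D w) E.ν₂) *
      (∏ᶠ w, lpow (RingHom.id A) (termS E F w) D.ν₁) *
      (∏ᶠ w, lpow (RingHom.id A) (termQ E F w) D.ν₂) := by
  rw [formula, lpow_of_const (signExp_apply hD hE hF), lpow_of_const (nu_apply hE hF),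
    lpow_of_const (nu_apply hF hD), lpow_of_const (nu_apply hD hE), tame]

/-- The logarithmic derivative of the symbol is the residue of the determinant of the logarithmic
derivatives of its arguments. -/
lemma dlog_formula (hA : IsNilpotent (nilradical A)) {D E F : Factorization A}
    {f g h : (HahnSeries LexZ A)ˣ} (hf : D.Decomposes f.val) (hg : E.Decomposes g.val)
    (hh : F.Decomposes h.val) {u v w : ℤ × ℤ} (hD : D.HasOrder u) (hE : E.HasOrder v)
    (hF : F.HasOrder w) :
    dlog δ (formula D E F) = (det3 (logVec δ f) (logVec δ g) (logVec δ h)).coeff 0 := by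
  have hlim := (TendstoCoeff.det3 (D.tendsto_logVec δ hA hf) (E.tendsto_logVec δ hA hg)
    (F.tendsto_logVec δ hA hh)).ev 0
  -- One finite set serves for everything: the constant term of the determinant has stabilized and
  -- all seven products are exhausted.
  obtain ⟨G, hG, hT, hS1, hQ1, hS2, hQ2, hS3, hQ3⟩ := (hlim.and
    ((eventually_dlog_finprod δ (finite_mulSupport_termT hA D E F)).and
    ((eventually_dlog_finprod_lpow δ (finite_mulSupport_termS hA D E) hF.1).and
    ((eventually_dlog_finprod_lpow δ (finite_mulSupport_termQ hA D E) hF.2).and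
    ((eventually_dlog_finprod_lpow δ (finite_mulSupport_termS hA F D) hE.1).and
    ((eventually_dlog_finprod_lpow δ (finite_mulSupport_termQ hA F D) hE.2).and
    ((eventually_dlog_finprod_lpow δ (finite_mulSupport_termS hA E F) hD.1).and
    (eventually_dlog_finprod_lpow δ (finite_mulSupport_termQ hA E F) hD.2)))))))).exists
  rw [← hG, D.logVec_partialUnit δ hD.1 hD.2, E.logVec_partialUnit δ hE.1 hE.2,
    F.logVec_partialUnit δ hF.1 hF.2]
  refine Eq.trans ?_ (Factorization.coeff_det3_sum δ D E F G _ _ _).symm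
  -- The tame factor accounts for the determinant of the constant vectors; its sign has zero
  -- logarithmic derivative.
  simp only [formula_eq_tame hD hE hF, tame, dlog_mul, hT, hS1, hQ1, hS2, hQ2, hS3, hQ3,
    dlog_zpow, dlog_neg_one, mul_zero, zero_add, det]
  simp only [Finset.sum_add_distrib, Factorization.constVec, det3, Matrix.cons_val]
  push_cast
  ring

lemma symT_eq_one {x y z : ℤ × ℤ} {a b c : A} (h : a = 0 ∨ b = 0 ∨ c = 0) :
    symT x y z a b c = 1 := by
  by_contra h1
  obtain ⟨P, Q, S, hP, hQ, hS, -, hne⟩ := symT_ne_one h1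
  rcases h with rfl | rfl | rfl <;> simp [hP.ne', hQ.ne', hS.ne'] at hne

lemma symS_eq_one {x y : ℤ × ℤ} {a b : A} (h : a = 0 ∨ b = 0) : symS x y a b = 1 := by
  by_contra h1
  obtain ⟨m, n, hm, hn, -, hne⟩ := symS_ne_one h1
  rcases h with rfl | rfl <;> simp [hm.ne', hn.ne'] at hne

lemma symQ_eq_one {x y : ℤ × ℤ} {a b : A} (h : a = 0 ∨ b = 0) : symQ x y a b = 1 := by
  by_contra h1
  obtain ⟨m, n, hm, hn, -, hne⟩ := symQ_ne_one h1
  rcases h with rfl | rfl <;> simp [hm.ne', hn.ne'] at hne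

lemma formula_eq_tame_of_terms {D E F : Factorization A} {u v w : ℤ × ℤ} (hD : D.HasOrder u)
    (hE : E.HasOrder v) (hF : F.HasOrder w) (hDE : ∀ x y, D.a x = 0 ∨ E.a y = 0)
    (hFD : ∀ x y, F.a x = 0 ∨ D.a y = 0) (hEF : ∀ x y, E.a x = 0 ∨ F.a y = 0) :
    formula D E F = tame u v w D.c E.c F.c := by
  have hT : ∀ w, termT D E F w = 1 := fun w => symT_eq_one (by
    rcases hDE w.1 w.2.1 with h | h
    · exact Or.inl h
    · exact Or.inr (Or.inl h))
  have h1 : ∀ w, termS D E w = 1 := fun w => symS_eq_one (hDE _ _)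
  have h2 : ∀ w, termQ D E w = 1 := fun w => symQ_eq_one (hDE _ _)
  have h3 : ∀ w, termS F D w = 1 := fun w => symS_eq_one (hFD _ _)
  have h4 : ∀ w, termQ F D w = 1 := fun w => symQ_eq_one (hFD _ _)
  have h5 : ∀ w, termS E F w = 1 := fun w => symS_eq_one (hEF _ _)
  have h6 : ∀ w, termQ E F w = 1 := fun w => symQ_eq_one (hEF _ _)
  rw [formula_eq_tame hD hE hF]
  simp [hT, h1, h2, h3, h4, h5, h6, lpow_one]

end Variation

/-! ### Lifting to torsion-free rings -/

section Lift

/-- A surjection from a torsion-free ring whose nilradical is nilpotent and prime, along which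
units and nilpotent elements lift. -/
structure IsLift {V R : Type*} [CommRing V] [CommRing R] (π : V →+* R) : Prop where
  torsionFree : IsAddTorsionFree V
  nilp : IsNilpotent (nilradical V)
  prime : (nilradical V).IsPrime
  surj : Function.Surjective π
  isUnit : ∀ x, IsUnit (π x) → IsUnit x
  nilpLift : ∀ r, IsNilpotent r → ∃ x, IsNilpotent x ∧ π x = r

variable (σ Λ : Type*) [CommRing Λ]

/-- The polynomials all of whose monomials have degree at least `k`. -/
def degIdeal (k : ℕ) : Ideal (MvPolynomial σ Λ) where
  carrier := {p | ∀ m, m.degree < k → p.coeff m = 0}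
  add_mem' hp hq m hm := by rw [MvPolynomial.coeff_add, hp m hm, hq m hm, add_zero]
  zero_mem' m _ := MvPolynomial.coeff_zero m
  smul_mem' c p hp m hm := by
    classical
    rw [smul_eq_mul, MvPolynomial.coeff_mul]
    refine Finset.sum_eq_zero fun ij hij => ?_
    rw [Finset.HasAntidiagonal.mem_antidiagonal] at hij
    have : ij.2.degree < k := by
      rw [← hij, map_add] at hm
      omega
    rw [hp _ this, mul_zero]

variable {σ Λ}

lemma mem_degIdeal {k : ℕ} {p : MvPolynomial σ Λ} :
    p ∈ degIdeal σ Λ k ↔ ∀ m, m.degree < k → p.coeff m = 0 := Iff.rfl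

lemma degIdeal_mul_le (i j : ℕ) : degIdeal σ Λ i * degIdeal σ Λ j ≤ degIdeal σ Λ (i + j) := by
  classical
  rw [Ideal.mul_le]
  intro p hp q hq m hm
  rw [MvPolynomial.coeff_mul]
  refine Finset.sum_eq_zero fun ij hij => ?_
  rw [Finset.HasAntidiagonal.mem_antidiagonal] at hij
  rw [← hij, map_add] at hm
  by_cases h : ij.1.degree < i
  · rw [hp _ h, zero_mul]
  · rw [hq ij.2 (by omega), mul_zero]

lemma degIdeal_one_pow_le (k : ℕ) : degIdeal σ Λ 1 ^ k ≤ degIdeal σ Λ k := by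
  induction k with
  | zero => exact fun p _ m hm => absurd hm (Nat.not_lt_zero _)
  | succ k ih =>
    rw [pow_succ]
    exact (Ideal.mul_mono_left ih).trans (degIdeal_mul_le k 1)

lemma mem_degIdeal_one {p : MvPolynomial σ Λ} :
    p ∈ degIdeal σ Λ 1 ↔ MvPolynomial.constantCoeff p = 0 := by
  rw [mem_degIdeal, MvPolynomial.constantCoeff_eq]
  constructor
  · exact fun h => h 0 (by simp)
  · intro h m hm
    rw [Nat.lt_one_iff, Finsupp.degree_eq_zero_iff] at hm
    rw [hm, h]

lemma prod_pow_mem {R ι : Type*} [CommRing R] {I : Ideal R} (s : Finset ι) (a : ι → R) (m : ι → ℕ)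
    (ha : ∀ i, a i ∈ I) : ∏ i ∈ s, a i ^ m i ∈ I ^ ∑ i ∈ s, m i := by
  classical
  induction s using Finset.induction_on with
  | empty => simp
  | insert i s hi ih =>
    rw [Finset.prod_insert hi, Finset.sum_insert hi, _root_.pow_add]
    exact Ideal.mul_mem_mul (Ideal.pow_mem_pow (ha i) _) ih

lemma eval₂Hom_eq_zero {R : Type*} [CommRing R] {I : Ideal R} {k : ℕ} (hI : I ^ k = 0)
    (φ : Λ →+* R) {a : σ → R} (ha : ∀ i, a i ∈ I) {p : MvPolynomial σ Λ}
    (hp : p ∈ degIdeal σ Λ k) : MvPolynomial.eval₂Hom φ a p = 0 := by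
  rw [MvPolynomial.coe_eval₂Hom, MvPolynomial.eval₂_eq]
  refine Finset.sum_eq_zero fun m hm => ?_
  have hk : k ≤ m.degree := by
    by_contra h
    exact (MvPolynomial.mem_support_iff.1 hm) (hp m (not_le.1 h))
  have h1 := prod_pow_mem m.support a m ha
  have h2 := Ideal.pow_le_pow_right hk h1
  rw [hI] at h2
  rw [show ∏ i ∈ m.support, a i ^ m i = 0 from h2, mul_zero]

variable {R : Type*} [CommRing R]

/-- A lift of units to a domain of characteristic zero gives a lift of units and nilpotents. -/
lemma isLift_truncated [IsDomain Λ] [CharZero Λ] (φ : Λ →+* R) (hφ : Function.Surjective φ)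
    (hunit : ∀ x, IsUnit (φ x) → IsUnit x) {k : ℕ} (hk : nilradical R ^ (k + 1) = 0) :
    ∃ π : MvPolynomial (nilradical R) Λ ⧸ degIdeal (nilradical R) Λ (k + 1) →+* R, IsLift π := by
  -- One variable for each nilpotent element of `R`, truncated in degree `k + 1`. Products of `k +
  -- 1` nilpotents vanish in `R`, so evaluation descends to the quotient.
  set J := degIdeal (nilradical R) Λ (k + 1) with hJ
  set θ := MvPolynomial.eval₂Hom φ (fun n : nilradical R => (n : R)) with hθ
  set π : MvPolynomial (nilradical R) Λ ⧸ J →+* R :=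
    Ideal.Quotient.lift J θ fun p hp => eval₂Hom_eq_zero hk φ (fun n => n.2) hp with hπ
  -- The constant term. Its kernel is nilpotent by truncation and its target is a domain, so the
  -- kernel is the nilradical and is prime.
  set ε : MvPolynomial (nilradical R) Λ ⧸ J →+* Λ :=
    Ideal.Quotient.lift J MvPolynomial.constantCoeff fun p hp => by
      rw [MvPolynomial.constantCoeff_eq]
      exact hp 0 (by simp) with hε
  have hker : RingHom.ker ε ≤ (degIdeal (nilradical R) Λ 1).map (Ideal.Quotient.mk J) := by
    intro x hx
    obtain ⟨p, rfl⟩ := Ideal.Quotient.mk_surjective x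
    exact Ideal.mem_map_of_mem _ (mem_degIdeal_one.2 hx)
  have hkerpow : RingHom.ker ε ^ (k + 1) = ⊥ := by
    refine le_bot_iff.1 ((Ideal.pow_right_mono hker _).trans ?_)
    rw [← Ideal.map_pow]
    refine (Ideal.map_mono (degIdeal_one_pow_le (k + 1))).trans ?_
    rw [Ideal.map_quotient_self]
  have hnil : nilradical (MvPolynomial (nilradical R) Λ ⧸ J) = RingHom.ker ε := by
    refine le_antisymm (fun x hx => ?_) fun x hx => ?_
    · exact (IsNilpotent.map (mem_nilradical.1 hx) ε).eq_zero
    · refine mem_nilradical.2 ⟨k + 1, ?_⟩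
      have := Ideal.pow_mem_pow hx (k + 1)
      rwa [hkerpow] at this
  refine ⟨π, ⟨?_, ?_, ?_, ?_, ?_, ?_⟩⟩
  · refine ⟨fun n hn x y hxy => ?_⟩
    obtain ⟨p, rfl⟩ := Ideal.Quotient.mk_surjective x
    obtain ⟨q, rfl⟩ := Ideal.Quotient.mk_surjective y
    rw [Ideal.Quotient.eq]
    have h1 : n • p - n • q ∈ J := by
      rw [← Ideal.Quotient.eq, map_nsmul, map_nsmul]
      exact hxy
    intro m hm
    have h2 := h1 m hm
    rw [← smul_sub, MvPolynomial.coeff_smul, nsmul_eq_mul, mul_eq_zero] at h2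
    exact h2.resolve_left (Nat.cast_ne_zero.2 hn)
  · exact ⟨k + 1, by rw [hnil, hkerpow]; rfl⟩
  · rw [hnil]; exact RingHom.ker_isPrime ε
  · intro r
    obtain ⟨l, rfl⟩ := hφ r
    exact ⟨Ideal.Quotient.mk J (MvPolynomial.C l), by simp [hπ, hθ]⟩
  · intro x hx
    -- A polynomial differs from its constant term by terms containing a variable, and variables are
    -- sent to nilpotents. Units can thus be tested on constant terms, where the hypothesis on `φ`
    -- applies.
    have hdiff : φ (ε x) - π x ∈ nilradical R := by
      obtain ⟨p, rfl⟩ := Ideal.Quotient.mk_surjective x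
      have h1 : p - MvPolynomial.C (MvPolynomial.constantCoeff p) ∈
          degIdeal (nilradical R) Λ 1 := by
        rw [mem_degIdeal_one]; simp
      have h2 : Ideal.Quotient.mk (nilradical R)
          (θ (p - MvPolynomial.C (MvPolynomial.constantCoeff p))) = 0 := by
        have h3 := eval₂Hom_eq_zero (I := (⊥ : Ideal (R ⧸ nilradical R))) (k := 1) (by simp)
          ((Ideal.Quotient.mk (nilradical R)).comp φ)
          (a := fun n : nilradical R => Ideal.Quotient.mk (nilradical R) (n : R))
          (fun n => by simp [Ideal.Quotient.eq_zero_iff_mem]) h1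
        rw [← h3, hθ]
        simp [MvPolynomial.eval₂_comp_left]
        rfl
      rw [Ideal.Quotient.eq_zero_iff_mem] at h2
      rw [← neg_mem_iff, neg_sub]
      have h4 : π (Ideal.Quotient.mk J p) - φ (ε (Ideal.Quotient.mk J p)) =
          θ (p - MvPolynomial.C (MvPolynomial.constantCoeff p)) := by
        rw [map_sub]
        simp [hπ, hε, hθ]
      rw [h4]
      exact h2
    have h1 : IsUnit (φ (ε x)) := by
      have := (mem_nilradical.1 hdiff).isUnit_add_left_of_commute hx (Commute.all _ _)
      rwa [add_sub_cancel] at this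
    obtain ⟨y, hy⟩ := (hunit _ h1).exists_right_inv
    have hs : ε (Ideal.Quotient.mk J (MvPolynomial.C y)) = y := by simp [hε]
    have h2 : x * Ideal.Quotient.mk J (MvPolynomial.C y) - 1 ∈ RingHom.ker ε := by
      rw [RingHom.mem_ker, map_sub, map_mul, hs, hy, map_one, sub_self]
    rw [← hnil, mem_nilradical] at h2
    have h3 := h2.isUnit_one_add
    rw [add_sub_cancel] at h3
    exact isUnit_of_mul_isUnit_left h3
  · intro r hr
    refine ⟨Ideal.Quotient.mk J (MvPolynomial.X ⟨r, hr⟩), ?_, by simp [hπ, hθ]⟩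
    rw [← mem_nilradical, hnil, RingHom.mem_ker]
    simp [hε]

/-- Every nonzero ring with nilpotent nilradical has a lift. -/
lemma exists_isLift.{u} {R : Type u} [CommRing R] [Nontrivial R] (hR : IsNilpotent (nilradical R)) :
    ∃ (V : Type u) (_ : CommRing V) (π : V →+* R), IsLift π := by
  obtain ⟨k, hk⟩ := hR
  let ρ : MvPolynomial R ℤ →+* R := MvPolynomial.eval₂Hom (Int.castRingHom R) id
  -- Everything that becomes a unit in `R` is inverted. Since `R` is nonzero, `0` is not in `M`, and
  -- the localization is a domain of characteristic zero along which units lift.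
  let M : Submonoid (MvPolynomial R ℤ) := (IsUnit.submonoid R).comap ρ
  have hM : M ≤ nonZeroDivisors (MvPolynomial R ℤ) := by
    refine le_nonZeroDivisors_of_noZeroDivisors fun h0 => ?_
    have : IsUnit (ρ 0) := h0
    rw [map_zero] at this
    exact not_isUnit_zero this
  let φ : Localization M →+* R := IsLocalization.lift (M := M) (g := ρ) fun y => y.2
  have hφalg : ∀ p, φ (algebraMap _ _ p) = ρ p := fun p => IsLocalization.lift_eq _ p
  have : IsDomain (Localization M) := IsLocalization.isDomain_localization hM
  have : CharZero (Localization M) :=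
    charZero_of_injective_algebraMap (IsLocalization.injective (Localization M) hM)
  have hsurj : Function.Surjective φ := fun r =>
    ⟨algebraMap _ _ (MvPolynomial.X r), by rw [hφalg]; simp [ρ]⟩
  have hunit : ∀ x, IsUnit (φ x) → IsUnit x := by
    intro x hx
    obtain ⟨⟨p, m⟩, hpm⟩ := IsLocalization.surj M x
    have hm : IsUnit (algebraMap (MvPolynomial R ℤ) (Localization M) m) :=
      IsLocalization.map_units _ m
    have h1 : IsUnit (ρ p) := by
      rw [← hφalg, ← hpm, map_mul]
      exact hx.mul (hm.map φ)
    have h2 : IsUnit (algebraMap (MvPolynomial R ℤ) (Localization M) p) :=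
      IsLocalization.map_units (Localization M) (⟨p, h1⟩ : M)
    rw [← hpm] at h2
    exact isUnit_of_mul_isUnit_left h2
  obtain ⟨π, hπ⟩ := isLift_truncated φ hsurj hunit (k := k) (by rw [pow_succ, hk, zero_mul])
  exact ⟨_, inferInstance, π, hπ⟩

end Lift

/-! ### The tame symbol of monomials -/

section TameSymbol

variable {A : Type*} [CommRing A]

lemma neg_one_zpow_congr {m n : ℤ} (h : (m : ZMod 2) = n) : (-1 : Aˣ) ^ m = (-1) ^ n := by
  have h1 : Even (m - n) := by
    rw [even_iff_two_dvd]
    exact_mod_cast (ZMod.intCast_zmod_eq_zero_iff_dvd (m - n) 2).1 (by push_cast; rw [h, sub_self])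
  have h2 := h1.neg_one_zpow (α := Aˣ)
  rwa [zpow_sub, mul_inv_eq_one] at h2

set_option maxRecDepth 100000 in
-- Modulo `2` the exponent is `p * q + p * r + q * r + p * q * r` for the three determinants, with
-- `r = det v w`. By the Plücker relation its defect of additivity is `det u u' * r * (1 + r)`,
-- which is even. The proof checks all values in `ZMod 2`.
lemma tameExp_add (u u' v w : ℤ × ℤ) :
    ((tameExp (u + u') v w : ℤ) : ZMod 2) = ((tameExp u v w + tameExp u' v w : ℤ) : ZMod 2) := by
  have key : ∀ a b c d e f g h : ZMod 2,
      ((b + d) * e - f * (a + c)) * ((b + d) * g - h * (a + c)) +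
      (f * g - h * e) * (f * (a + c) - (b + d) * e) +
      (h * (a + c) - (b + d) * g) * (h * e - f * g) +
      ((b + d) * e - f * (a + c)) * ((b + d) * g - h * (a + c)) * (f * g - h * e) =
      ((b * e - f * a) * (b * g - h * a) + (f * g - h * e) * (f * a - b * e) +
        (h * a - b * g) * (h * e - f * g) + (b * e - f * a) * (b * g - h * a) * (f * g - h * e)) +
      ((d * e - f * c) * (d * g - h * c) + (f * g - h * e) * (f * c - d * e) +
        (h * c - d * g) * (h * e - f * g) +
        (d * e - f * c) * (d * g - h * c) * (f * g - h * e)) := by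
    decide
  simp only [tameExp, det, Prod.fst_add, Prod.snd_add]
  push_cast
  exact key _ _ _ _ _ _ _ _

lemma tame_mul (u u' v w : ℤ × ℤ) (a a' b c : Aˣ) :
    tame (u + u') v w (a * a') b c = tame u v w a b c * tame u' v w a' b c := by
  have h1 : det w (u + u') = det w u + det w u' := by
    simp only [det, Prod.fst_add, Prod.snd_add]; ring
  have h2 : det (u + u') v = det u v + det u' v := by
    simp only [det, Prod.fst_add, Prod.snd_add]; ring
  simp only [tame, neg_one_zpow_congr (tameExp_add u u' v w), h1, h2, zpow_add, mul_zpow]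
  simp only [mul_assoc, mul_comm, mul_left_comm]

lemma tame_zero_mid (u w : ℤ × ℤ) (a c : Aˣ) : tame u 0 w a 1 c = 1 := by
  simp [tame, tameExp, det]

lemma tame_zero_left (u w : ℤ × ℤ) (a c : Aˣ) : tame 0 u w 1 a c = 1 := by
  simp [tame, tameExp, det]

lemma tame_zero_zero (w : ℤ × ℤ) (a b c : Aˣ) : tame 0 0 w a b c = 1 := by
  simp [tame, tameExp, det]

/-- The sign exponent is the square of `det u w`, congruent to `det u w` modulo `2`, so it cancels
the sign coming from `-a`. -/
lemma tame_self_neg (u w : ℤ × ℤ) (a c : Aˣ) : tame u u w a (-a) c = 1 := by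
  have h1 : det w u = - det u w := by simp only [det]; ring
  have h2 : ((tameExp u u w : ℤ) : ZMod 2) = ((det u w : ℤ) : ZMod 2) := by
    have key : ∀ d : ZMod 2, d * d = d := by decide
    have : tameExp u u w = det u w * det u w := by simp only [tameExp, det]; ring
    rw [this]
    push_cast
    exact key _
  have h3 : det u u = 0 := by simp only [det]; ring
  rw [tame, neg_one_zpow_congr h2, h1, h3, zpow_zero, mul_one, zpow_neg, mul_inv_eq_one,
    ← mul_zpow, neg_one_mul]

lemma tame_neg_self (u w : ℤ × ℤ) (a c : Aˣ) : tame u u w (-a) a c = 1 := by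
  have := tame_self_neg u w (-a) c
  rwa [neg_neg] at this

end TameSymbol

/-! ### Constancy of orders and decompositions of binomials -/

section Order

variable {A B : Type*} [CommRing A] [CommRing B]

lemma LocInt.apply_eq_of_le (ν : LocInt A) {p q : PrimeSpectrum A} (h : p ≤ q) : ν p = ν q :=
  (((PrimeSpectrum.le_iff_specializes p q).1 h).map ν.continuous).eq

namespace Factorization

/-- The nilradical is a generic point, and a locally constant function takes the same value at all
its specializations. -/
lemma exists_hasOrder_of_prime (h : (nilradical A).IsPrime) (D : Factorization A) :
    ∃ v, D.HasOrder v :=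
  ⟨(D.ν₁ ⟨nilradical A, h⟩, D.ν₂ ⟨nilradical A, h⟩),
    fun p => (LocInt.apply_eq_of_le _ (p := ⟨nilradical A, h⟩)
      (nilradical_le_prime p.asIdeal)).symm,
    fun p => (LocInt.apply_eq_of_le _ (p := ⟨nilradical A, h⟩)
      (nilradical_le_prime p.asIdeal)).symm⟩

/-- Every point of the spectrum specializes to the closed point. -/
lemma exists_hasOrder_of_isLocalRing [IsLocalRing A] (D : Factorization A) :
    ∃ v, D.HasOrder v :=
  ⟨(D.ν₁ (IsLocalRing.closedPoint A), D.ν₂ (IsLocalRing.closedPoint A)),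
    fun p => LocInt.apply_eq_of_le _ (IsLocalRing.le_maximalIdeal p.isPrime.ne_top),
    fun p => LocInt.apply_eq_of_le _ (IsLocalRing.le_maximalIdeal p.isPrime.ne_top)⟩

lemma HasOrder.map {D : Factorization A} {v : ℤ × ℤ} (h : D.HasOrder v) (φ : A →+* B) :
    (D.map φ).HasOrder v := ⟨fun _ => h.1 _, fun _ => h.2 _⟩

lemma Decomposes.unique {D : Factorization A} {f g : HahnSeries LexZ A} (hf : D.Decomposes f)
    (hg : D.Decomposes g) : f = g := by
  obtain ⟨n, p, hn, hp, rfl⟩ := hf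
  obtain ⟨n', p', hn', hp', rfl⟩ := hg
  rw [hn.unique hn', hp.unique hp']

lemma exists_unit_decomposes (hA : IsNilpotent (nilradical A)) (D : Factorization A) :
    ∃ f : (HahnSeries LexZ A)ˣ, D.Decomposes f.val := by
  obtain ⟨n, hn⟩ := D.exists_tendsto_aNeg hA
  obtain ⟨p, hp⟩ := D.exists_tendsto_aPos
  have hu : IsUnit (C (D.c : A) * n * p * (monomial D.ν₁ D.ν₂).val) :=
    (((D.c.isUnit.map C).mul ((isNegOne_of_tendsto hn).isUnit hA)).mul
      (isPosOne_of_tendsto hp).isUnit).mul (Units.isUnit _)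
  exact ⟨hu.unit, n, p, hn, hp, rfl⟩

lemma HasOrder.monomial_eq {D : Factorization A} {v : ℤ × ℤ} (h : D.HasOrder v) :
    (monomial D.ν₁ D.ν₂).val = single (toLex v) 1 := by
  rw [monomial, lpow_of_const h.2, lpow_of_const h.1, ← xpow_zsmul, ← xpow_zsmul, ← xpow_add,
    coe_xpow]
  congr 2
  change v.2 • ((0, 1) : ℤ × ℤ) + v.1 • ((1, 0) : ℤ × ℤ) = v
  ext <;> simp

/-- The factorization of `c X ^ v (1 - b X ^ x)` for a positive index `x`. -/
def binomial (c : Aˣ) (v : ℤ × ℤ) {x : ℤ × ℤ} (hx : 0 < toLex x) (b : A) : Factorization A where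
  c := c
  ν₁ := LocallyConstant.const _ v.1
  ν₂ := LocallyConstant.const _ v.2
  a y := if y = x then b else 0
  a_zero := if_neg fun h => hx.ne (congrArg toLex h)
  nilp y hy := by
    rw [lexNeg_iff] at hy
    rw [if_neg]
    · exact IsNilpotent.zero
    · rintro rfl
      exact lt_asymm hx hy
  bdd_neg := ⟨0, 0, fun y hy hne => by
    rw [lexNeg_iff] at hy
    refine absurd (if_neg ?_) hne
    rintro rfl
    exact lt_asymm hx hy⟩
  bdd_pos i := ⟨x.2 - 1, fun j _ hne => by
    by_cases h : (i, j) = x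
    · rw [← h]; simp
    · exact absurd (if_neg h) hne⟩

variable {c : Aˣ} {v x : ℤ × ℤ} {hx : 0 < toLex x} {b : A}

lemma hasOrder_binomial : (binomial c v hx b).HasOrder v := ⟨fun _ => rfl, fun _ => rfl⟩

lemma decomposes_binomial :
    (binomial c v hx b).Decomposes
      (C c.val * (1 - single (toLex x) b) * single (toLex v) 1) := by
  have hN : (binomial c v hx b).aNeg = 0 := by
    funext y
    rw [aNeg]
    split_ifs with h
    · refine if_neg ?_
      rintro rfl
      exact lt_asymm hx h
    · rfl
  have hP : ∀ y, (binomial c v hx b).aPos y = if y = toLex x then b else 0 := by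
    intro y
    rw [aPos]
    by_cases h : y = toLex x
    · rw [if_pos h, h, if_pos hx]
      exact if_pos rfl
    · rw [if_neg h]
      split_ifs
      · exact if_neg fun h' => h (congrArg toLex h')
      · rfl
  refine ⟨1, 1 - single (toLex x) b, ?_, ?_, ?_⟩
  · have : eprod (binomial c v hx b).aNeg = fun _ => 1 := by
      funext F
      rw [hN]
      simp [eprod]
    rw [this]
    exact TendstoCoeff.const 1
  · obtain ⟨p, hp⟩ := (binomial c v hx b).exists_tendsto_aPos
    have : p = 1 - single (toLex x) b := by
      ext z
      obtain ⟨F, h1, h2⟩ := ((hp.ev z).and (eventually_ge_atTop {toLex x})).exists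
      rw [← h1]
      congr 1
      rw [eprod, Finset.prod_eq_single (toLex x)]
      · rw [hP, if_pos rfl]
      · intro y _ hy
        rw [hP, if_neg hy, single_eq_zero, sub_zero]
      · exact fun h => absurd (h2 (Finset.mem_singleton_self _)) h
    rwa [← this]
  · rw [hasOrder_binomial.monomial_eq, mul_one]
    rfl

/-- The factorization of `c X ^ v`. -/
def ofMonomial (c : Aˣ) (v : ℤ × ℤ) : Factorization A :=
  -- With coefficient `0` any positive index would do.
  binomial c v (x := (1, 0)) ((lexPos_iff _).1 (Or.inl one_pos)) 0

lemma a_ofMonomial (c : Aˣ) (v : ℤ × ℤ) : (ofMonomial c v).a = 0 := by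
  funext y
  exact ite_self 0

lemma hasOrder_ofMonomial (c : Aˣ) (v : ℤ × ℤ) : (ofMonomial c v).HasOrder v := hasOrder_binomial

lemma decomposes_ofMonomial (c : Aˣ) (v : ℤ × ℤ) :
    (ofMonomial c v).Decomposes (C c.val * single (toLex v) 1) := by
  have := decomposes_binomial (c := c) (v := v)
    (hx := (lexPos_iff (1, 0)).1 (Or.inl one_pos)) (b := 0)
  rwa [single_eq_zero, sub_zero, mul_one] at this

lemma eq_ofMonomial {D : Factorization A} (hD : D.HasOrder v) (ha : D.a = 0) :
    D = ofMonomial D.c v := by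
  ext1
  · rfl
  · ext p; exact hD.1 p
  · ext p; exact hD.2 p
  · rw [ha, a_ofMonomial]

lemma decomposes_of_a_eq_zero {D : Factorization A} (hD : D.HasOrder v) (ha : D.a = 0) :
    D.Decomposes (C D.c.val * single (toLex v) 1) := by
  have := decomposes_ofMonomial D.c v
  rwa [← eq_ofMonomial hD ha] at this

lemma coeff_of_lt_order {D : Factorization A} (hD : D.HasOrder v) {f : HahnSeries LexZ A}
    (hf : D.Decomposes f) {z : LexZ} (hz : z < toLex v) : f.coeff z ∈ nilradical A := by
  obtain ⟨n, p, hn, hp, rfl⟩ := hf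
  rw [hD.monomial_eq, ← sub_add_cancel z (toLex v), coeff_mul_single_add, mul_one]
  exact coeff_C_mul_mul_of_neg (isNegOne_of_tendsto hn) (isPosOne_of_tendsto hp) _ (sub_neg.2 hz)

lemma coeff_order_sub_mem {D : Factorization A} (hD : D.HasOrder v) {f : HahnSeries LexZ A}
    (hf : D.Decomposes f) : f.coeff (toLex v) - D.c ∈ nilradical A := by
  obtain ⟨n, p, hn, hp, rfl⟩ := hf
  have h : (C (D.c : A) * n * p * single (toLex v) 1).coeff (toLex v) =
      (C (D.c : A) * n * p).coeff 0 := by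
    have := coeff_mul_single_add (x := C (D.c : A) * n * p) (r := (1 : A)) (a := 0) (b := toLex v)
    rwa [zero_add, mul_one] at this
  rw [hD.monomial_eq, h]
  exact coeff_C_mul_mul_zero (isNegOne_of_tendsto hn) (isPosOne_of_tendsto hp) _

end Factorization

end Order

/-! ### Deformation to monomials over `V[X]` -/

section Deformation

variable {V R : Type*} [CommRing V] [CommRing R]

lemma nilradical_polynomial :
    nilradical (Polynomial V) = (nilradical V).map (Polynomial.C : V →+* Polynomial V) := by
  ext p
  rw [mem_nilradical, Polynomial.isNilpotent_iff, Ideal.mem_map_C_iff]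
  rfl

lemma isNilpotent_nilradical_polynomial (hV : IsNilpotent (nilradical V)) :
    IsNilpotent (nilradical (Polynomial V)) := by
  obtain ⟨k, hk⟩ := hV
  refine ⟨k, ?_⟩
  rw [nilradical_polynomial, ← Ideal.map_pow, hk]
  exact Ideal.map_bot

lemma isPrime_nilradical_polynomial (hV : (nilradical V).IsPrime) :
    (nilradical (Polynomial V)).IsPrime := by
  rw [nilradical_polynomial]
  exact Ideal.isPrime_map_C_of_isPrime

/-- A derivation over the integers from an additive map satisfying the Leibniz rule. -/
def derivationOfAddMonoidHom {B : Type*} [CommRing B] (d : B →+ B)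
    (h : ∀ a b, d (a * b) = d a * b + a * d b) : Derivation ℤ B B :=
  Derivation.mk' d.toIntLinearMap fun a b => by
    change d (a * b) = a * d b + b * d a
    rw [h]; ring

/-- The derivative of polynomials. -/
def polyDerivation (V : Type*) [CommRing V] :=
  derivationOfAddMonoidHom (B := Polynomial V) Polynomial.derivative.toAddMonoidHom
    fun _ _ => Polynomial.derivative_mul

/-- Without torsion, a polynomial with zero derivative is constant. This is the point where
torsion-freeness of the lift enters. -/
lemma eval_eq_of_dlog_eq_zero (hV : IsAddTorsionFree V) {W : (Polynomial V)ˣ}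
    (h : dlog (polyDerivation V) W = 0) :
    Polynomial.eval 1 W.val = Polynomial.eval 0 W.val := by
  have h1 : Polynomial.derivative W.val = 0 := eq_zero_of_dlog_eq_zero _ h
  rw [Polynomial.eq_C_of_derivative_eq_zero h1]
  simp

/-- Evaluation at `0`. -/
abbrev evalZero (V : Type*) [CommRing V] : Polynomial V →+* V := Polynomial.evalRingHom 0

/-- Evaluation at `1`, followed by `π`. -/
abbrev evalOne (π : V →+* R) : Polynomial V →+* R := π.comp (Polynomial.evalRingHom 1)

/-- A unit with vanishing logarithmic derivative is determined by its value at `0`. -/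
lemma map_evalOne_eq_one (hV : IsAddTorsionFree V) (π : V →+* R) {W : (Polynomial V)ˣ}
    (h : dlog (polyDerivation V) W = 0)
    (h0 : Units.map (evalZero V : Polynomial V →* V) W = 1) :
    Units.map (evalOne π : Polynomial V →* R) W = 1 := by
  ext
  have h1 : Polynomial.eval 0 W.val = 1 := congrArg Units.val h0
  change π (Polynomial.eval 1 W.val) = 1
  rw [eval_eq_of_dlog_eq_zero hV h, h1, map_one]

namespace IsLift

variable {π : V →+* R}

lemma exists_section (hπ : IsLift π) : ∃ s : R → V, s 0 = 0 ∧
    (∀ r, IsNilpotent r → IsNilpotent (s r)) ∧ ∀ r, π (s r) = r := by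
  have h : ∀ r, ∃ x, (r = 0 → x = 0) ∧ (IsNilpotent r → IsNilpotent x) ∧ π x = r := by
    intro r
    by_cases h0 : r = 0
    · exact ⟨0, fun _ => rfl, fun _ => IsNilpotent.zero, by rw [h0, map_zero]⟩
    by_cases hr : IsNilpotent r
    · obtain ⟨x, hx, hxr⟩ := hπ.nilpLift r hr
      exact ⟨x, fun h => absurd h h0, fun _ => hx, hxr⟩
    · obtain ⟨x, hx⟩ := hπ.surj r
      exact ⟨x, fun h => absurd h h0, fun h => absurd h hr, hx⟩
  choose s h1 h2 h3 using h
  exact ⟨s, h1 0 rfl, h2, h3⟩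

/-- Every factorization of constant order deforms to a monomial over a lift. -/
lemma exists_deformation (hπ : IsLift π) {D : Factorization R} {v : ℤ × ℤ} (hD : D.HasOrder v) :
    ∃ D' : Factorization (Polynomial V), D'.HasOrder v ∧ (D'.map (evalZero V)).a = 0 ∧
      D'.map (evalOne π) = D ∧
      ∃ c : Vˣ, D'.c = Units.map (Polynomial.C : V →+* Polynomial V) c ∧ π c.val = D.c.val := by
  obtain ⟨s, hs0, hsn, hsr⟩ := hπ.exists_section
  obtain ⟨c, hc⟩ : ∃ c : Vˣ, π c.val = D.c.val := by
    have h : IsUnit (s D.c) := hπ.isUnit _ (by rw [hsr]; exact D.c.isUnit)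
    exact ⟨h.unit, hsr _⟩
  have hne : ∀ {x}, Polynomial.X * Polynomial.C (s (D.a x)) ≠ 0 → D.a x ≠ 0 := by
    intro x h h0
    rw [h0, hs0, map_zero, mul_zero] at h
    exact h rfl
  let D' : Factorization (Polynomial V) :=
    { c := Units.map (Polynomial.C : V →+* Polynomial V) c
      ν₁ := LocallyConstant.const _ v.1
      ν₂ := LocallyConstant.const _ v.2
      -- The factor `X` kills the coefficients at `X = 0` and disappears at `X = 1`. The section `s`
      -- preserves zero, which controls supports, and nilpotency, which negative indices require.
      a := fun x => Polynomial.X * Polynomial.C (s (D.a x))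
      a_zero := by rw [D.a_zero, hs0, map_zero, mul_zero]
      nilp := fun x hx => (Commute.all _ _).isNilpotent_mul_left
        ((hsn _ (D.nilp x hx)).map Polynomial.C)
      bdd_neg := by
        obtain ⟨n, m, h⟩ := D.bdd_neg
        exact ⟨n, m, fun x hx h' => h x hx (hne h')⟩
      bdd_pos := fun i => by
        obtain ⟨m, h⟩ := D.bdd_pos i
        exact ⟨m, fun j hj h' => h j hj (hne h')⟩ }
  refine ⟨D', ⟨fun _ => rfl, fun _ => rfl⟩, ?_, ?_, c, rfl, hc⟩
  · funext x
    change Polynomial.eval 0 (Polynomial.X * Polynomial.C (s (D.a x))) = 0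
    simp
  · ext1
    · ext
      change π (Polynomial.eval 1 (Polynomial.C c.val)) = D.c
      rw [Polynomial.eval_C, hc]
    · ext p; exact (hD.1 p).symm
    · ext p; exact (hD.2 p).symm
    · funext x
      change π (Polynomial.eval 1 (Polynomial.X * Polynomial.C (s (D.a x)))) = D.a x
      simp [hsr]

/-- Multiplicativity in the first argument over a ring that has a lift. -/
lemma formula_mul (hπ : IsLift π) (hR : IsNilpotent (nilradical R))
    {D₁ D₂ D E F : Factorization R}
    {f₁ f₂ : HahnSeries LexZ R} (h₁ : D₁.Decomposes f₁) (h₂ : D₂.Decomposes f₂)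
    (h₁₂ : D.Decomposes (f₁ * f₂)) {u₁ u₂ v w : ℤ × ℤ} (hD₁ : D₁.HasOrder u₁)
    (hD₂ : D₂.HasOrder u₂) (hE : E.HasOrder v) (hF : F.HasOrder w) :
    formula D E F = formula D₁ E F * formula D₂ E F := by
  have hP := isNilpotent_nilradical_polynomial hπ.nilp
  obtain ⟨D₁', hD₁', z₁, m₁, -⟩ := hπ.exists_deformation hD₁
  obtain ⟨D₂', hD₂', z₂, m₂, -⟩ := hπ.exists_deformation hD₂
  obtain ⟨E', hE', zE, mE, -⟩ := hπ.exists_deformation hE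
  obtain ⟨F', hF', zF, mF, -⟩ := hπ.exists_deformation hF
  obtain ⟨f₁', hf₁⟩ := D₁'.exists_unit_decomposes hP
  obtain ⟨f₂', hf₂⟩ := D₂'.exists_unit_decomposes hP
  obtain ⟨g', hg⟩ := E'.exists_unit_decomposes hP
  obtain ⟨h', hh⟩ := F'.exists_unit_decomposes hP
  obtain ⟨D', hf⟩ := Factorization.exists_decomposes hP (f₁' * f₂')
  obtain ⟨u, hD'⟩ := D'.exists_hasOrder_of_prime (isPrime_nilradical_polynomial hπ.prime)
  -- The coefficients of `D'` are not known explicitly; its two specializations are identified by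
  -- uniqueness of the decomposition.
  have m : D'.map (evalOne π) = D := by
    have e₁ := (hf₁.map (evalOne π)).unique (m₁ ▸ h₁)
    have e₂ := (hf₂.map (evalOne π)).unique (m₂ ▸ h₂)
    have e := hf.map (evalOne π)
    rw [Units.val_mul, map_mul, e₁, e₂] at e
    exact Factorization.decomposes_unique hR e h₁₂
  have z : D'.map (evalZero V) = Factorization.ofMonomial
      ((D₁'.map (evalZero V)).c * (D₂'.map (evalZero V)).c) (u₁ + u₂) := by
    have e₁ := (hf₁.map (evalZero V)).unique
      (Factorization.decomposes_of_a_eq_zero (hD₁'.map _) z₁)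
    have e₂ := (hf₂.map (evalZero V)).unique
      (Factorization.decomposes_of_a_eq_zero (hD₂'.map _) z₂)
    have e := hf.map (evalZero V)
    rw [Units.val_mul, map_mul, e₁, e₂] at e
    refine Factorization.decomposes_unique hπ.nilp e ?_
    convert Factorization.decomposes_ofMonomial _ _ using 1
    rw [Units.val_mul, map_mul, toLex_add]
    have : single (toLex u₁ + toLex u₂) (1 : V) = single (toLex u₁) 1 * single (toLex u₂) 1 := by
      rw [single_mul_single, mul_one]
    rw [this]
    ring
  -- The quotient of the two sides has zero logarithmic derivative, because the residue is additive
  -- in its first argument, and the value `1` at `X = 0` by multiplicativity of the tame symbol.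
  have hW := map_evalOne_eq_one hπ.torsionFree π
    (W := formula D' E' F' * (formula D₁' E' F' * formula D₂' E' F')⁻¹) (by
      rw [dlog_mul, dlog_inv, dlog_mul, dlog_formula _ hP hf hg hh hD' hE' hF',
        dlog_formula _ hP hf₁ hg hh hD₁' hE' hF', dlog_formula _ hP hf₂ hg hh hD₂' hE' hF',
        logVec_mul, det3_add_left, coeff_add, add_neg_cancel]) (by
      rw [_root_.map_mul, map_inv, _root_.map_mul, map_formula hP, map_formula hP, map_formula hP,
        z, formula_eq_tame_of_terms (Factorization.hasOrder_ofMonomial _ _) (hE'.map _) (hF'.map _),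
        formula_eq_tame_of_terms (hD₁'.map _) (hE'.map _) (hF'.map _),
        formula_eq_tame_of_terms (hD₂'.map _) (hE'.map _) (hF'.map _), mul_inv_eq_one]
      · exact tame_mul ..
      all_goals
        simp only [z₁, z₂, zE, zF, Factorization.a_ofMonomial, Pi.zero_apply, or_true,
          implies_true])
  rw [_root_.map_mul, map_inv, _root_.map_mul, map_formula hP, map_formula hP, map_formula hP, m,
    m₁, m₂, mE, mF, mul_inv_eq_one] at hW
  exact hW

end IsLift

end Deformation

/-! ### The Steinberg relation over rings with a lift and over local rings -/

section Steinberg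

variable {A : Type*} [CommRing A]

lemma det3_proportional (k : A) (p r : Fin 3 → A) : det3 p (fun i => k * p i) r = 0 := by
  simp only [det3]; ring

lemma det3_proportional_left (k : A) (p r : Fin 3 → A) : det3 (fun i => k * p i) p r = 0 := by
  simp only [det3]; ring

/-- This proportionality makes the determinant, and with it the logarithmic derivative of the
symbol, vanish. -/
lemma logVec_one_sub (δ : Derivation ℤ A A) {f f' : (HahnSeries LexZ A)ˣ}
    (h : f'.val = 1 - f.val) :
    logVec δ f' = fun i => -(f'⁻¹.val * f.val) * logVec δ f i := by
  funext i
  change f'⁻¹.val * (coordDerivation δ i).op f'.val =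
    -(f'⁻¹.val * f.val) * (f⁻¹.val * (coordDerivation δ i).op f.val)
  have h1 : f.val * f⁻¹.val = 1 := f.mul_inv
  rw [h, map_sub, Derivation.map_one_eq_zero]
  linear_combination (f'⁻¹.val * (coordDerivation δ i).op f.val) * h1

/-- The Steinberg relation for a monomial. -/
lemma formula_steinberg_monomial (hA : IsNilpotent (nilradical A)) {D E F : Factorization A}
    {u w : ℤ × ℤ} (hD : D.HasOrder u) (hF : F.HasOrder w) (hDa : D.a = 0) (hFa : F.a = 0)
    (hE : E.Decomposes (1 - C D.c.val * single (toLex u) 1))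
    (hu : u ≠ 0 ∨ IsUnit (1 - D.c.val)) : formula D E F = 1 ∧ formula E D F = 1 := by
  have key : ∀ {v : ℤ × ℤ}, E.HasOrder v → tame u v w D.c E.c F.c = 1 →
      tame v u w E.c D.c F.c = 1 → formula D E F = 1 ∧ formula E D F = 1 := by
    intro v hv h1 h2
    rw [formula_eq_tame_of_terms hD hv hF, formula_eq_tame_of_terms hv hD hF]
    · exact ⟨h1, h2⟩
    all_goals simp only [hDa, hFa, Pi.zero_apply, true_or, or_true, implies_true]
  rcases lt_trichotomy (toLex u) 0 with h | h | h
  · have hpos : 0 < toLex (-u) := by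
      rw [toLex_neg]; exact neg_pos.2 h
    have hE' : E = Factorization.binomial (-D.c) u hpos (D.c⁻¹).val := by
      refine Factorization.decomposes_unique hA hE ?_
      convert Factorization.decomposes_binomial using 1
      have h1 : C D.c.val * single (toLex (-u)) (D.c⁻¹).val * single (toLex u) 1 =
          (1 : HahnSeries LexZ A) := by
        rw [C_apply, single_mul_single, single_mul_single, toLex_neg, zero_add, neg_add_cancel,
          mul_one, Units.mul_inv]
        rfl
      rw [Units.val_neg, map_neg]
      linear_combination -h1
    rw [hE'] at key ⊢
    exact key Factorization.hasOrder_binomial (tame_self_neg u w D.c F.c)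
      (tame_neg_self u w D.c F.c)
  · have hu0 : u = 0 := h
    subst hu0
    have h1 := hu.resolve_left (fun h => h rfl)
    have hE' : E = Factorization.ofMonomial h1.unit 0 := by
      refine Factorization.decomposes_unique hA hE ?_
      convert Factorization.decomposes_ofMonomial h1.unit 0 using 1
      have : single (toLex (0 : ℤ × ℤ)) (1 : A) = 1 := rfl
      rw [this, mul_one, mul_one, IsUnit.unit_spec, map_sub, map_one]
    rw [hE'] at key ⊢
    exact key (Factorization.hasOrder_ofMonomial _ _) (tame_zero_zero ..) (tame_zero_zero ..)
  · have hE' : E = Factorization.binomial 1 0 h D.c.val := by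
      refine Factorization.decomposes_unique hA hE ?_
      convert Factorization.decomposes_binomial using 1
      have h1 : single (toLex (0 : ℤ × ℤ)) (1 : A) = 1 := rfl
      rw [h1, mul_one, Units.val_one, RingHom.map_one, one_mul, C_apply, single_mul_single,
        zero_add, mul_one]
    rw [hE'] at key ⊢
    exact key Factorization.hasOrder_binomial (tame_zero_mid u w D.c F.c)
      (tame_zero_left u w D.c F.c)

/-- Up to nilpotents, the lowest relevant coefficient of `1 - f` is `-c`, `1 - c` or `1` for `u`
negative, zero or positive. -/
lemma isUnit_one_sub_of_decomposes (hA : IsNilpotent (nilradical A)) {D : Factorization A}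
    {u : ℤ × ℤ} (hD : D.HasOrder u) {f : HahnSeries LexZ A} (hf : D.Decomposes f)
    (hu : u ≠ 0 ∨ IsUnit (1 - D.c.val)) : IsUnit (1 - f) := by
  have hadd : ∀ {x y : A}, IsUnit x → y ∈ nilradical A → IsUnit (x - y) := by
    intro x y hx hy
    have := (mem_nilradical.1 (neg_mem hy)).isUnit_add_left_of_commute hx (Commute.all _ _)
    rwa [← sub_eq_add_neg] at this
  have hc := Factorization.coeff_order_sub_mem hD hf
  have hlt : ∀ z < toLex u, z < 0 → (1 - f).coeff z ∈ nilradical A := by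
    intro z hz hz0
    rw [coeff_sub, coeff_one, if_neg hz0.ne, zero_sub]
    exact neg_mem (Factorization.coeff_of_lt_order hD hf hz)
  rcases lt_trichotomy (toLex u) 0 with h | h | h
  · refine isUnit_of_coeff_isUnit_of_mem hA (x := toLex u) ?_ fun z hz => hlt z hz (hz.trans h)
    rw [coeff_sub, coeff_one, if_neg h.ne, zero_sub]
    have := hadd D.c.isUnit.neg hc
    convert this using 1
    ring
  · have hu0 : u = 0 := h
    subst hu0
    have h1 := hu.resolve_left (fun h => h rfl)
    refine isUnit_of_coeff_isUnit_of_mem hA (x := 0) ?_ fun z hz => hlt z hz hz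
    rw [coeff_sub, coeff_one, if_pos rfl]
    have := hadd h1 hc
    rwa [sub_sub_sub_cancel_right] at this
  · refine isUnit_of_coeff_isUnit_of_mem hA (x := 0) ?_ fun z hz => hlt z (hz.trans h) hz
    rw [coeff_sub, coeff_one, if_pos rfl]
    exact hadd isUnit_one (Factorization.coeff_of_lt_order hD hf h)

variable {V R : Type*} [CommRing V] [CommRing R]

/-- The condition on `u` and `D.c` ensures that `1 - f` remains a unit after deformation. Both
orders of `f` and `1 - f` are treated, since over a local ring the condition may hold only after
exchanging them. -/
lemma IsLift.formula_steinberg {π : V →+* R} (hπ : IsLift π) (hR : IsNilpotent (nilradical R))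
    {D E F : Factorization R} {f : HahnSeries LexZ R} (hf : D.Decomposes f)
    (hf' : E.Decomposes (1 - f)) {u w : ℤ × ℤ} (hD : D.HasOrder u) (hF : F.HasOrder w)
    (hu : u ≠ 0 ∨ IsUnit (1 - D.c.val)) : formula D E F = 1 ∧ formula E D F = 1 := by
  have hP := isNilpotent_nilradical_polynomial hπ.nilp
  obtain ⟨D', hD', zD, mD, c, hc, hcD⟩ := hπ.exists_deformation hD
  obtain ⟨F', hF', zF, mF, -⟩ := hπ.exists_deformation hF
  obtain ⟨g, hg⟩ := D'.exists_unit_decomposes hP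
  obtain ⟨h, hh⟩ := F'.exists_unit_decomposes hP
  have hc1 : u ≠ 0 ∨ IsUnit (1 - c.val) := by
    refine hu.imp_right fun h => hπ.isUnit _ ?_
    rwa [map_sub, map_one, hcD]
  have hc2 : u ≠ 0 ∨ IsUnit (1 - D'.c.val) := by
    refine hc1.imp_right fun h => ?_
    have := h.map (Polynomial.C : V →+* Polynomial V)
    rw [map_sub, map_one] at this
    rw [hc]
    exact this
  obtain ⟨g', hg'⟩ := isUnit_one_sub_of_decomposes hP hD' hg hc2
  obtain ⟨E', hE'⟩ := Factorization.exists_decomposes hP g'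
  obtain ⟨v, hE'o⟩ := E'.exists_hasOrder_of_prime (isPrime_nilradical_polynomial hπ.prime)
  have mE : E'.map (evalOne π) = E := by
    have e := hE'.map (evalOne π)
    rw [hg', map_sub, map_one, (hg.map (evalOne π)).unique (mD ▸ hf)] at e
    exact Factorization.decomposes_unique hR e hf'
  have zE : (E'.map (evalZero V)).Decomposes
      (1 - C (D'.map (evalZero V)).c.val * single (toLex u) 1) := by
    have e := hE'.map (evalZero V)
    rwa [hg', map_sub, map_one, (hg.map (evalZero V)).unique
      (Factorization.decomposes_of_a_eq_zero (hD'.map _) zD)] at e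
  have hc3 : u ≠ 0 ∨ IsUnit (1 - (D'.map (evalZero V)).c.val) := by
    refine hc2.imp_right fun h => ?_
    have := h.map (evalZero V)
    rw [map_sub, map_one] at this
    exact this
  obtain ⟨h1, h2⟩ := formula_steinberg_monomial hπ.nilp (hD'.map _) (hF'.map _) zD zF zE hc3
  constructor
  · have := map_evalOne_eq_one hπ.torsionFree π (W := formula D' E' F') (by
      rw [dlog_formula _ hP hg hE' hh hD' hE'o hF', logVec_one_sub _ hg', det3_proportional,
        coeff_zero]) (by rw [map_formula hP, h1])
    rwa [map_formula hP, mD, mE, mF] at this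
  · have := map_evalOne_eq_one hπ.torsionFree π (W := formula E' D' F') (by
      rw [dlog_formula _ hP hE' hg hh hE'o hD' hF', logVec_one_sub _ hg', det3_proportional_left,
        coeff_zero]) (by rw [map_formula hP, h2])
    rwa [map_formula hP, mD, mE, mF] at this

/-- The Steinberg relation over a local ring. -/
lemma formula_steinberg_of_isLocalRing [IsLocalRing R] (hR : IsNilpotent (nilradical R))
    {D E F : Factorization R} {f : HahnSeries LexZ R} (hf : D.Decomposes f)
    (hf' : E.Decomposes (1 - f)) : formula D E F = 1 := by
  obtain ⟨V, _, π, hπ⟩ := exists_isLift hR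
  obtain ⟨u, hD⟩ := D.exists_hasOrder_of_isLocalRing
  obtain ⟨v, hE⟩ := E.exists_hasOrder_of_isLocalRing
  obtain ⟨w, hF⟩ := F.exists_hasOrder_of_isLocalRing
  by_cases hu : u ≠ 0 ∨ IsUnit (1 - D.c.val)
  · exact (hπ.formula_steinberg hR hf hf' hD hF hu).1
  -- Now `f` has order zero and `1 - c` is not a unit, so `f` and `1 - f` exchange roles. If `1 - f`
  -- also had order zero, the two leading constants would add up to `1` modulo nilpotents, making `1
  -- - c` a unit.
  · rw [not_or, not_not] at hu
    refine (hπ.formula_steinberg hR hf' (by rwa [sub_sub_cancel]) hE hF (Or.inl ?_)).2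
    intro hv
    apply hu.2
    have h1 := Factorization.coeff_order_sub_mem hD hf
    have h2 := Factorization.coeff_order_sub_mem hE hf'
    rw [hu.1] at h1
    rw [hv, coeff_sub, coeff_one, if_pos toLex_zero] at h2
    have h3 := (mem_nilradical.1 (add_mem h1 h2)).isUnit_add_left_of_commute E.c.isUnit
      (Commute.all _ _)
    convert h3 using 1
    ring

end Steinberg

/-! ### Cyclic invariance -/

section Cyclic

variable {R : Type*} [CommRing R]

lemma SameSign.rotate {x y z : ℤ × ℤ} (h : SameSign x y z) : SameSign y z x :=
  h.imp (fun h => ⟨h.2.1, h.2.2, h.1⟩) fun h => ⟨h.2.1, h.2.2, h.1⟩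

lemma detGcd_rotate (x y z : ℤ × ℤ) : detGcd x y z = detGcd y z x := by
  unfold detGcd
  rw [Int.gcd_comm, Int.gcd_assoc]

lemma tExp_rotate {x y z : ℤ × ℤ} (h : SameSign x y z) : tExp x y z = tExp y z x := by
  rw [tExp, tExp, detGcd_rotate x y z]
  rcases h with h | h
  · rw [if_pos h.1, if_pos h.2.1]
  · rw [if_neg (lt_asymm h.1), if_neg (lt_asymm h.2.1)]

lemma symT_rotate (x y z : ℤ × ℤ) (a b c : R) : symT x y z a b c = symT y z x b c a := by
  by_cases h : SameSign x y z
  · rw [symT_of_sameSign h, symT_of_sameSign h.rotate, tExp_rotate h]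
    congr 1
    change a ^ ((det y z).natAbs / detGcd x y z) * b ^ ((det z x).natAbs / detGcd x y z) *
      c ^ ((det x y).natAbs / detGcd x y z) = b ^ ((det z x).natAbs / detGcd y z x) *
      c ^ ((det x y).natAbs / detGcd y z x) * a ^ ((det y z).natAbs / detGcd y z x)
    rw [detGcd_rotate x y z]
    ring
  · rw [symT_of_not_sameSign h, symT_of_not_sameSign fun h' => h h'.rotate.rotate]

lemma signExp_rotate (D E F : Factorization R) : signExp D E F = signExp E F D := by
  simp only [signExp, nu]
  ring

/-- The explicit formula is invariant under cyclic permutations. -/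
lemma formula_rotate (D E F : Factorization R) : formula D E F = formula E F D := by
  have hT : ∏ᶠ w, termT D E F w = ∏ᶠ w, termT E F D w := by
    let e : (ℤ × ℤ) × (ℤ × ℤ) × (ℤ × ℤ) ≃ (ℤ × ℤ) × (ℤ × ℤ) × (ℤ × ℤ) :=
      { toFun := fun w => (w.2.1, w.2.2, w.1)
        invFun := fun w => (w.2.2, w.1, w.2.1)
        left_inv := fun _ => rfl
        right_inv := fun _ => rfl }
    exact (finprod_congr fun w => symT_rotate _ _ _ _ _ _).trans
      (finprod_comp_equiv e (f := termT E F D))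
  rw [formula, formula, hT, signExp_rotate D E F]
  simp only [mul_assoc, mul_comm, mul_left_comm]

end Cyclic

/-! ### Reduction to local rings -/

section Globalization

variable {R : Type*} [CommRing R]

/-- A nilpotent fraction becomes, after multiplication by a suitable denominator, the image of a
nilpotent of `R`. So the nilradical of the localization is generated by the image of that of `R`. -/
lemma isNilpotent_nilradical_localization (hR : IsNilpotent (nilradical R)) (M : Submonoid R) :
    IsNilpotent (nilradical (Localization M)) := by
  obtain ⟨k, hk⟩ := hR
  have hle : nilradical (Localization M) ≤ (nilradical R).map (algebraMap R (Localization M)) := by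
    intro x hx
    obtain ⟨n, hn⟩ := mem_nilradical.1 hx
    obtain ⟨⟨r, s⟩, hrs⟩ := IsLocalization.surj M x
    have h0 : algebraMap R (Localization M) (r ^ n) = 0 := by
      rw [map_pow, ← hrs, mul_pow, hn, zero_mul]
    obtain ⟨m, hm⟩ := (IsLocalization.map_eq_zero_iff M (Localization M) _).1 h0
    have hnil : (m : R) * r ∈ nilradical R := by
      refine mem_nilradical.2 ⟨n + 1, ?_⟩
      calc ((m : R) * r) ^ (n + 1) = m ^ n * r * (m * r ^ n) := by ring
        _ = 0 := by rw [hm, mul_zero]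
    have hu : IsUnit (algebraMap R (Localization M) (m * s : M)) := IsLocalization.map_units _ _
    rw [← Ideal.mul_unit_mem_iff_mem _ hu]
    have : x * algebraMap R (Localization M) (m * s : M) =
        algebraMap R (Localization M) (m * r) := by
      rw [Submonoid.coe_mul, map_mul, map_mul, ← hrs]
      ring
    rw [this]
    exact Ideal.mem_map_of_mem _ hnil
  refine ⟨k, le_bot_iff.1 ((Ideal.pow_right_mono hle k).trans ?_)⟩
  rw [← Ideal.map_pow, hk]
  exact Ideal.map_bot.le

/-- Two units that agree in all local rings at maximal ideals are equal. -/
lemma units_eq_of_localization {x y : Rˣ}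
    (h : ∀ (P : Ideal R) (_ : P.IsMaximal),
      Units.map (algebraMap R (Localization.AtPrime P) : R →* Localization.AtPrime P) x =
      Units.map (algebraMap R (Localization.AtPrime P) : R →* Localization.AtPrime P) y) :
    x = y := by
  ext
  apply MaximalSpectrum.toPiLocalization_injective R
  funext P
  exact congrArg Units.val (h P.asIdeal P.isMaximal)

/-- Equality of units is checked at maximal ideals, and the formula commutes with localization. Over
a local ring all orders are constant, and a lift exists. -/
lemma formula_mul (hR : IsNilpotent (nilradical R)) {D₁ D₂ D E F : Factorization R}
    {f₁ f₂ : HahnSeries LexZ R} (h₁ : D₁.Decomposes f₁) (h₂ : D₂.Decomposes f₂)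
    (h₁₂ : D.Decomposes (f₁ * f₂)) : formula D E F = formula D₁ E F * formula D₂ E F := by
  refine units_eq_of_localization fun P _ => ?_
  have hP := isNilpotent_nilradical_localization hR P.primeCompl
  obtain ⟨V, _, π, hπ⟩ := exists_isLift hP
  rw [_root_.map_mul, map_formula hR, map_formula hR, map_formula hR]
  have e := h₁₂.map (algebraMap R (Localization.AtPrime P))
  rw [map_mul] at e
  exact hπ.formula_mul hP (h₁.map _) (h₂.map _) e
    (Factorization.exists_hasOrder_of_isLocalRing _).choose_spec
    (Factorization.exists_hasOrder_of_isLocalRing _).choose_spec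
    (Factorization.exists_hasOrder_of_isLocalRing _).choose_spec
    (Factorization.exists_hasOrder_of_isLocalRing _).choose_spec

lemma formula_steinberg (hR : IsNilpotent (nilradical R)) {D E F : Factorization R}
    {f : HahnSeries LexZ R} (hf : D.Decomposes f) (hf' : E.Decomposes (1 - f)) :
    formula D E F = 1 := by
  refine units_eq_of_localization fun P _ => ?_
  rw [map_formula hR, map_one]
  have e := hf'.map (algebraMap R (Localization.AtPrime P))
  rw [map_sub, map_one] at e
  exact formula_steinberg_of_isLocalRing (isNilpotent_nilradical_localization hR P.primeCompl)
    (hf.map _) e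

lemma factorization_decomposes (hR : IsNilpotent (nilradical R)) (f : (Iterated R)ˣ) :
    (factorization f).Decomposes (toHahn f.val) := by
  have h : ∃ D : Factorization R, D.Represents f := (existsUnique_represents hR f).exists
  rw [← Factorization.represents_iff hR, factorization, dif_pos h]
  exact h.choose_spec

lemma symbol_rotate (f g h : (Iterated R)ˣ) : symbol f g h = symbol g h f := formula_rotate ..

lemma symbol_mul (hR : IsNilpotent (nilradical R)) (f₁ f₂ g h : (Iterated R)ˣ) :
    symbol (f₁ * f₂) g h = symbol f₁ g h * symbol f₂ g h := by
  have e := factorization_decomposes hR (f₁ * f₂)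
  rw [Units.val_mul, map_mul] at e
  exact formula_mul hR (factorization_decomposes hR f₁) (factorization_decomposes hR f₂) e

lemma symbol_steinberg (hR : IsNilpotent (nilradical R)) {f f' : (Iterated R)ˣ}
    (h : f'.val = 1 - f.val) (g : (Iterated R)ˣ) : symbol f f' g = 1 := by
  have e := factorization_decomposes hR f'
  rw [h, map_sub, map_one] at e
  exact formula_steinberg hR (factorization_decomposes hR f) e

end Globalization

end ContouCarrere

end

open ContouCarrere in
/-- Let `R` be a commutative ring whose nilradical is a nilpotent ideal. Every unit of
`R((u))((t))` has exactly one product decomposition and the products in the explicit formula have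
only finitely many factors different from `1`, so that the two-dimensional Contou-Carrère symbol
is well defined; it is multiplicative in each argument and satisfies the Steinberg relations. -/
theorem mainTheorem7 {R : Type*} [CommRing R] (hR : IsNilpotent (nilradical R)) :
    (∀ f : (Iterated R)ˣ, ∃! D : Factorization R, D.Represents f) ∧
    (∀ D E F : Factorization R, (termT D E F).mulSupport.Finite ∧
      (termS D E).mulSupport.Finite ∧ (termQ D E).mulSupport.Finite) ∧
    (∀ f₁ f₂ g h : (Iterated R)ˣ, symbol (f₁ * f₂) g h = symbol f₁ g h * symbol f₂ g h) ∧
    (∀ f g₁ g₂ h : (Iterated R)ˣ, symbol f (g₁ * g₂) h = symbol f g₁ h * symbol f g₂ h) ∧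
    (∀ f g h₁ h₂ : (Iterated R)ˣ, symbol f g (h₁ * h₂) = symbol f g h₁ * symbol f g h₂) ∧
    (∀ f f' g : (Iterated R)ˣ, (f' : Iterated R) = 1 - (f : Iterated R) →
      symbol f f' g = 1 ∧ symbol f g f' = 1 ∧ symbol g f f' = 1) := by
  refine ⟨existsUnique_represents hR, fun D E F => ⟨finite_mulSupport_termT hR D E F,
    finite_mulSupport_termS hR D E, finite_mulSupport_termQ hR D E⟩, symbol_mul hR,
    fun f g₁ g₂ h => ?_, fun f g h₁ h₂ => ?_, fun f f' g h => ⟨symbol_steinberg hR h g, ?_, ?_⟩⟩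
  · rw [symbol_rotate f, symbol_mul hR, symbol_rotate f g₁, symbol_rotate f g₂]
  · rw [← symbol_rotate, symbol_mul hR, symbol_rotate, symbol_rotate h₂]
  -- After rotation the first two arguments are `1 - f` and `f`, and `f = 1 - (1 - f)`.
  · rw [← symbol_rotate]
    exact symbol_steinberg hR (by rw [h, sub_sub_cancel]) g
  · rw [symbol_rotate]
    exact symbol_steinberg hR h g
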